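/- Let $(\mathcal A,\varphi)$ be a tracial $*$-probability space, i.e. $\mathcal A$ is a unital $*$-algebra over $\mathbb C$ and $\varphi:\mathcal A\to\mathbb C$ is a unital linear functional with $\varphi(ab)=\varphi(ba)$ and $\varphi(a^*a)\ge 0$ for all $a,b\in\mathcal A$. A *test graph* in $\mathcal A$ is a finite, non-empty, connected multidigraph $T=(V,E)$ with edge labels in $\mathcal A$; a *graph monomial* in $\mathcal A$ is a test graph with two distinguished (possibly equal) vertices, the input and the output, and is considered up to isomorphism. Let $\mathbb C\mathcal G\langle\mathcal A\rangle$ be the complex vector space spanned by the graph monomials; it is a unital algebra, where $t\cdot t'$ is obtained by identifying the input of $t$ with the output of $t'$ (with output that of $t$ and input that of $t'$). The free $\mathcal G$-algebra generated by $\mathcal A$ is $\mathcal B=\mathcal G(\mathcal A)=\mathbb C\mathcal G\langle\mathcal A\rangle/\mathcal I$, where the two-sided ideal $\mathcal I$ is generated by all differences between a graph monomial having an edge labeled $P(b_1,\dots,b_n)$ (with $b_i\in\mathcal A$ and $P$ a non-commutative polynomial) and the graph polynomial obtained by substituting $P(\text{out}\xleftarrow{b_1}\text{in},\dots,\text{out}\xleftarrow{b_n}\text{in})$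 for that edge (input at its source, output at its target). Let $\kappa_n$ be the free cumulants of $(\mathcal A,\varphi)$. An *oriented cactus* is a test graph in which every edge lies in a unique simple (undirected) cycle and every such cycle, called a pad, is directed. For a test graph $T$, set $\tau^0_\varphi[T]=\prod_{C}\kappa(C)$ over the pads $C$ of $T$ if $T$ is an oriented cactus, where $\kappa(C)=\kappa_n[a_1,\dots,a_n]$ for the labels $a_1,\dots,a_n$ of $C$ read against its direction, and $\tau^0_\varphi[T]=0$ otherwise. Set $\tau_\varphi[T]=\sum_{\pi\in\mathcal P(V)}\tau_\varphi^0[T^\pi]$, where $T^\pi$ is obtained by identifying the vertices within each block of the partition $\pi$ of $V$. Then there is a (necessarily unique) linear functional $\psi:\mathcal B\to\mathbb C$ such that $\psi(t)=\tau_\varphi[\widetilde\Delta(t)]$ for every graph monomial $t$ in $\mathcal A$, where $\widetilde\Delta(t)$ is the test graph obtained from $t$ by identifying the input with the output and forgetting the roots. Moreover, let $(\mathcal A_i)_{i\in I}$ be a family of unital $*$-subalgebras of $\mathcal A$ that are freely independent in $(\mathcal A,\varphi)$, and let $\Delta(\mathcal B_i)=\Delta(\mathcal G(\mathcal A_i))\subset\mathcal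 B$ be the unital subalgebra spanned by the graph monomials with labels in $\mathcal A_i$ whose input and output coincide. Then the algebras $\Delta(\mathcal B_i)$ are commutative and $(\Delta(\mathcal B_i))_{i\in I}$ are classically independent in $(\mathcal B,\psi)$: $xy=yx$ for all $x\in\Delta(\mathcal B_i)$, $y\in\Delta(\mathcal B_j)$ with $i\ne j$, and $\psi(x_1\cdots x_n)=\psi(x_1)\cdots\psi(x_n)$ whenever $x_j\in\Delta(\mathcal B_{i(j)})$ with $i(1),\dots,i(n)$ pairwise distinct. -/

import Mathlib

open scoped ComplexOrder

noncomputable section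

universe u

/-! ### Free probability -/

namespace NCProb

variable {A : Type u} [Ring A] [Algebra ℂ A]

/-- Free independence of a family of unital subalgebras of `(A, φ)`: alternating products of
centered elements have expectation zero. -/
def FreelyIndependent {I : Type*} (φ : A →ₗ[ℂ] ℂ) (S : I → Subalgebra ℂ A) : Prop :=
  ∀ (n : ℕ) (i : Fin (n + 1) → I) (a : Fin (n + 1) → A),
    (∀ k : Fin n, i k.castSucc ≠ i k.succ) →
    (∀ j, a j ∈ S (i j)) → (∀ j, φ (a j) = 0) →
    φ (List.ofFn a).prod = 0

/-- Classical independence of a family of unital subalgebras of `(A, φ)`: distinct subalgebras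
commute, and the expectation factors over products of elements of distinct subalgebras. -/
def ClassicallyIndependent {I : Type*} (φ : A →ₗ[ℂ] ℂ) (S : I → Subalgebra ℂ A) : Prop :=
  (∀ i j, i ≠ j → ∀ a ∈ S i, ∀ b ∈ S j, a * b = b * a) ∧
  ∀ (n : ℕ) (i : Fin n → I) (a : Fin n → A),
    Function.Injective i → (∀ j, a j ∈ S (i j)) →
    φ (List.ofFn a).prod = ∏ j, φ (a j)

/-- A partition of a finite set of a linear order is non-crossing if there are no distinct blocks
`B`, `C` and `i < j < k < l` with `i, k ∈ B` and `j, l ∈ C`. -/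
def IsNonCrossing {ι : Type*} [LinearOrder ι] {s : Finset ι} (π : Finpartition s) : Prop :=
  ∀ B ∈ π.parts, ∀ C ∈ π.parts, B ≠ C →
    ∀ i ∈ B, ∀ j ∈ C, ∀ k ∈ B, ∀ l ∈ C, i < j → j < k → ¬ k < l

theorem block_card_lt {ι : Type*} [DecidableEq ι] {s : Finset ι} (π : Finpartition s)
    (h : π.parts ≠ {s}) {B : Finset ι} (hB : B ∈ π.parts) : B.card < s.card := by
  refine Finset.card_lt_card ((π.le hB).lt_of_ne ?_)
  rintro rfl
  refine h (Finset.eq_singleton_iff_unique_mem.2 ⟨hB, fun C hC => ?_⟩)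
  by_contra hne
  have hd : Disjoint C B := π.disjoint hC hB hne
  have hbot : C = ⊥ := by
    have h2 : C ≤ B := π.le hC
    exact disjoint_self.1 (hd.mono_right h2)
  exact π.ne_bot hC hbot

/-- The product of the `a i`, `i ∈ s`, in increasing order of the index. -/
def orderedProd {ι : Type*} [LinearOrder ι] (a : ι → A) (s : Finset ι) : A :=
  ((s.sort (· ≤ ·)).map a).prod

open Classical in
/-- The free cumulant `κ(s)[a] = κ_m[a_{i_1}, …, a_{i_m}]` for `s = {i_1 < ⋯ < i_m}`, defined by the
moment-cumulant recursion
`φ (a_{i_1} ⋯ a_{i_m}) = ∑ over non-crossing partitions σ of s of ∏ over blocks B of σ of κ(B)[a]`,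
solved for the term of the one-block partition. -/
def cumulantOn {ι : Type*} [LinearOrder ι] (φ : A →ₗ[ℂ] ℂ) (a : ι → A) (s : Finset ι) : ℂ :=
  φ (orderedProd a s) -
    ∑ σ ∈ ({σ : Finpartition s | IsNonCrossing σ ∧ σ.parts ≠ {s}} : Finset _).attach,
      ∏ B ∈ σ.1.parts.attach, cumulantOn φ a B.1
termination_by s.card
decreasing_by
  exact block_card_lt σ.1 (Finset.mem_filter.1 σ.2).2.2 B.2

/-- The `n`th free cumulant `κ_n[a_1, …, a_n]`. -/
def freeCumulant (φ : A →ₗ[ℂ] ℂ) {n : ℕ} (a : Fin n → A) : ℂ :=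
  cumulantOn φ a Finset.univ

end NCProb

/-! ### Graphs -/

namespace Traffic

/-- A test graph in `S`: a finite non-empty connected multidigraph with edge labels in `S`. -/
structure TestGraph (S : Type u) where
  V : Type
  E : Type
  [finV : Finite V]
  [finE : Finite E]
  src : E → V
  tgt : E → V
  label : E → S
  nonempty : Nonempty V
  /-- Any two vertices are joined by a path, regardless of the directions of the edges. -/
  connected : ∀ x y : V, Relation.EqvGen (fun x y => ∃ e, src e = x ∧ tgt e = y) x y

attribute [instance] TestGraph.finV TestGraph.finE

/-- A graph monomial in `S`: a bi-rooted test graph. -/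
structure GraphMonomial (S : Type u) extends TestGraph S where
  inp : V
  out : V

theorem eqvGen_map {α β : Type*} {r : α → α → Prop} {s : β → β → Prop} (f : α → β)
    (h : ∀ x y, r x y → Relation.EqvGen s (f x) (f y)) {x y : α} (hxy : Relation.EqvGen r x y) :
    Relation.EqvGen s (f x) (f y) := by
  induction hxy with
  | rel x y hr => exact h x y hr
  | refl x => exact .refl _
  | symm x y _ ih => exact .symm _ _ ih
  | trans x y z _ _ ih1 ih2 => exact .trans _ _ _ ih1 ih2

namespace TestGraph

variable {S : Type u}

/-- The quotient `T^π`: identify the vertices within each block of the partition `π` of `V`. -/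
def quot (T : TestGraph S) (π : Setoid T.V) : TestGraph S where
  V := Quotient π
  E := T.E
  src e := Quotient.mk π (T.src e)
  tgt e := Quotient.mk π (T.tgt e)
  label := T.label
  nonempty := T.nonempty.map (Quotient.mk π)
  connected := by
    intro x y
    induction x using Quotient.inductionOn with | _ x
    induction y using Quotient.inductionOn with | _ y
    refine eqvGen_map (Quotient.mk π) ?_ (T.connected x y)
    rintro x y ⟨e, rfl, rfl⟩
    exact .rel _ _ ⟨e, rfl, rfl⟩

/-- The edges `e 0, …, e n` are distinct and form a simple cycle, through the distinct vertices
`v 0, …, v n`, where directions are ignored and indices are cyclic; a loop is a cycle of length 1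
and two parallel or antiparallel edges form a cycle of length 2. A cycle is recorded by its set
of edges. -/
def IsSimpleCycle (T : TestGraph S) (C : Set T.E) : Prop :=
  ∃ (n : ℕ) (e : Fin (n + 1) → T.E) (v : Fin (n + 1) → T.V),
    Function.Injective e ∧ Function.Injective v ∧ Set.range e = C ∧
    ∀ i, (T.src (e i) = v i ∧ T.tgt (e i) = v (i + 1)) ∨
      (T.src (e i) = v (i + 1) ∧ T.tgt (e i) = v i)

/-- The edges `e 0, …, e n` form a directed simple cycle and are listed against the direction of
the cycle: `· ←(e 0) · ←(e 1) · ⋯ · ←(e n) ·`. -/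
def IsReading (T : TestGraph S) {n : ℕ} (e : Fin (n + 1) → T.E) : Prop :=
  Function.Injective (fun i => T.src (e i)) ∧ ∀ i, T.src (e i) = T.tgt (e (i + 1))

/-- The set of edges `C` is that of a directed simple cycle. -/
def IsDirectedCycle (T : TestGraph S) (C : Set T.E) : Prop :=
  ∃ p : (n : ℕ) × (Fin (n + 1) → T.E), T.IsReading p.2 ∧ Set.range p.2 = C

/-- Every edge belongs to a unique simple cycle. -/
def IsCactus (T : TestGraph S) : Prop :=
  ∀ e : T.E, ∃! C : Set T.E, T.IsSimpleCycle C ∧ e ∈ C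

/-- A cactus all of whose cycles are directed. -/
def IsOrientedCactus (T : TestGraph S) : Prop :=
  T.IsCactus ∧ ∀ C, T.IsSimpleCycle C → T.IsDirectedCycle C

/-- The pads of a cactus are its cycles. -/
def pads (T : TestGraph S) : Set (Set T.E) := {C | T.IsSimpleCycle C}

end TestGraph

/-! ### The traffic state of the universal enveloping traffic space -/

section State

variable {A : Type u} [Ring A] [Algebra ℂ A]

open Classical in
/-- The free cumulant `κ_n[a_1, …, a_n]` of the labels of a directed cycle, read against its
direction. For tracial `φ` it does not depend on the edge where the reading starts. -/
def padCumulant (φ : A →ₗ[ℂ] ℂ) (T : TestGraph A) (C : Set T.E) : ℂ :=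
  if h : T.IsDirectedCycle C then
    NCProb.freeCumulant φ (fun i => T.label (h.choose.2 i))
  else 0

open Classical in
/-- The injective traffic state `τ⁰_φ`. (The product is over a finite set.) -/
def injTrafficState (φ : A →ₗ[ℂ] ℂ) (T : TestGraph A) : ℂ :=
  if T.IsOrientedCactus then ∏ᶠ C ∈ T.pads, padCumulant φ T C else 0

/-- The traffic state `τ_φ[T] = ∑ τ⁰_φ[T^π]`, summed over all (finitely many) partitions `π` of the
vertices. -/
def trafficState (φ : A →ₗ[ℂ] ℂ) (T : TestGraph A) : ℂ :=
  ∑ᶠ π : Setoid T.V, injTrafficState φ (T.quot π)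

end State

/-! ### Graph monomials up to isomorphism and graph polynomials -/

namespace GraphMonomial

variable {S : Type u}

/-- The test graph obtained by identifying the input with the output and forgetting the roots. -/
def closure (t : GraphMonomial S) : TestGraph S :=
  t.toTestGraph.quot (Relation.EqvGen.setoid fun x y => x = t.inp ∧ y = t.out)

/-- Isomorphism of graph monomials. -/
def Iso (t t' : GraphMonomial S) : Prop :=
  ∃ (f : t.V ≃ t'.V) (g : t.E ≃ t'.E),
    (∀ e, f (t.src e) = t'.src (g e)) ∧ (∀ e, f (t.tgt e) = t'.tgt (g e)) ∧
    (∀ e, t.label e = t'.label (g e)) ∧ f t.inp = t'.inp ∧ f t.out = t'.out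

instance isoSetoid (S : Type u) : Setoid (GraphMonomial S) where
  r := Iso
  iseqv :=
    { refl := fun t => ⟨Equiv.refl _, Equiv.refl _, fun _ => rfl, fun _ => rfl, fun _ => rfl,
        rfl, rfl⟩
      symm := by
        rintro t t' ⟨f, g, h1, h2, h3, h4, h5⟩
        refine ⟨f.symm, g.symm, fun e => ?_, fun e => ?_, fun e => ?_, ?_, ?_⟩
        · rw [Equiv.symm_apply_eq, h1]; simp
        · rw [Equiv.symm_apply_eq, h2]; simp
        · rw [h3]; simp
        · rw [Equiv.symm_apply_eq, h4]
        · rw [Equiv.symm_apply_eq, h5]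
      trans := by
        rintro t t' t'' ⟨f, g, h1, h2, h3, h4, h5⟩ ⟨f', g', h1', h2', h3', h4', h5'⟩
        refine ⟨f.trans f', g.trans g', fun e => ?_, fun e => ?_, fun e => ?_, ?_, ?_⟩
        · simp [h1, h1']
        · simp [h2, h2']
        · simp [h3, h3']
        · simp [h4, h4']
        · simp [h5, h5'] }

/-- The trivial graph monomial: one vertex, no edge. -/
def triv : GraphMonomial S where
  V := Unit
  E := Empty
  src := Empty.elim
  tgt := Empty.elim
  label := Empty.elim
  nonempty := ⟨()⟩
  connected _ _ := .refl _
  inp := ()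
  out := ()

/-- The graph monomial `out ←a in`. -/
def edge (a : S) : GraphMonomial S where
  V := Bool
  E := Unit
  src _ := false
  tgt _ := true
  label _ := a
  nonempty := ⟨true⟩
  connected := by
    have h : Relation.EqvGen (fun x y : Bool => ∃ _ : Unit, false = x ∧ true = y) false true :=
      .rel _ _ ⟨(), rfl, rfl⟩
    rintro (_ | _) (_ | _)
    · exact .refl _
    · exact h
    · exact .symm _ _ h
    · exact .refl _
  inp := false
  out := true

/-- The product `out ←t · ←t' in`: identify the input of `t` with the output of `t'`. -/
def comp (t t' : GraphMonomial S) : GraphMonomial S where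
  V := Quot fun x y : t.V ⊕ t'.V => x = .inl t.inp ∧ y = .inr t'.out
  E := t.E ⊕ t'.E
  src := Sum.elim (fun e => Quot.mk _ (.inl (t.src e))) (fun e => Quot.mk _ (.inr (t'.src e)))
  tgt := Sum.elim (fun e => Quot.mk _ (.inl (t.tgt e))) (fun e => Quot.mk _ (.inr (t'.tgt e)))
  label := Sum.elim t.label t'.label
  nonempty := ⟨Quot.mk _ (.inl t.inp)⟩
  connected := by
    set q : t.V ⊕ t'.V → _ :=
      Quot.mk (fun x y : t.V ⊕ t'.V => x = .inl t.inp ∧ y = .inr t'.out) with hq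
    have hglue : q (.inl t.inp) = q (.inr t'.out) := Quot.sound ⟨rfl, rfl⟩
    have key : ∀ x, Relation.EqvGen (fun x y => ∃ e : t.E ⊕ t'.E,
        Sum.elim (fun e => q (.inl (t.src e))) (fun e => q (.inr (t'.src e))) e = x ∧
        Sum.elim (fun e => q (.inl (t.tgt e))) (fun e => q (.inr (t'.tgt e))) e = y)
        (q x) (q (.inl t.inp)) := by
      rintro (x | x)
      · refine eqvGen_map (fun x => q (.inl x)) ?_ (t.connected x t.inp)
        rintro x y ⟨e, rfl, rfl⟩
        exact .rel _ _ ⟨.inl e, rfl, rfl⟩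
      · rw [hglue]
        refine eqvGen_map (fun x => q (.inr x)) ?_ (t'.connected x t'.out)
        rintro x y ⟨e, rfl, rfl⟩
        exact .rel _ _ ⟨.inr e, rfl, rfl⟩
    intro x y
    induction x using Quot.inductionOn with | _ x
    induction y using Quot.inductionOn with | _ y
    exact .trans _ _ _ (key x) (.symm _ _ (key y))
  inp := Quot.mk _ (.inr t'.inp)
  out := Quot.mk _ (.inl t.out)

/-- Substitution of the graph monomial `m` for the edge `e₀` of `t`: remove `e₀` and install a copy
of `m` in its place, identifying the source of `e₀` with the input of `m` and the target of `e₀`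
with the output of `m`. -/
def subst (t : GraphMonomial S) (e₀ : t.E) (m : GraphMonomial S) : GraphMonomial S where
  V := Quot fun x y : t.V ⊕ m.V =>
    (x = .inl (t.src e₀) ∧ y = .inr m.inp) ∨ (x = .inl (t.tgt e₀) ∧ y = .inr m.out)
  E := {e : t.E // e ≠ e₀} ⊕ m.E
  src := Sum.elim (fun e => Quot.mk _ (.inl (t.src e.1))) (fun e => Quot.mk _ (.inr (m.src e)))
  tgt := Sum.elim (fun e => Quot.mk _ (.inl (t.tgt e.1))) (fun e => Quot.mk _ (.inr (m.tgt e)))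
  label := Sum.elim (fun e => t.label e.1) m.label
  nonempty := ⟨Quot.mk _ (.inl t.inp)⟩
  connected := by
    set q : t.V ⊕ m.V → _ := Quot.mk (fun x y : t.V ⊕ m.V =>
      (x = .inl (t.src e₀) ∧ y = .inr m.inp) ∨ (x = .inl (t.tgt e₀) ∧ y = .inr m.out)) with hq
    have hs : q (.inl (t.src e₀)) = q (.inr m.inp) := Quot.sound (.inl ⟨rfl, rfl⟩)
    have ht : q (.inl (t.tgt e₀)) = q (.inr m.out) := Quot.sound (.inr ⟨rfl, rfl⟩)
    set R : Quot _ → Quot _ → Prop := fun x y => ∃ e : {e : t.E // e ≠ e₀} ⊕ m.E,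
        Sum.elim (fun e => q (.inl (t.src e.1))) (fun e => q (.inr (m.src e))) e = x ∧
        Sum.elim (fun e => q (.inl (t.tgt e.1))) (fun e => q (.inr (m.tgt e))) e = y with hR
    have hm : ∀ x y, Relation.EqvGen R (q (.inr x)) (q (.inr y)) := by
      intro x y
      refine eqvGen_map (fun x => q (.inr x)) ?_ (m.connected x y)
      rintro x y ⟨e, rfl, rfl⟩
      exact .rel _ _ ⟨.inr e, rfl, rfl⟩
    have hT : ∀ x y, Relation.EqvGen R (q (.inl x)) (q (.inl y)) := by
      intro x y
      refine eqvGen_map (fun x => q (.inl x)) ?_ (t.connected x y)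
      rintro x y ⟨e, rfl, rfl⟩
      by_cases he : e = e₀
      · subst he
        rw [hs, ht]
        exact hm _ _
      · exact .rel _ _ ⟨.inl ⟨e, he⟩, rfl, rfl⟩
    have key : ∀ x, Relation.EqvGen R (q x) (q (.inl (t.src e₀))) := by
      rintro (x | x)
      · exact hT _ _
      · rw [hs]
        exact hm _ _
    intro x y
    induction x using Quot.inductionOn with | _ x
    induction y using Quot.inductionOn with | _ y
    exact .trans _ _ _ (key x) (.symm _ _ (key y))
  inp := Quot.mk _ (.inl t.inp)
  out := Quot.mk _ (.inl t.out)

theorem comp_iso {t₁ t₁' t₂ t₂' : GraphMonomial S} (h₁ : Iso t₁ t₁') (h₂ : Iso t₂ t₂') :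
    Iso (t₁.comp t₂) (t₁'.comp t₂') := by
  obtain ⟨f, g, h1, h2, h3, h4, h5⟩ := h₁
  obtain ⟨f', g', h1', h2', h3', h4', h5'⟩ := h₂
  refine ⟨Quot.congr (Equiv.sumCongr f f') ?_, Equiv.sumCongr g g', ?_, ?_, ?_, ?_, ?_⟩
  · rintro (x | x) (y | y) <;> simp [← h4, ← h5']
  · rintro (e | e)
    · exact congrArg (fun z => Quot.mk _ (Sum.inl z)) (h1 e)
    · exact congrArg (fun z => Quot.mk _ (Sum.inr z)) (h1' e)
  · rintro (e | e)
    · exact congrArg (fun z => Quot.mk _ (Sum.inl z)) (h2 e)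
    · exact congrArg (fun z => Quot.mk _ (Sum.inr z)) (h2' e)
  · rintro (e | e)
    · exact h3 e
    · exact h3' e
  · exact congrArg (fun z => Quot.mk _ (Sum.inr z)) h4'
  · exact congrArg (fun z => Quot.mk _ (Sum.inl z)) h5

theorem subst_iso (t : GraphMonomial S) (e₀ : t.E) {m m' : GraphMonomial S} (h : Iso m m') :
    Iso (t.subst e₀ m) (t.subst e₀ m') := by
  obtain ⟨f, g, h1, h2, h3, h4, h5⟩ := h
  refine ⟨Quot.congr (Equiv.sumCongr (Equiv.refl _) f) ?_,
    Equiv.sumCongr (Equiv.refl _) g, ?_, ?_, ?_, rfl, rfl⟩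
  · rintro (x | x) (y | y) <;> simp [← h4, ← h5]
  · rintro (e | e)
    · rfl
    · exact congrArg (fun z => Quot.mk _ (Sum.inr z)) (h1 e)
  · rintro (e | e)
    · rfl
    · exact congrArg (fun z => Quot.mk _ (Sum.inr z)) (h2 e)
  · rintro (e | e)
    · rfl
    · exact h3 e

theorem triv_comp_iso (t : GraphMonomial S) : Iso (triv.comp t) t := by
  refine ⟨⟨Quot.lift (Sum.elim (fun _ => t.out) id) ?_, fun x => Quot.mk _ (.inr x), ?_, ?_⟩,
    Equiv.emptySum Empty t.E, ?_, ?_, ?_, rfl, rfl⟩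
  · rintro _ _ ⟨rfl, rfl⟩; rfl
  · rintro ⟨x | x⟩
    · exact (Quot.sound ⟨rfl, rfl⟩ : Quot.mk _ (Sum.inl x) = Quot.mk _ (Sum.inr t.out)).symm
    · rfl
  · intro x; rfl
  · rintro (e | e); exact e.elim; rfl
  · rintro (e | e); exact e.elim; rfl
  · rintro (e | e); exact e.elim; rfl

theorem comp_triv_iso (t : GraphMonomial S) : Iso (t.comp triv) t := by
  refine ⟨⟨Quot.lift (Sum.elim id (fun _ => t.inp)) ?_, fun x => Quot.mk _ (.inl x), ?_, ?_⟩,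
    Equiv.sumEmpty t.E Empty, ?_, ?_, ?_, rfl, rfl⟩
  · rintro _ _ ⟨rfl, rfl⟩; rfl
  · rintro ⟨x | x⟩
    · rfl
    · exact Quot.sound (r := fun x y : t.V ⊕ Unit => x = .inl t.inp ∧ y = .inr ()) ⟨rfl, rfl⟩
  · intro x; rfl
  · rintro (e | e); rfl; exact e.elim
  · rintro (e | e); rfl; exact e.elim
  · rintro (e | e); rfl; exact e.elim

theorem comp_assoc_iso (t₁ t₂ t₃ : GraphMonomial S) :
    Iso ((t₁.comp t₂).comp t₃) (t₁.comp (t₂.comp t₃)) := by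
  refine ⟨⟨
    Quot.lift (Sum.elim
      (Quot.lift (Sum.elim (fun x => Quot.mk _ (.inl x))
        (fun x => Quot.mk _ (.inr (Quot.mk _ (.inl x))))) ?_)
      (fun x => Quot.mk _ (.inr (Quot.mk _ (.inr x))))) ?_,
    Quot.lift (Sum.elim (fun x => Quot.mk _ (.inl (Quot.mk _ (.inl x))))
      (Quot.lift (Sum.elim (fun x => Quot.mk _ (.inl (Quot.mk _ (.inr x))))
        (fun x => Quot.mk _ (.inr x))) ?_)) ?_, ?_, ?_⟩,
    Equiv.sumAssoc _ _ _, ?_, ?_, ?_, rfl, rfl⟩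
  · rintro _ _ ⟨rfl, rfl⟩
    exact Quot.sound ⟨rfl, rfl⟩
  · rintro _ _ ⟨rfl, rfl⟩
    exact congrArg (fun z => Quot.mk _ (Sum.inr z)) (Quot.sound ⟨rfl, rfl⟩)
  · rintro _ _ ⟨rfl, rfl⟩
    exact Quot.sound ⟨rfl, rfl⟩
  · rintro _ _ ⟨rfl, rfl⟩
    exact congrArg (fun z => Quot.mk _ (Sum.inl z)) (Quot.sound ⟨rfl, rfl⟩)
  · intro z
    induction z using Quot.inductionOn with | _ z
    rcases z with z | x
    · induction z using Quot.inductionOn with | _ z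
      rcases z with x | x <;> rfl
    · rfl
  · intro z
    induction z using Quot.inductionOn with | _ z
    rcases z with x | z
    · rfl
    · induction z using Quot.inductionOn with | _ z
      rcases z with x | x <;> rfl
  · rintro ((e | e) | e) <;> rfl
  · rintro ((e | e) | e) <;> rfl
  · rintro ((e | e) | e) <;> rfl

/-- `t` is a diagonal graph monomial (input = output) with labels in `D`. -/
def IsDiagonalIn (D : Set S) (t : GraphMonomial S) : Prop :=
  t.inp = t.out ∧ ∀ e, t.label e ∈ D

theorem IsDiagonalIn.comp {D : Set S} {t t' : GraphMonomial S} (h : t.IsDiagonalIn D)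
    (h' : t'.IsDiagonalIn D) : (t.comp t').IsDiagonalIn D := by
  refine ⟨?_, ?_⟩
  · change Quot.mk _ (Sum.inr t'.inp) = Quot.mk _ (Sum.inl t.out)
    rw [h'.1, ← h.1]
    exact (Quot.sound ⟨rfl, rfl⟩ : Quot.mk _ (Sum.inl t.inp) = Quot.mk _ (Sum.inr t'.out)).symm
  · rintro (e | e)
    · exact h.2 e
    · exact h'.2 e

end GraphMonomial

/-- Graph monomials in `S` up to isomorphism. -/
def Monomial (S : Type u) : Type (max 1 u) := Quotient (GraphMonomial.isoSetoid S)

namespace Monomial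

variable {S : Type u}

def mk (t : GraphMonomial S) : Monomial S := Quotient.mk _ t

instance : Monoid (Monomial S) where
  mul := Quotient.map₂ GraphMonomial.comp fun _ _ h _ _ h' => GraphMonomial.comp_iso h h'
  one := mk GraphMonomial.triv
  mul_assoc := by
    rintro ⟨a⟩ ⟨b⟩ ⟨c⟩
    exact Quotient.sound (GraphMonomial.comp_assoc_iso a b c)
  one_mul := by
    rintro ⟨a⟩
    exact Quotient.sound (GraphMonomial.triv_comp_iso a)
  mul_one := by
    rintro ⟨a⟩
    exact Quotient.sound (GraphMonomial.comp_triv_iso a)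

/-- Substitution for the edge `e₀` of `t`, on isomorphism classes. -/
def subst (t : GraphMonomial S) (e₀ : t.E) : Monomial S → Monomial S :=
  Quotient.map (t.subst e₀) fun _ _ h => GraphMonomial.subst_iso t e₀ h

end Monomial

/-- The graph polynomials `ℂ𝒢⟨S⟩`: formal linear combinations of graph monomials in `S`. -/
abbrev GraphPoly (S : Type u) : Type (max 1 u) := MonoidAlgebra ℂ (Monomial S)

/-- A graph monomial as a graph polynomial. -/
def GraphPoly.of {S : Type u} (t : GraphMonomial S) : GraphPoly S :=
  MonoidAlgebra.single (Monomial.mk t) 1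

/-- Substitution of a graph polynomial for the edge `e₀` of `t`, extended linearly from graph
monomials. -/
def GraphPoly.subst {S : Type u} (t : GraphMonomial S) (e₀ : t.E) :
    GraphPoly S →ₗ[ℂ] GraphPoly S :=
  MonoidAlgebra.mapDomainLinearMap ℂ ℂ (Monomial.subst t e₀)

/-! ### The free `𝒢`-algebra generated by `A` -/

section UE

variable (A : Type u) [Ring A] [Algebra ℂ A]

/-- The relations of the free `𝒢`-algebra generated by `A`: an edge labeled by
`a = P(b_1, …, b_n)`, `P` a non-commutative polynomial, may be replaced by the graph polynomial
`P(out ←b_1 in, …, out ←b_n in)`. -/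
inductive UERel : GraphPoly A → GraphPoly A → Prop
  | of (t : GraphMonomial A) (e₀ : t.E) (n : ℕ) (b : Fin n → A) (P : FreeAlgebra ℂ (Fin n))
      (h : t.label e₀ = FreeAlgebra.lift ℂ b P) :
      UERel (GraphPoly.of t)
        (GraphPoly.subst t e₀
          (FreeAlgebra.lift ℂ (fun i => GraphPoly.of (GraphMonomial.edge (b i))) P))

/-- The free `𝒢`-algebra `𝒢(A) = ℂ𝒢⟨A⟩ / 𝓘`, with `𝓘` the two-sided ideal generated by the
differences of related graph polynomials. -/
abbrev UE : Type (max 1 u) := RingQuot (UERel A)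

variable {A}

/-- The class of a graph monomial in `𝒢(A)`. -/
def UE.mk (t : GraphMonomial A) : UE A := RingQuot.mkAlgHom ℂ (UERel A) (GraphPoly.of t)

theorem UE.mk_mul (t t' : GraphMonomial A) : UE.mk t * UE.mk t' = UE.mk (t.comp t') := by
  unfold UE.mk GraphPoly.of
  rw [← map_mul, MonoidAlgebra.single_mul_single, one_mul]
  rfl

theorem UE.mk_triv : UE.mk (GraphMonomial.triv : GraphMonomial A) = 1 := by
  unfold UE.mk GraphPoly.of
  exact map_one (RingQuot.mkAlgHom ℂ (UERel A))

/-- The diagonal algebra `Δ(𝒢(D))` inside `𝒢(A)`, for a unital subalgebra `D` of `A`: the span of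
the diagonal graph monomials with labels in `D`. -/
def diagonalAlgebra (D : Subalgebra ℂ A) : Subalgebra ℂ (UE A) :=
  (Submodule.span ℂ {x : UE A | ∃ t : GraphMonomial A, t.IsDiagonalIn D ∧ UE.mk t = x}).toSubalgebra
    (Submodule.subset_span ⟨GraphMonomial.triv, ⟨rfl, fun e => e.elim⟩, UE.mk_triv⟩)
    (by
      intro x y hx hy
      have hxy := Submodule.mul_mem_mul hx hy
      rw [Submodule.span_mul_span] at hxy
      refine Submodule.span_mono ?_ hxy
      rintro _ ⟨_, ⟨t, ht, rfl⟩, _, ⟨t', ht', rfl⟩, rfl⟩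
      exact ⟨t.comp t', ht.comp ht', (UE.mk_mul t t').symm⟩)

/-- `ψ` is the trace on `𝒢(A)` induced by the traffic state: `ψ(t) = τ_φ[Δ̃(t)]` for every graph
monomial `t` in `A`. As graph monomials span `𝒢(A)`, there is at most one such `ψ`. -/
def IsInducedTrace (φ : A →ₗ[ℂ] ℂ) (ψ : UE A →ₗ[ℂ] ℂ) : Prop :=
  ∀ t : GraphMonomial A, ψ (UE.mk t) = trafficState φ t.closure

end UE

end Traffic

end

/-!
The traffic state is rewritten as a sum over permutations of the edges. If `T^π` is an oriented
cactus, let `ρ e` be the edge of the pad of `e` that ends where `e` starts. Then `π` is determined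
by `ρ`, as the partition generated by `src e ∼ tgt (ρ e)`, and `τ⁰[T^π]` is the product of the free
cumulants of the labels along the orbits of `ρ`. Hence `τ[T]` is the sum of these products over all
permutations `ρ` such that `T^π`, with `π` generated by `ρ`, is a cactus with pads the orbits of
`ρ` (`trafficState_eq_cactusSum`). The set of these cactus permutations depends only on the linear
space of the pairs `(f ∘ src, f ∘ tgt)`, `f` a rational function on the vertices
(`IsCactusPerm`): the cactus condition says that the incidence graph of vertices and pads is a tree,
that is, connected and with every function on its edges a coboundary. This encoding makes it
unnecessary to construct graphs and their isomorphisms, since gluing graphs amounts to equating the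
values of such functions.

Two elementary facts on oriented cacti underlie the translation. A simple cycle is a flow, and all
coboundaries, hence all functions `h - h ∘ ρ`, are orthogonal to it, so that it is an orbit of `ρ`
(`TestGraph.IsSimpleCycle.exists_eq_orbitSet`). Conversely, the support of a flow contains a simple
cycle (`TestGraph.exists_isSimpleCycle_of_flow`), so that all flows on an oriented cactus are
combinations of its pads, and every function with sum zero on each pad is a coboundary
(`TestGraph.IsOrientedCactus.exists_isCactusPerm`).

The trace exists because the sum over cactus permutations is compatible with the relations of the
free `𝒢`-algebra. It is linear in each label (`cactusSum_add_smul`). An edge labelled `1` can be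
contracted, since free cumulants of length at least two with an entry `1` vanish (`cactusSum_one`).
An edge labelled `x * y` can be subdivided (`cactusSum_pathData`): a cactus permutation of the
subdivided graph either visits the two new edges one after the other or arises from one that does so
by cutting an orbit in two, which is matched by the formula for free cumulants with products as
entries (`NCProb.listCumulant_mul_cons`). An induction on the non-commutative
polynomial gives all relations (`evaluates_lift`).

Two diagonal graph monomials commute, as both products consist of the two graphs with a common
vertex. If the labels of the two graphs belong to different free algebras, mixed free cumulants
vanish (`NCProb.listCumulant_eq_zero_of_mixed`), so that only permutations preserving both sets of
edges contribute, and the sum over these is a product (`cactusSum_comp`). This is the asserted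
factorization of `ψ`, for one factor at a time.
-/

noncomputable section

namespace NCProb

/-! ### The moment-cumulant formula -/

open scoped Classical in
/-- The non-crossing partitions of `s`. -/
def ncPartitions {ι : Type*} [LinearOrder ι] (s : Finset ι) : Finset (Finpartition s) :=
  {σ | IsNonCrossing σ}

theorem mem_ncPartitions {ι : Type*} [LinearOrder ι] {s : Finset ι} {σ : Finpartition s} :
    σ ∈ ncPartitions s ↔ IsNonCrossing σ := by
  simp [ncPartitions]

theorem indiscrete_mem_ncPartitions {ι : Type*} [LinearOrder ι] {s : Finset ι} (hs : s ≠ ⊥) :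
    Finpartition.indiscrete hs ∈ ncPartitions s := by
  rw [mem_ncPartitions]
  intro B hB C hC hne
  rw [Finpartition.indiscrete_parts, Finset.mem_singleton] at hB hC
  exact absurd (hB.trans hC.symm) hne

/-- A sum over non-crossing partitions, with the term of the one-block partition split off. -/
theorem sum_ncPartitions_eq_add {ι : Type*} [LinearOrder ι] {s : Finset ι} (hs : s.Nonempty)
    (f : Finset ι → ℂ) :
    ∑ σ ∈ ncPartitions s, ∏ B ∈ σ.parts, f B =
      f s + ∑ σ ∈ ncPartitions s with σ.parts ≠ {s}, ∏ B ∈ σ.parts, f B := by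
  have h1 : {σ ∈ ncPartitions s | σ.parts = {s}} =
      {Finpartition.indiscrete (Finset.nonempty_iff_ne_empty.1 hs)} := by
    ext σ
    simp only [Finset.mem_filter, Finset.mem_singleton]
    constructor
    · rintro ⟨-, h⟩
      exact Finpartition.ext (by rw [h, Finpartition.indiscrete_parts])
    · rintro rfl
      exact ⟨indiscrete_mem_ncPartitions _, Finpartition.indiscrete_parts _⟩
  rw [← Finset.sum_filter_add_sum_filter_not (ncPartitions s) (fun σ => σ.parts = {s}), h1,
    Finset.sum_singleton, Finpartition.indiscrete_parts, Finset.prod_singleton]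

variable {A : Type*} [Ring A] {ι : Type*} [LinearOrder ι]

theorem sort_insert_first {s : Finset ι} {x : ι} (h : ∀ y ∈ s, x < y) :
    (insert x s).sort (· ≤ ·) = x :: s.sort (· ≤ ·) :=
  Finset.sort_insert _ (fun y hy => (h y hy).le) fun hx => lt_irrefl _ (h x hx)

theorem sort_insert_last {s : Finset ι} {x : ι} (h : ∀ y ∈ s, y < x) :
    (insert x s).sort (· ≤ ·) = s.sort (· ≤ ·) ++ [x] := by
  refine List.Perm.eq_of_pairwise (le := (· ≤ ·)) (fun a b _ _ => le_antisymm)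
    (Finset.pairwise_sort _ _) ?_ ?_
  · rw [List.pairwise_append]
    refine ⟨Finset.pairwise_sort _ _, by simp, ?_⟩
    intro a ha b hb
    rw [List.mem_singleton] at hb
    subst hb
    exact (h a ((Finset.mem_sort _).1 ha)).le
  · refine (List.perm_ext_iff_of_nodup (Finset.sort_nodup _ _) ?_).2 fun a => ?_
    · rw [List.nodup_append]
      refine ⟨Finset.sort_nodup _ _, List.nodup_singleton _, ?_⟩
      intro a ha b hb
      rw [List.mem_singleton] at hb
      subst hb
      exact (h a ((Finset.mem_sort _).1 ha)).ne
    · simp [or_comm]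

theorem sort_image_of_strictMonoOn {ι' : Type*} [LinearOrder ι'] {f : ι → ι'} {s : Finset ι}
    (h : StrictMonoOn f s) :
    (s.image f).sort (· ≤ ·) = (s.sort (· ≤ ·)).map f := by
  refine List.Perm.eq_of_pairwise (le := (· ≤ ·)) (fun a b _ _ => le_antisymm)
    (Finset.pairwise_sort _ _) ?_ ?_
  · rw [List.pairwise_map]
    refine List.Pairwise.imp_of_mem ?_ (Finset.pairwise_sort s (· ≤ ·))
    intro a b ha hb hab
    exact h.monotoneOn ((Finset.mem_sort _).1 ha) ((Finset.mem_sort _).1 hb) hab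
  · refine (List.perm_ext_iff_of_nodup (Finset.sort_nodup _ _) ?_).2 fun a => ?_
    · refine List.Nodup.map_on ?_ (Finset.sort_nodup _ _)
      intro a ha b hb hab
      exact h.injOn ((Finset.mem_sort _).1 ha) ((Finset.mem_sort _).1 hb) hab
    · simp

theorem orderedProd_image {ι' : Type*} [LinearOrder ι'] {f : ι → ι'} {s : Finset ι}
    (h : StrictMonoOn f s) (a : ι' → A) :
    orderedProd a (s.image f) = orderedProd (a ∘ f) s := by
  simp [orderedProd, sort_image_of_strictMonoOn h]

theorem orderedProd_insert_first (a : ι → A) {s : Finset ι} {x : ι} (h : ∀ y ∈ s, x < y) :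
    orderedProd a (insert x s) = a x * orderedProd a s := by
  simp [orderedProd, sort_insert_first h]

theorem orderedProd_insert_last (a : ι → A) {s : Finset ι} {x : ι} (h : ∀ y ∈ s, y < x) :
    orderedProd a (insert x s) = orderedProd a s * a x := by
  simp [orderedProd, sort_insert_last h]

theorem orderedProd_congr {a b : ι → A} {s : Finset ι} (h : ∀ x ∈ s, a x = b x) :
    orderedProd a s = orderedProd b s := by
  unfold orderedProd
  congr 1
  exact List.map_congr_left fun x hx => h x ((Finset.mem_sort _).1 hx)

variable [Algebra ℂ A]

theorem cumulantOn_eq (φ : A →ₗ[ℂ] ℂ) (a : ι → A) (s : Finset ι) :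
    cumulantOn φ a s = φ (orderedProd a s) -
      ∑ σ ∈ ncPartitions s with σ.parts ≠ {s}, ∏ B ∈ σ.parts, cumulantOn φ a B := by
  rw [cumulantOn]
  congr 1
  rw [Finset.sum_attach _ (fun σ : Finpartition s => ∏ B ∈ σ.parts.attach, cumulantOn φ a B.1)]
  refine Finset.sum_congr ?_ fun σ _ => Finset.prod_attach _ _
  ext σ
  simp [mem_ncPartitions]

/-- The moment-cumulant formula. -/
theorem map_orderedProd (φ : A →ₗ[ℂ] ℂ) (a : ι → A) {s : Finset ι} (hs : s.Nonempty) :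
    φ (orderedProd a s) = ∑ σ ∈ ncPartitions s, ∏ B ∈ σ.parts, cumulantOn φ a B := by
  rw [sum_ncPartitions_eq_add hs, cumulantOn_eq φ a s]
  ring

/-- The moment-cumulant formula determines the cumulants. -/
theorem cumulantOn_eq_of_forall (φ : A →ₗ[ℂ] ℂ) (a : ι → A) (g : Finset ι → ℂ) (s : Finset ι)
    (hs : s.Nonempty) (h : ∀ t ⊆ s, t.Nonempty →
      φ (orderedProd a t) = ∑ σ ∈ ncPartitions t, ∏ B ∈ σ.parts, g B) :
    cumulantOn φ a s = g s := by
  induction s using Finset.strongInduction with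
  | H s ih =>
    have h1 := h s subset_rfl hs
    rw [map_orderedProd φ a hs, sum_ncPartitions_eq_add hs, sum_ncPartitions_eq_add hs] at h1
    have h2 : ∑ σ ∈ ncPartitions s with σ.parts ≠ {s}, ∏ B ∈ σ.parts, cumulantOn φ a B =
        ∑ σ ∈ ncPartitions s with σ.parts ≠ {s}, ∏ B ∈ σ.parts, g B := by
      refine Finset.sum_congr rfl fun σ hσ => Finset.prod_congr rfl fun B hB => ?_
      have hlt := block_card_lt σ (Finset.mem_filter.1 hσ).2 hB
      have hsub : B ⊆ s := σ.le hB
      refine ih B (hsub.ssubset_of_ne ?_) (σ.nonempty_of_mem_parts hB)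
        fun t ht => h t (ht.trans hsub)
      rintro rfl
      exact lt_irrefl _ hlt
    rw [h2] at h1
    exact add_right_cancel h1

/-! ### Relabelling the index set -/

/-- The image of a partition under a map that is injective on the partitioned set. -/
def mapPartition {α β : Type*} [DecidableEq α] [DecidableEq β] {s : Finset α} (f : α → β)
    (hf : Set.InjOn f s) (π : Finpartition s) : Finpartition (s.image f) :=
  .ofExistsUnique (π.parts.image (Finset.image f))
    (by
      intro p hp
      obtain ⟨B, hB, rfl⟩ := Finset.mem_image.1 hp
      exact Finset.image_subset_image (π.le hB))
    (by
      intro b hb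
      obtain ⟨a, ha, rfl⟩ := Finset.mem_image.1 hb
      obtain ⟨B, hB, haB⟩ := π.exists_mem ha
      refine ⟨B.image f, ⟨Finset.mem_image_of_mem _ hB, Finset.mem_image_of_mem _ haB⟩, ?_⟩
      rintro p ⟨hp, hap⟩
      obtain ⟨C, hC, rfl⟩ := Finset.mem_image.1 hp
      obtain ⟨c, hc, hca⟩ := Finset.mem_image.1 hap
      have : c = a := hf (π.le hC hc) ha hca
      subst this
      rw [π.eq_of_mem_parts hC hB hc haB])
    (by
      intro h
      obtain ⟨B, hB, h⟩ := Finset.mem_image.1 h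
      exact π.ne_empty hB (Finset.image_eq_empty.1 h))

theorem mapPartition_parts {α β : Type*} [DecidableEq α] [DecidableEq β] {s : Finset α}
    (f : α → β) (hf : Set.InjOn f s) (π : Finpartition s) :
    (mapPartition f hf π).parts = π.parts.image (Finset.image f) := rfl

theorem image_injOn_powerset {α β : Type*} [DecidableEq β] {s : Finset α} {f : α → β}
    (hf : Set.InjOn f s) {B C : Finset α} (hB : B ⊆ s) (hC : C ⊆ s)
    (h : B.image f = C.image f) : B = C := by
  ext x
  constructor
  · intro hx
    obtain ⟨y, hy, hyx⟩ := Finset.mem_image.1 (h ▸ Finset.mem_image_of_mem f hx)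
    rwa [← hf (hC hy) (hB hx) hyx]
  · intro hx
    obtain ⟨y, hy, hyx⟩ := Finset.mem_image.1 (h ▸ Finset.mem_image_of_mem f hx)
    rwa [← hf (hB hy) (hC hx) hyx]

theorem mapPartition_bijective {α β : Type*} [DecidableEq α] [DecidableEq β] {s : Finset α}
    (f : α → β) (hf : Set.InjOn f s) : Function.Bijective (mapPartition f hf) := by
  constructor
  · intro π π' h
    have h' : π.parts.image (Finset.image f) = π'.parts.image (Finset.image f) :=
      congrArg Finpartition.parts h
    have key : ∀ σ σ' : Finpartition s,
        σ.parts.image (Finset.image f) = σ'.parts.image (Finset.image f) →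
        σ.parts ⊆ σ'.parts := by
      intro σ σ' h B hB
      obtain ⟨C, hC, hCB⟩ := Finset.mem_image.1 (h ▸ Finset.mem_image_of_mem _ hB)
      rwa [← image_injOn_powerset hf (σ'.le hC) (σ.le hB) hCB]
    exact Finpartition.ext (Finset.Subset.antisymm (key _ _ h') (key _ _ h'.symm))
  · intro τ
    have hback : ∀ D ∈ τ.parts, (s.filter (f · ∈ D)).image f = D := by
      intro D hD
      ext y
      simp only [Finset.mem_image, Finset.mem_filter]
      constructor
      · rintro ⟨x, ⟨-, hx⟩, rfl⟩
        exact hx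
      · intro hy
        obtain ⟨x, hx, rfl⟩ := Finset.mem_image.1 (τ.le hD hy)
        exact ⟨x, ⟨hx, hy⟩, rfl⟩
    refine ⟨.ofExistsUnique (τ.parts.image fun D => s.filter (f · ∈ D)) ?_ ?_ ?_, ?_⟩
    · intro p hp
      obtain ⟨D, -, rfl⟩ := Finset.mem_image.1 hp
      exact Finset.filter_subset _ _
    · intro a ha
      obtain ⟨D, hD, haD⟩ := τ.exists_mem (Finset.mem_image_of_mem f ha)
      refine ⟨s.filter (f · ∈ D), ⟨Finset.mem_image_of_mem _ hD, by simp [ha, haD]⟩, ?_⟩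
      rintro p ⟨hp, hap⟩
      obtain ⟨D', hD', rfl⟩ := Finset.mem_image.1 hp
      rw [τ.eq_of_mem_parts hD' hD (Finset.mem_filter.1 hap).2 haD]
    · intro h
      obtain ⟨D, hD, h⟩ := Finset.mem_image.1 h
      apply τ.ne_empty hD
      rw [← hback D hD, h, Finset.image_empty]
    · refine Finpartition.ext ?_
      rw [mapPartition_parts]
      change (τ.parts.image fun D => s.filter (f · ∈ D)).image (Finset.image f) = τ.parts
      rw [Finset.image_image]
      exact (Finset.image_congr hback).trans Finset.image_id

theorem prod_mapPartition {α β : Type*} [DecidableEq α] [DecidableEq β] {s : Finset α}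
    (f : α → β) (hf : Set.InjOn f s) (π : Finpartition s) (F : Finset β → ℂ) :
    ∏ B ∈ (mapPartition f hf π).parts, F B = ∏ B ∈ π.parts, F (B.image f) := by
  rw [mapPartition_parts, Finset.prod_image]
  intro B hB C hC h
  exact image_injOn_powerset hf (π.le hB) (π.le hC) h

/-- `f` is injective on `s` and preserves the cyclic order of the elements of `s`, in the special
case that it moves the last element `m` (if `m ∈ s`) to the front and is increasing elsewhere. -/
structure IsRotationOn {ι ι' : Type*} [LinearOrder ι] [LinearOrder ι'] (f : ι → ι') (m : ι)
    (s : Finset ι) : Prop where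
  le : ∀ x ∈ s, x ≤ m
  mono : ∀ x ∈ s, ∀ y ∈ s, x < y → y < m → f x < f y
  last : ∀ x ∈ s, x < m → m ∈ s → f m < f x

namespace IsRotationOn

variable {ι' : Type*} [LinearOrder ι'] {f : ι → ι'} {m : ι} {s : Finset ι}

theorem subset (h : IsRotationOn f m s) {t : Finset ι} (hts : t ⊆ s) : IsRotationOn f m t :=
  ⟨fun x hx => h.le x (hts hx), fun x hx y hy => h.mono x (hts hx) y (hts hy),
    fun x hx hxm hm => h.last x (hts hx) hxm (hts hm)⟩

theorem ne_of_lt (h : IsRotationOn f m s) {x y : ι} (hx : x ∈ s) (hy : y ∈ s) (hxy : x < y) :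
    f x ≠ f y := by
  rcases (h.le y hy).lt_or_eq with hym | rfl
  · exact (h.mono x hx y hy hxy hym).ne
  · exact (h.last x hx hxy hy).ne'

theorem injOn (h : IsRotationOn f m s) : Set.InjOn f s := by
  intro x hx y hy hxy
  rcases lt_trichotomy x y with h1 | h1 | h1
  · exact absurd hxy (h.ne_of_lt hx hy h1)
  · exact h1
  · exact absurd hxy.symm (h.ne_of_lt hy hx h1)

/-- Non-crossing partitions are defined in terms of the cyclic order alone: a crossing
`i < j < k < l` with `l = m` becomes the crossing `f l < f i < f j < f k`. -/
theorem isNonCrossing_iff (h : IsRotationOn f m s) (π : Finpartition s) :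
    IsNonCrossing (mapPartition f h.injOn π) ↔ IsNonCrossing π := by
  have mono' : ∀ x ∈ s, ∀ y ∈ s, x < m → y < m → f x < f y → x < y := by
    intro x hx y hy hxm hym hlt
    by_contra hle
    rcases (not_lt.1 hle).lt_or_eq with h1 | rfl
    · exact lt_asymm hlt (h.mono y hy x hx h1 hxm)
    · exact lt_irrefl _ hlt
  have last' : ∀ x ∈ s, ∀ y ∈ s, f x < f y → y < m := by
    intro x hx y hy hlt
    rcases (h.le y hy).lt_or_eq with h1 | rfl
    · exact h1
    · rcases (h.le x hx).lt_or_eq with h2 | rfl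
      · exact absurd hlt (h.last x hx h2 hy).not_gt
      · exact absurd hlt (lt_irrefl _)
  constructor
  · intro hn B hB C hC hne i hi j hj k hk l hl hij hjk hkl
    have hiS := π.le hB hi
    have hjS := π.le hC hj
    have hkS := π.le hB hk
    have hlS := π.le hC hl
    have hne' : B.image f ≠ C.image f := fun e =>
      hne (image_injOn_powerset h.injOn (π.le hB) (π.le hC) e)
    have hB' : B.image f ∈ (mapPartition f h.injOn π).parts := Finset.mem_image_of_mem _ hB
    have hC' : C.image f ∈ (mapPartition f h.injOn π).parts := Finset.mem_image_of_mem _ hC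
    have him := Finset.mem_image_of_mem f hi
    have hjm := Finset.mem_image_of_mem f hj
    have hkm := Finset.mem_image_of_mem f hk
    have hlm := Finset.mem_image_of_mem f hl
    have hlm' := h.le l hlS
    have h1 := h.mono i hiS j hjS hij (hjk.trans (hkl.trans_le hlm'))
    have h2 := h.mono j hjS k hkS hjk (hkl.trans_le hlm')
    rcases hlm'.lt_or_eq with h3 | rfl
    · exact hn _ hB' _ hC' hne' _ him _ hjm _ hkm _ hlm h1 h2 (h.mono k hkS l hlS hkl h3)
    · exact hn _ hC' _ hB' hne'.symm _ hlm _ him _ hjm _ hkm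
        (h.last i hiS (hij.trans (hjk.trans hkl)) hlS) h1 h2
  · intro hn B' hB' C' hC' hne i' hi' j' hj' k' hk' l' hl' hij hjk hkl
    obtain ⟨B, hB, rfl⟩ := Finset.mem_image.1 hB'
    obtain ⟨C, hC, rfl⟩ := Finset.mem_image.1 hC'
    obtain ⟨i, hi, rfl⟩ := Finset.mem_image.1 hi'
    obtain ⟨j, hj, rfl⟩ := Finset.mem_image.1 hj'
    obtain ⟨k, hk, rfl⟩ := Finset.mem_image.1 hk'
    obtain ⟨l, hl, rfl⟩ := Finset.mem_image.1 hl'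
    have hne' : B ≠ C := fun e => hne (e ▸ rfl)
    have hiS := π.le hB hi
    have hjS := π.le hC hj
    have hkS := π.le hB hk
    have hlS := π.le hC hl
    have hjm := last' i hiS j hjS hij
    have hkm := last' j hjS k hkS hjk
    have hlm := last' k hkS l hlS hkl
    have h2 := mono' j hjS k hkS hjm hkm hjk
    have h3 := mono' k hkS l hlS hkm hlm hkl
    rcases (h.le i hiS).lt_or_eq with him | rfl
    · exact hn B hB C hC hne' i hi j hj k hk l hl (mono' i hiS j hjS him hjm hij) h2 h3
    · exact hn C hC B hB hne'.symm j hj k hk l hl i hi h2 h3 hlm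

/-- Reindexing a sum over non-crossing partitions along a rotation. -/
theorem sum_ncPartitions (h : IsRotationOn f m s) (F : Finset ι' → ℂ) :
    ∑ σ ∈ ncPartitions (s.image f), ∏ B ∈ σ.parts, F B =
      ∑ σ ∈ ncPartitions s, ∏ B ∈ σ.parts, F (B.image f) := by
  symm
  refine Finset.sum_bij (fun π _ => mapPartition f h.injOn π) ?_ ?_ ?_ ?_
  · intro π hπ
    rw [mem_ncPartitions] at hπ ⊢
    exact (h.isNonCrossing_iff π).2 hπ
  · intro π _ π' _ he
    exact (mapPartition_bijective f h.injOn).1 he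
  · intro τ hτ
    obtain ⟨π, rfl⟩ := (mapPartition_bijective f h.injOn).2 τ
    rw [mem_ncPartitions, h.isNonCrossing_iff] at hτ
    exact ⟨π, mem_ncPartitions.2 hτ, rfl⟩
  · intro π _
    rw [prod_mapPartition]

end IsRotationOn

/-- Cumulants of a tracial functional are invariant under rotations: the moments are, and so is the
set of non-crossing partitions. -/
theorem cumulantOn_image {ι' : Type*} [LinearOrder ι'] (φ : A →ₗ[ℂ] ℂ)
    (htracial : ∀ a b : A, φ (a * b) = φ (b * a)) {f : ι → ι'} {m : ι} {s : Finset ι}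
    (hs : s.Nonempty) (h : IsRotationOn f m s) {a : ι → A} {b : ι' → A}
    (hab : ∀ x ∈ s, a x = b (f x)) :
    cumulantOn φ a s = cumulantOn φ b (s.image f) := by
  refine cumulantOn_eq_of_forall φ a (fun t => cumulantOn φ b (t.image f)) s hs fun t hts ht => ?_
  have h' := h.subset hts
  rw [← h'.sum_ncPartitions (cumulantOn φ b), ← map_orderedProd φ b (ht.image f),
    orderedProd_congr (b := b ∘ f) fun x hx => hab x (hts hx)]
  by_cases hm : m ∈ t
  · have hlt : ∀ y ∈ t.erase m, y < m := fun y hy =>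
      (h'.le y (Finset.mem_of_mem_erase hy)).lt_of_ne (Finset.ne_of_mem_erase hy)
    have hmono : StrictMonoOn f (t.erase m) := fun x hx y hy hxy =>
      h'.mono x (Finset.mem_of_mem_erase hx) y (Finset.mem_of_mem_erase hy) hxy (hlt y hy)
    rw [← Finset.insert_erase hm, orderedProd_insert_last _ hlt, Finset.image_insert,
      orderedProd_insert_first, orderedProd_image hmono, htracial]
    · rfl
    · intro y hy
      obtain ⟨x, hx, rfl⟩ := Finset.mem_image.1 hy
      exact h'.last x (Finset.mem_of_mem_erase hx) (hlt x hx) hm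
  · have hlt : ∀ y ∈ t, y < m := fun y hy =>
      (h'.le y hy).lt_of_ne fun e => hm (e ▸ hy)
    rw [orderedProd_image fun x hx y hy hxy => h'.mono x hx y hy hxy (hlt y hy)]

/-! ### Splitting the first letter of a non-crossing partition -/

theorem eq_of_parts_subset {α : Type*} [DecidableEq α] {s : Finset α} {π π' : Finpartition s}
    (h : π.parts ⊆ π'.parts) : π = π' := by
  refine Finpartition.ext (h.antisymm fun B hB => ?_)
  obtain ⟨b, hb⟩ := π'.nonempty_of_mem_parts hB
  obtain ⟨C, hC, hbC⟩ := π.exists_mem (π'.le hB hb)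
  rwa [π'.eq_of_mem_parts hB (h hC) hb hbC]

section Cut

variable {ι : Type*} [LinearOrder ι] {s : Finset ι} {x y : ι}

/-- Given a partition `ρ` of a set with first element `y`, and a new element `x` below this set,
the partition of the enlarged set in which the block `B` of `y` is replaced by the blocks
`{x} ∪ {b ∈ B | z < b}` and `{b ∈ B | b ≤ z}`, the latter being omitted if it is empty. -/
def cutPartition (hx : ∀ z ∈ s, x < z) (hy : y ∈ s) (ρ : Finpartition s) (z : ι) :
    Finpartition (insert x s) :=
  .ofExistsUnique
    (insert (insert x {b ∈ ρ.part y | z < b})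
      ((insert {b ∈ ρ.part y | b ≤ z} (ρ.parts.erase (ρ.part y))).erase ∅))
    (by
      intro p hp
      simp only [Finset.mem_insert, Finset.mem_erase] at hp
      rcases hp with rfl | ⟨-, rfl | ⟨-, hp⟩⟩
      · exact Finset.insert_subset_insert _ ((Finset.filter_subset _ _).trans (ρ.part_subset y))
      · exact ((Finset.filter_subset _ _).trans (ρ.part_subset y)).trans (Finset.subset_insert _ _)
      · exact (ρ.le hp).trans (Finset.subset_insert _ _))
    (by
      intro a ha
      have hxs : x ∉ s := fun h => lt_irrefl _ (hx x h)
      have hB := ρ.part_mem.2 hy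
      rcases Finset.mem_insert.1 ha with rfl | ha
      · refine ⟨_, ⟨Finset.mem_insert_self _ _, Finset.mem_insert_self _ _⟩, ?_⟩
        rintro p ⟨hp, hap⟩
        simp only [Finset.mem_insert, Finset.mem_erase] at hp
        rcases hp with rfl | ⟨-, rfl | ⟨-, hp⟩⟩
        · rfl
        · exact absurd (ρ.part_subset y (Finset.mem_filter.1 hap).1) hxs
        · exact absurd (ρ.le hp hap) hxs
      · have hax : a ≠ x := (hx a ha).ne'
        by_cases haB : a ∈ ρ.part y
        · have hother : ∀ p ∈ ρ.parts, p ≠ ρ.part y → a ∉ p := fun p hp hne hap =>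
            hne (ρ.eq_of_mem_parts hp hB hap haB)
          rcases lt_or_ge z a with hza | hza
          · refine ⟨_, ⟨Finset.mem_insert_self _ _, by simp [haB, hza]⟩, ?_⟩
            rintro p ⟨hp, hap⟩
            simp only [Finset.mem_insert, Finset.mem_erase] at hp
            rcases hp with rfl | ⟨-, rfl | ⟨hne, hp⟩⟩
            · rfl
            · exact absurd (Finset.mem_filter.1 hap).2 hza.not_ge
            · exact absurd hap (hother p hp hne)
          · refine ⟨{b ∈ ρ.part y | b ≤ z}, ⟨?_, by simp [haB, hza]⟩, ?_⟩
            · refine Finset.mem_insert_of_mem (Finset.mem_erase.2 ⟨?_, Finset.mem_insert_self _ _⟩)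
              exact Finset.nonempty_iff_ne_empty.1 ⟨a, by simp [haB, hza]⟩
            rintro p ⟨hp, hap⟩
            simp only [Finset.mem_insert, Finset.mem_erase] at hp
            rcases hp with rfl | ⟨-, rfl | ⟨hne, hp⟩⟩
            · rcases Finset.mem_insert.1 hap with rfl | hap
              · exact absurd rfl hax
              · exact absurd (Finset.mem_filter.1 hap).2 hza.not_gt
            · rfl
            · exact absurd hap (hother p hp hne)
        · obtain ⟨C, hC, haC⟩ := ρ.exists_mem ha
          refine ⟨C, ⟨?_, haC⟩, ?_⟩
          · simp only [Finset.mem_insert, Finset.mem_erase]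
            exact .inr ⟨ρ.ne_empty hC, .inr ⟨fun e => haB (e ▸ haC), hC⟩⟩
          rintro p ⟨hp, hap⟩
          simp only [Finset.mem_insert, Finset.mem_erase] at hp
          rcases hp with rfl | ⟨-, rfl | ⟨hne, hp⟩⟩
          · rcases Finset.mem_insert.1 hap with rfl | hap
            · exact absurd rfl hax
            · exact absurd (Finset.mem_filter.1 hap).1 haB
          · exact absurd (Finset.mem_filter.1 hap).1 haB
          · exact ρ.eq_of_mem_parts hp hC hap haC)
    (by
      simp only [Finset.mem_insert, Finset.mem_erase, ne_eq, not_true_eq_false, false_and,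
        or_false]
      exact fun h => Finset.insert_ne_empty _ _ h.symm)

theorem mem_cutPartition (hx : ∀ z ∈ s, x < z) (hy : y ∈ s) (ρ : Finpartition s) (z : ι)
    (p : Finset ι) : p ∈ (cutPartition hx hy ρ z).parts ↔
      p = insert x {b ∈ ρ.part y | z < b} ∨
        p ≠ ∅ ∧ (p = {b ∈ ρ.part y | b ≤ z} ∨ p ≠ ρ.part y ∧ p ∈ ρ.parts) := by
  change p ∈ insert _ _ ↔ _
  simp only [Finset.mem_insert, Finset.mem_erase]

theorem prod_cutPartition (hx : ∀ z ∈ s, x < z) (hy : y ∈ s) (ρ : Finpartition s) (z : ι)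
    (f : Finset ι → ℂ) (hf : f ∅ = 1) :
    ∏ B ∈ (cutPartition hx hy ρ z).parts, f B =
      f (insert x {b ∈ ρ.part y | z < b}) * f {b ∈ ρ.part y | b ≤ z} *
        ∏ B ∈ ρ.parts.erase (ρ.part y), f B := by
  have hxs : x ∉ s := fun h => lt_irrefl _ (hx x h)
  have hB := ρ.part_mem.2 hy
  change ∏ B ∈ insert _ _, f B = _
  rw [Finset.prod_insert, Finset.prod_erase _ hf, mul_assoc]
  · congr 1
    by_cases hemp : ({b ∈ ρ.part y | b ≤ z} : Finset ι) = ∅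
    · rw [hemp, Finset.prod_insert, hf]
      exact fun h => ρ.ne_empty (Finset.mem_of_mem_erase h) rfl
    · rw [Finset.prod_insert]
      intro h
      obtain ⟨b, hb⟩ := Finset.nonempty_iff_ne_empty.2 hemp
      exact Finset.ne_of_mem_erase h (ρ.eq_of_mem_parts (Finset.mem_of_mem_erase h) hB hb
        (Finset.mem_filter.1 hb).1)
  · simp only [Finset.mem_insert, Finset.mem_erase]
    rintro ⟨-, h | ⟨-, h⟩⟩
    · have : x ∈ ({b ∈ ρ.part y | b ≤ z} : Finset ι) := h ▸ Finset.mem_insert_self _ _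
      exact hxs (ρ.part_subset y (Finset.mem_filter.1 this).1)
    · exact hxs (ρ.le h (Finset.mem_insert_self _ _))

theorem isNonCrossing_cutPartition (hx : ∀ z ∈ s, x < z) (hy : y ∈ s) (hmin : ∀ z ∈ s, y ≤ z)
    {ρ : Finpartition s} (hρ : IsNonCrossing ρ) (z : ι) :
    IsNonCrossing (cutPartition hx hy ρ z) := by
  have hB := ρ.part_mem.2 hy
  have hyB := ρ.mem_part_self.2 hy
  have hBs := ρ.part_subset y
  intro P hP Q hQ hne i hi j hj k hk l hl hij hjk hkl
  rw [mem_cutPartition] at hP hQ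
  have hins : ∀ {b}, b ∈ insert x ({b ∈ ρ.part y | z < b} : Finset ι) → ∀ c ∈ insert x s, c < b →
      b ∈ ρ.part y ∧ z < b := by
    intro b hb c hc hcb
    rcases Finset.mem_insert.1 hb with rfl | hb
    · rcases Finset.mem_insert.1 hc with rfl | hc
      · exact absurd hcb (lt_irrefl _)
      · exact absurd hcb (hx c hc).not_gt
    · exact Finset.mem_filter.1 hb
  have hsub : ∀ {R}, R ∈ (cutPartition hx hy ρ z).parts → R ⊆ insert x s := fun h =>
    (cutPartition hx hy ρ z).le h
  have hiS := hsub ((mem_cutPartition hx hy ρ z P).2 hP) hi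
  have hjS := hsub ((mem_cutPartition hx hy ρ z Q).2 hQ) hj
  have hkS := hsub ((mem_cutPartition hx hy ρ z P).2 hP) hk
  rcases hP with rfl | ⟨-, rfl | ⟨hPB, hP⟩⟩ <;> rcases hQ with rfl | ⟨-, rfl | ⟨hQB, hQ⟩⟩
  · exact hne rfl
  · have hk' := hins hk j hjS hjk
    exact absurd ((Finset.mem_filter.1 hl).2.trans_lt hk'.2) hkl.not_gt
  · have hk' := hins hk j hjS hjk
    rcases Finset.mem_insert.1 hi with rfl | hi
    · refine hρ _ hB _ hQ hQB.symm y hyB j hj k hk'.1 l hl ?_ hjk hkl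
      exact (hmin j (ρ.le hQ hj)).lt_of_ne fun e =>
        hQB (ρ.eq_of_mem_parts hQ hB (e ▸ hj) hyB)
    · exact hρ _ hB _ hQ hQB.symm i (Finset.mem_filter.1 hi).1 j hj k hk'.1 l hl hij hjk hkl
  · have hj' := hins hj i hiS hij
    exact absurd ((Finset.mem_filter.1 hk).2.trans_lt hj'.2) hjk.not_gt
  · exact hne rfl
  · exact hρ _ hB _ hQ hQB.symm i (Finset.mem_filter.1 hi).1 j hj k (Finset.mem_filter.1 hk).1 l hl
      hij hjk hkl
  · exact hρ _ hP _ hB hPB i hi j (hins hj i hiS hij).1 k hk l (hins hl k hkS hkl).1 hij hjk hkl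
  · exact hρ _ hP _ hB hPB i hi j (Finset.mem_filter.1 hj).1 k hk l (Finset.mem_filter.1 hl).1
      hij hjk hkl
  · exact hρ _ hP _ hQ hne i hi j hj k hk l hl hij hjk hkl

/-- The partition obtained by merging the blocks of `x` and `y` and removing `x`. -/
def collapsePartition (hx : ∀ z ∈ s, x < z) (hy : y ∈ s) (π : Finpartition (insert x s)) :
    Finpartition s :=
  .ofExistsUnique
    (insert ((π.part x ∪ π.part y).erase x) ((π.parts.erase (π.part x)).erase (π.part y)))
    (by
      intro p hp
      simp only [Finset.mem_insert, Finset.mem_erase] at hp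
      rcases hp with rfl | ⟨-, hpx, hp⟩
      · rw [← Finset.subset_insert_iff]
        exact Finset.union_subset (π.part_subset _) (π.part_subset _)
      · refine (Finset.subset_insert_iff_of_notMem ?_).1 (π.le hp)
        exact fun h => hpx (π.part_eq_of_mem hp h).symm)
    (by
      intro a ha
      have hxm : x ∈ insert x s := Finset.mem_insert_self _ _
      have hym : y ∈ insert x s := Finset.mem_insert_of_mem hy
      by_cases h : a ∈ π.part x ∪ π.part y
      · refine ⟨_, ⟨Finset.mem_insert_self _ _, Finset.mem_erase.2 ⟨(hx a ha).ne', h⟩⟩, ?_⟩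
        rintro p ⟨hp, hap⟩
        simp only [Finset.mem_insert, Finset.mem_erase] at hp
        rcases hp with rfl | ⟨hpy, hpx, hp⟩
        · rfl
        · rcases Finset.mem_union.1 h with h | h
          · exact absurd (π.eq_of_mem_parts hp (π.part_mem.2 hxm) hap h) hpx
          · exact absurd (π.eq_of_mem_parts hp (π.part_mem.2 hym) hap h) hpy
      · obtain ⟨C, hC, haC⟩ := π.exists_mem (Finset.mem_insert_of_mem (a := a) (b := x) ha)
        refine ⟨C, ⟨?_, haC⟩, ?_⟩
        · simp only [Finset.mem_insert, Finset.mem_erase]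
          exact .inr ⟨fun e => h (Finset.mem_union_right _ (e ▸ haC)),
            fun e => h (Finset.mem_union_left _ (e ▸ haC)), hC⟩
        rintro p ⟨hp, hap⟩
        simp only [Finset.mem_insert, Finset.mem_erase] at hp
        rcases hp with rfl | ⟨hpy, hpx, hp⟩
        · exact absurd (Finset.mem_of_mem_erase hap) h
        · exact π.eq_of_mem_parts hp hC hap haC)
    (by
      simp only [Finset.mem_insert, Finset.mem_erase]
      rintro (h | ⟨-, -, h⟩)
      · have : y ∈ (π.part x ∪ π.part y).erase x := Finset.mem_erase.2 ⟨(hx y hy).ne',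
          Finset.mem_union_right _ (π.mem_part_self.2 (Finset.mem_insert_of_mem hy))⟩
        rw [← h] at this
        exact Finset.notMem_empty _ this
      · exact π.ne_empty h rfl)

theorem mem_collapsePartition (hx : ∀ z ∈ s, x < z) (hy : y ∈ s) (π : Finpartition (insert x s))
    (p : Finset ι) : p ∈ (collapsePartition hx hy π).parts ↔
      p = (π.part x ∪ π.part y).erase x ∨ p ≠ π.part y ∧ p ≠ π.part x ∧ p ∈ π.parts := by
  change p ∈ insert _ _ ↔ _
  simp only [Finset.mem_insert, Finset.mem_erase]

theorem part_collapsePartition (hx : ∀ z ∈ s, x < z) (hy : y ∈ s)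
    (π : Finpartition (insert x s)) :
    (collapsePartition hx hy π).part y = (π.part x ∪ π.part y).erase x :=
  (collapsePartition hx hy π).part_eq_of_mem ((mem_collapsePartition hx hy π _).2 (.inl rfl))
    (Finset.mem_erase.2 ⟨(hx y hy).ne',
      Finset.mem_union_right _ (π.mem_part_self.2 (Finset.mem_insert_of_mem hy))⟩)

theorem isNonCrossing_collapsePartition (hx : ∀ z ∈ s, x < z) (hy : y ∈ s)
    (hmin : ∀ z ∈ s, y ≤ z) {π : Finpartition (insert x s)} (hπ : IsNonCrossing π) :
    IsNonCrossing (collapsePartition hx hy π) := by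
  have hxm : x ∈ insert x s := Finset.mem_insert_self _ _
  have hym : y ∈ insert x s := Finset.mem_insert_of_mem hy
  have hX := π.part_mem.2 hxm
  have hY := π.part_mem.2 hym
  have hxX := π.mem_part_self.2 hxm
  have hyY := π.mem_part_self.2 hym
  have hxy := hx y hy
  intro P hP Q hQ hne i hi j hj k hk l hl hij hjk hkl
  have hPs := (collapsePartition hx hy π).le hP
  have hQs := (collapsePartition hx hy π).le hQ
  rw [mem_collapsePartition] at hP hQ
  rcases hP with rfl | ⟨hPY, hPX, hP⟩ <;> rcases hQ with rfl | ⟨hQY, hQX, hQ⟩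
  · exact hne rfl
  · have hiP := Finset.mem_of_mem_erase hi
    have hkP := Finset.mem_of_mem_erase hk
    have hix := Finset.ne_of_mem_erase hi
    rcases Finset.mem_union.1 hkP with hkX | hkY
    · exact hπ _ hX _ hQ hQX.symm x hxX j hj k hkX l hl (hx j (hQs hj)) hjk hkl
    · rcases Finset.mem_union.1 hiP with hiX | hiY
      · by_cases hXY : π.part x = π.part y
        · exact hπ _ hX _ hQ hQX.symm i hiX j hj k (hXY ▸ hkY) l hl hij hjk hkl
        · refine hπ _ hX _ hY hXY x hxX y hyY i hiX k hkY hxy ?_ (hij.trans hjk)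
          refine (hmin i (hPs hi)).lt_of_ne fun e => hXY ?_
          exact π.eq_of_mem_parts hX hY hiX (e ▸ hyY)
      · exact hπ _ hY _ hQ hQY.symm i hiY j hj k hkY l hl hij hjk hkl
  · have hjQ := Finset.mem_of_mem_erase hj
    have hlQ := Finset.mem_of_mem_erase hl
    rcases Finset.mem_union.1 hjQ with hjX | hjY
    · rcases Finset.mem_union.1 hlQ with hlX | hlY
      · exact hπ _ hP _ hX hPX i hi j hjX k hk l hlX hij hjk hkl
      · by_cases hXY : π.part x = π.part y
        · exact hπ _ hP _ hX hPX i hi j hjX k hk l (hXY ▸ hlY) hij hjk hkl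
        · refine hπ _ hX _ hY hXY x hxX y hyY j hjX l hlY hxy ?_ (hjk.trans hkl)
          exact (hmin i (hPs hi)).trans_lt hij
    · refine hπ _ hY _ hP hPY.symm y hyY i hi j hjY k hk ?_ hij hjk
      exact (hmin i (hPs hi)).lt_of_ne fun e => hPY (π.eq_of_mem_parts hP hY (e ▸ hi) hyY)
  · exact hπ _ hP _ hQ hne i hi j hj k hk l hl hij hjk hkl

theorem part_cutPartition_left (hx : ∀ z ∈ s, x < z) (hy : y ∈ s) (ρ : Finpartition s) (z : ι) :
    (cutPartition hx hy ρ z).part x = insert x {b ∈ ρ.part y | z < b} :=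
  (cutPartition hx hy ρ z).part_eq_of_mem ((mem_cutPartition hx hy ρ z _).2 (.inl rfl))
    (Finset.mem_insert_self _ _)

theorem part_cutPartition_right_self (hx : ∀ z ∈ s, x < z) (hy : y ∈ s) (ρ : Finpartition s) :
    (cutPartition hx hy ρ x).part y = insert x (ρ.part y) := by
  have hBx : ({b ∈ ρ.part y | x < b} : Finset ι) = ρ.part y :=
    Finset.filter_true_of_mem fun b hb => hx b (ρ.part_subset y hb)
  refine (cutPartition hx hy ρ x).part_eq_of_mem ((mem_cutPartition hx hy ρ x _).2 (.inl ?_))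
    (Finset.mem_insert_of_mem (ρ.mem_part_self.2 hy))
  rw [hBx]

theorem part_cutPartition_right (hx : ∀ z ∈ s, x < z) (hy : y ∈ s) (hmin : ∀ z ∈ s, y ≤ z)
    (ρ : Finpartition s) {z : ι} (hz : z ∈ ρ.part y) :
    (cutPartition hx hy ρ z).part y = {b ∈ ρ.part y | b ≤ z} := by
  have hyf : y ∈ ({b ∈ ρ.part y | b ≤ z} : Finset ι) :=
    Finset.mem_filter.2 ⟨ρ.mem_part_self.2 hy, hmin z (ρ.part_subset y hz)⟩
  exact (cutPartition hx hy ρ z).part_eq_of_mem ((mem_cutPartition hx hy ρ z _).2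
    (.inr ⟨Finset.nonempty_iff_ne_empty.1 ⟨y, hyf⟩, .inl rfl⟩)) hyf

theorem collapsePartition_cutPartition (hx : ∀ z ∈ s, x < z) (hy : y ∈ s)
    (hmin : ∀ z ∈ s, y ≤ z) (ρ : Finpartition s) {z : ι} (hz : z ∈ insert x (ρ.part y)) :
    collapsePartition hx hy (cutPartition hx hy ρ z) = ρ := by
  have hxs : x ∉ s := fun h => lt_irrefl _ (hx x h)
  have hxB : x ∉ ρ.part y := fun h => hxs (ρ.part_subset y h)
  symm
  refine eq_of_parts_subset fun C hC => ?_
  rw [mem_collapsePartition, part_cutPartition_left]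
  by_cases hCB : C = ρ.part y
  · left
    subst hCB
    rcases Finset.mem_insert.1 hz with rfl | hz
    · rw [part_cutPartition_right_self,
        Finset.filter_true_of_mem fun b hb => hx b (ρ.part_subset y hb), Finset.union_self,
        Finset.erase_insert hxB]
    · rw [part_cutPartition_right hx hy hmin ρ hz, Finset.insert_union, Finset.erase_insert]
      · ext b
        simp only [Finset.mem_union, Finset.mem_filter, ← and_or_left]
        exact ⟨fun h => ⟨h, lt_or_ge _ _⟩, fun h => h.1⟩
      · simp [hxB]
  · right
    have hxC : x ∉ C := fun h => hxs (ρ.le hC h)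
    refine ⟨?_, ?_, (mem_cutPartition hx hy ρ z C).2 (.inr ⟨ρ.ne_empty hC, .inr ⟨hCB, hC⟩⟩)⟩
    · rintro rfl
      rcases Finset.mem_insert.1 hz with rfl | hz
      · rw [part_cutPartition_right_self] at hxC
        exact hxC (Finset.mem_insert_self _ _)
      · refine hCB (ρ.part_eq_of_mem hC ?_).symm
        exact (Finpartition.mem_part_self _).2 (Finset.mem_insert_of_mem hy)
    · rintro rfl
      exact hxC (Finset.mem_insert_self _ _)

open scoped Classical in
/-- The last element of the block of `y`, or `x` if this is also the block of `x`: the place where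
the merged block has to be cut to recover the partition. -/
def cutPlace (x y : ι) (π : Finpartition (insert x s)) : ι :=
  if h : (π.part y).Nonempty ∧ x ∉ π.part y then (π.part y).max' h.1 else x

theorem cutPartition_collapsePartition (hx : ∀ z ∈ s, x < z) (hy : y ∈ s)
    (hmin : ∀ z ∈ s, y ≤ z) {π : Finpartition (insert x s)} (hπ : IsNonCrossing π) :
    cutPartition hx hy (collapsePartition hx hy π) (cutPlace x y π) = π := by
  have hxm : x ∈ insert x s := Finset.mem_insert_self _ _
  have hym : y ∈ insert x s := Finset.mem_insert_of_mem hy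
  have hX := π.part_mem.2 hxm
  have hY := π.part_mem.2 hym
  have hxX := π.mem_part_self.2 hxm
  have hyY := π.mem_part_self.2 hym
  have hxy := hx y hy
  have hlt : ∀ C ∈ π.parts, C ≠ π.part x → ∀ b ∈ C, x < b := fun C hC hne b hb => by
    rcases Finset.mem_insert.1 (π.le hC hb) with rfl | h
    · exact absurd (π.part_eq_of_mem hC hb).symm hne
    · exact hx b h
  have hlt' : ∀ b ∈ π.part x, b ≠ x → b ∈ s := fun b hb hne =>
    (Finset.mem_insert.1 (π.part_subset x hb)).resolve_left hne
  symm
  refine eq_of_parts_subset fun C hC => ?_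
  rw [mem_cutPartition, part_collapsePartition, mem_collapsePartition]
  by_cases hxY : x ∈ π.part y
  · have hXY : π.part x = π.part y := π.eq_of_mem_parts hX hY hxX hxY
    have hz : cutPlace x y π = x := by simp [cutPlace, hxY]
    rw [hz, ← hXY, Finset.union_self]
    by_cases hCX : C = π.part x
    · left
      rw [Finset.filter_true_of_mem, Finset.insert_erase hxX, hCX]
      intro b hb
      exact hx b (hlt' b (Finset.mem_of_mem_erase hb) (Finset.ne_of_mem_erase hb))
    · refine .inr ⟨π.ne_empty hC, .inr ⟨?_, .inr ⟨hCX, hCX, hC⟩⟩⟩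
      rintro rfl
      have : y ∈ (π.part x).erase x := Finset.mem_erase.2 ⟨hxy.ne', hXY ▸ hyY⟩
      exact hCX (π.eq_of_mem_parts hC hX this (hXY ▸ hyY))
  · have hXY : π.part x ≠ π.part y := fun e => hxY (e ▸ hxX)
    have hz : cutPlace x y π = (π.part y).max' ⟨y, hyY⟩ := by
      rw [cutPlace, dif_pos ⟨⟨y, hyY⟩, hxY⟩]
    have hzY : cutPlace x y π ∈ π.part y := hz ▸ Finset.max'_mem _ _
    have hYz : ∀ b ∈ π.part y, b ≤ cutPlace x y π := fun b hb => hz ▸ Finset.le_max' _ b hb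
    have hXz : ∀ b ∈ π.part x, b ≠ x → cutPlace x y π < b := by
      intro b hb hbx
      by_contra hle
      have hne : ∀ c ∈ π.part y, b ≠ c := by
        rintro c hc rfl
        exact hXY (π.eq_of_mem_parts hX hY hb hc)
      refine hπ _ hX _ hY hXY x hxX y hyY b hb _ hzY hxy ?_ ((not_lt.1 hle).lt_of_ne (hne _ hzY))
      exact (hmin b (hlt' b hb hbx)).lt_of_ne (hne y hyY).symm
    by_cases hCX : C = π.part x
    · left
      subst hCX
      ext b
      simp only [Finset.mem_insert, Finset.mem_filter, Finset.mem_erase, Finset.mem_union]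
      constructor
      · intro hb
        by_cases hbx : b = x
        · exact .inl hbx
        · exact .inr ⟨⟨hbx, .inl hb⟩, hXz b hb hbx⟩
      · rintro (rfl | ⟨⟨-, hb | hb⟩, hzb⟩)
        · exact hxX
        · exact hb
        · exact absurd hzb (hYz b hb).not_gt
    · refine .inr ⟨π.ne_empty hC, ?_⟩
      by_cases hCY : C = π.part y
      · left
        subst hCY
        ext b
        simp only [Finset.mem_filter, Finset.mem_erase, Finset.mem_union]
        constructor
        · intro hb
          exact ⟨⟨(hlt _ hY hXY.symm b hb).ne', .inr hb⟩, hYz b hb⟩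
        · rintro ⟨⟨hbx, hb | hb⟩, hbz⟩
          · exact absurd (hXz b hb hbx) hbz.not_gt
          · exact hb
      · refine .inr ⟨?_, .inr ⟨hCY, hCX, hC⟩⟩
        rintro rfl
        have : y ∈ (π.part x ∪ π.part y).erase x :=
          Finset.mem_erase.2 ⟨hxy.ne', Finset.mem_union_right _ hyY⟩
        exact hCY (π.eq_of_mem_parts hC hY this hyY)

theorem cutPlace_mem (hx : ∀ z ∈ s, x < z) (hy : y ∈ s) (π : Finpartition (insert x s)) :
    cutPlace x y π ∈ insert x ((collapsePartition hx hy π).part y) := by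
  rw [part_collapsePartition, cutPlace]
  split_ifs with h
  · have := Finset.max'_mem _ h.1
    exact Finset.mem_insert_of_mem (Finset.mem_erase.2
      ⟨fun e => h.2 (by rwa [e] at this), Finset.mem_union_right _ this⟩)
  · exact Finset.mem_insert_self _ _

theorem cutPlace_cutPartition (hx : ∀ z ∈ s, x < z) (hy : y ∈ s) (hmin : ∀ z ∈ s, y ≤ z)
    (ρ : Finpartition s) {z : ι} (hz : z ∈ insert x (ρ.part y)) :
    cutPlace x y (cutPartition hx hy ρ z) = z := by
  have hxs : x ∉ s := fun h => lt_irrefl _ (hx x h)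
  have hxB : x ∉ ρ.part y := fun h => hxs (ρ.part_subset y h)
  rw [cutPlace]
  rcases Finset.mem_insert.1 hz with rfl | hz
  · rw [dif_neg]
    rw [part_cutPartition_right_self]
    exact fun h => h.2 (Finset.mem_insert_self _ _)
  · have hp := part_cutPartition_right hx hy hmin ρ hz
    have hzm : z ∈ (cutPartition hx hy ρ z).part y := by
      rw [hp]
      exact Finset.mem_filter.2 ⟨hz, le_rfl⟩
    rw [dif_pos]
    · refine le_antisymm (Finset.max'_le _ _ _ fun b hb => ?_) (Finset.le_max' _ _ hzm)
      rw [hp] at hb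
      exact (Finset.mem_filter.1 hb).2
    · refine ⟨⟨z, hzm⟩, ?_⟩
      rw [hp]
      exact fun h => hxB (Finset.mem_filter.1 h).1

/-- Sums over the non-crossing partitions of `{x < y < ⋯}` are sums over those of `{y < ⋯}`: in
each partition of the latter set, the block of `y` is cut into two in all possible ways, and `x` is
added to its second half. -/
theorem sum_ncPartitions_insert (hx : ∀ z ∈ s, x < z) (hy : y ∈ s) (hmin : ∀ z ∈ s, y ≤ z)
    (f : Finset ι → ℂ) (hf : f ∅ = 1) :
    ∑ π ∈ ncPartitions (insert x s), ∏ B ∈ π.parts, f B =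
      ∑ ρ ∈ ncPartitions s, ∏ B ∈ ρ.parts, if y ∈ B then
        ∑ z ∈ insert x B, f (insert x {b ∈ B | z < b}) * f {b ∈ B | b ≤ z} else f B := by
  have hR : ∀ ρ : Finpartition s, (∏ B ∈ ρ.parts, if y ∈ B then
        ∑ z ∈ insert x B, f (insert x {b ∈ B | z < b}) * f {b ∈ B | b ≤ z} else f B) =
      ∑ z ∈ insert x (ρ.part y), ∏ B ∈ (cutPartition hx hy ρ z).parts, f B := by
    intro ρ
    have hB := ρ.part_mem.2 hy
    rw [← Finset.mul_prod_erase _ _ hB, if_pos (ρ.mem_part_self.2 hy), Finset.sum_mul]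
    refine Finset.sum_congr rfl fun z _ => ?_
    rw [prod_cutPartition hx hy ρ z f hf]
    congr 1
    refine Finset.prod_congr rfl fun C hC => ?_
    rw [if_neg]
    exact fun h => Finset.ne_of_mem_erase hC (ρ.part_eq_of_mem (Finset.mem_of_mem_erase hC) h).symm
  rw [Finset.sum_congr rfl fun ρ _ => hR ρ, Finset.sum_sigma']
  refine Finset.sum_bij'
    (fun π _ => (⟨collapsePartition hx hy π, cutPlace x y π⟩ : Σ _ : Finpartition s, ι))
    (fun p _ => cutPartition hx hy p.1 p.2) ?_ ?_ ?_ ?_ ?_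
  · intro π hπ
    exact Finset.mem_sigma.2 ⟨mem_ncPartitions.2 (isNonCrossing_collapsePartition hx hy hmin
      (mem_ncPartitions.1 hπ)), cutPlace_mem hx hy π⟩
  · intro p hp
    exact mem_ncPartitions.2 (isNonCrossing_cutPartition hx hy hmin
      (mem_ncPartitions.1 (Finset.mem_sigma.1 hp).1) _)
  · intro π hπ
    exact cutPartition_collapsePartition hx hy hmin (mem_ncPartitions.1 hπ)
  · rintro ⟨ρ, z⟩ hp
    have hz := (Finset.mem_sigma.1 hp).2
    simp only at hz ⊢
    rw [collapsePartition_cutPartition hx hy hmin ρ hz, cutPlace_cutPartition hx hy hmin ρ hz]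
  · intro π hπ
    simp only
    rw [cutPartition_collapsePartition hx hy hmin (mem_ncPartitions.1 hπ)]

end Cut

/-! ### Cumulants with products as entries -/

section Cumulant

variable {A : Type*} [Ring A] [Algebra ℂ A] {ι : Type*} [LinearOrder ι]

theorem cumulantOn_congr (φ : A →ₗ[ℂ] ℂ) {a b : ι → A} {s : Finset ι} (hs : s.Nonempty)
    (h : ∀ x ∈ s, a x = b x) : cumulantOn φ a s = cumulantOn φ b s :=
  cumulantOn_eq_of_forall φ a _ s hs fun t hts ht => by
    rw [← map_orderedProd φ b ht, orderedProd_congr fun x hx => h x (hts hx)]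

/-- Linearity of the cumulants in the first entry. -/
theorem cumulantOn_add_smul (φ : A →ₗ[ℂ] ℂ) {a a' a'' : ι → A} {s : Finset ι} {x : ι} {c : ℂ}
    (hx : x ∈ s) (hmin : ∀ z ∈ s, x ≤ z) (h0 : a x = a' x + c • a'' x)
    (h1 : ∀ z ∈ s, z ≠ x → a z = a' z) (h2 : ∀ z ∈ s, z ≠ x → a z = a'' z) :
    cumulantOn φ a s = cumulantOn φ a' s + c * cumulantOn φ a'' s := by
  -- The right-hand side, extended to all subsets, satisfies the moment-cumulant formula.
  rw [cumulantOn_eq_of_forall φ a (fun t => if x ∈ t then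
    cumulantOn φ a' t + c * cumulantOn φ a'' t else cumulantOn φ a' t) s ⟨x, hx⟩, if_pos hx]
  intro t hts ht
  by_cases hxt : x ∈ t
  · have hlt : ∀ z ∈ t.erase x, x < z := fun z hz =>
      (hmin z (hts (Finset.mem_of_mem_erase hz))).lt_of_ne (Finset.ne_of_mem_erase hz).symm
    have e1 : orderedProd a t = orderedProd a' t + c • orderedProd a'' t := by
      rw [← Finset.insert_erase hxt, orderedProd_insert_first a hlt,
        orderedProd_insert_first a' hlt, orderedProd_insert_first a'' hlt, h0, add_mul,
        smul_mul_assoc,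
        ← orderedProd_congr fun z hz => h1 z (hts (Finset.mem_of_mem_erase hz))
          (Finset.ne_of_mem_erase hz),
        ← orderedProd_congr fun z hz => h2 z (hts (Finset.mem_of_mem_erase hz))
          (Finset.ne_of_mem_erase hz)]
    rw [e1, map_add, map_smul, map_orderedProd φ a' ht, map_orderedProd φ a'' ht, smul_eq_mul,
      Finset.mul_sum, ← Finset.sum_add_distrib]
    refine Finset.sum_congr rfl fun σ _ => ?_
    have hB := σ.part_mem.2 hxt
    rw [← Finset.mul_prod_erase _ _ hB, ← Finset.mul_prod_erase _ (cumulantOn φ a'') hB,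
      ← Finset.mul_prod_erase _ (fun t => if x ∈ t then _ else _) hB,
      if_pos (σ.mem_part_self.2 hxt), add_mul, mul_assoc]
    have hother : ∀ C ∈ σ.parts.erase (σ.part x), x ∉ C := fun C hC h =>
      Finset.ne_of_mem_erase hC (σ.part_eq_of_mem (Finset.mem_of_mem_erase hC) h).symm
    congr 2
    · exact Finset.prod_congr rfl fun C hC => (if_neg (hother C hC)).symm
    · congr 1
      refine Finset.prod_congr rfl fun C hC => ?_
      rw [if_neg (hother C hC)]
      have hCp := Finset.mem_of_mem_erase hC
      refine cumulantOn_congr φ (σ.nonempty_of_mem_parts hCp) fun z hz => ?_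
      have hne : z ≠ x := fun e => hother C hC (e ▸ hz)
      have hzs := hts (σ.le hCp hz)
      exact (h2 z hzs hne).symm.trans (h1 z hzs hne)
  · rw [orderedProd_congr (b := a') fun z hz => h1 z (hts hz) fun e => hxt (e ▸ hz),
      map_orderedProd φ a' ht]
    refine Finset.sum_congr rfl fun σ _ => Finset.prod_congr rfl fun B hB => ?_
    rw [if_neg fun h => hxt (σ.le hB h)]

/-- The cumulants with a product as first entry, in terms of the cumulants with separate
entries. The sum is over the ways of cutting off the block of the second factor `a y` from that of
the first factor `a x`, see `sum_ncPartitions_insert`. -/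
theorem cumulantOn_mul (φ : A →ₗ[ℂ] ℂ) {a a' : ι → A} {s : Finset ι} {x y : ι}
    (hx : ∀ z ∈ s, x < z) (hy : y ∈ s) (hmin : ∀ z ∈ s, y ≤ z) (h0 : a' y = a x * a y)
    (h1 : ∀ z ∈ s, z ≠ y → a' z = a z) :
    cumulantOn φ a' s = cumulantOn φ a (insert x s) +
      ∑ z ∈ s, cumulantOn φ a (insert x {b ∈ s | z < b}) * cumulantOn φ a {b ∈ s | b ≤ z} := by
  -- The value at the empty set accounts for the block that is omitted when nothing is cut off.
  set f : Finset ι → ℂ := fun t => if t = ∅ then 1 else cumulantOn φ a t with hf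
  have hfne : ∀ {t : Finset ι}, t.Nonempty → f t = cumulantOn φ a t := fun ht =>
    if_neg (Finset.nonempty_iff_ne_empty.1 ht)
  rw [cumulantOn_eq_of_forall φ a' (fun B => if y ∈ B then
      ∑ z ∈ insert x B, f (insert x {b ∈ B | z < b}) * f {b ∈ B | b ≤ z} else f B) s ⟨y, hy⟩,
    if_pos hy, Finset.sum_insert fun h => lt_irrefl _ (hx x h),
    Finset.filter_true_of_mem hx, Finset.filter_false_of_mem fun b hb => (hx b hb).not_ge]
  · congr 1
    · rw [hfne (Finset.insert_nonempty _ _), hf]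
      simp
    · refine Finset.sum_congr rfl fun z hz => ?_
      rw [hfne (Finset.insert_nonempty _ _),
        hfne (t := {b ∈ s | b ≤ z}) ⟨z, Finset.mem_filter.2 ⟨hz, le_rfl⟩⟩]
  · intro t hts ht
    have hxt : ∀ z ∈ t, x < z := fun z hz => hx z (hts hz)
    have hcum : ∀ (u : Finset ι) (σ : Finpartition u), ∏ B ∈ σ.parts, f B =
        ∏ B ∈ σ.parts, cumulantOn φ a B := fun u σ =>
      Finset.prod_congr rfl fun B hB => hfne (σ.nonempty_of_mem_parts hB)
    by_cases hyt : y ∈ t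
    · rw [← sum_ncPartitions_insert hxt hyt (fun z hz => hmin z (hts hz)) f (by simp [hf])]
      simp only [hcum]
      rw [← map_orderedProd φ a (Finset.insert_nonempty _ _), orderedProd_insert_first a hxt]
      have hlt : ∀ z ∈ t.erase y, y < z := fun z hz =>
        (hmin z (hts (Finset.mem_of_mem_erase hz))).lt_of_ne (Finset.ne_of_mem_erase hz).symm
      rw [← Finset.insert_erase hyt, orderedProd_insert_first a hlt,
        orderedProd_insert_first a' hlt, h0, mul_assoc, orderedProd_congr fun z hz =>
          h1 z (hts (Finset.mem_of_mem_erase hz)) (Finset.ne_of_mem_erase hz)]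
    · rw [orderedProd_congr (b := a) fun z hz => h1 z (hts hz) fun e => hyt (e ▸ hz),
        map_orderedProd φ a ht]
      refine Finset.sum_congr rfl fun σ _ => ?_
      rw [← hcum]
      refine Finset.prod_congr rfl fun B hB => ?_
      rw [if_neg fun h => hyt (σ.le hB h)]

end Cumulant

/-! ### Free cumulants of lists and of cycles -/

section List

variable {A : Type*} [Ring A] [Algebra ℂ A]

/-- The free cumulant of the entries of a list. The entries are indexed by `Finset.range l.length`;
the value `0` at the other indices plays no role. -/
def listCumulant (φ : A →ₗ[ℂ] ℂ) (l : List A) : ℂ :=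
  cumulantOn φ (fun i => l.getD i 0) (Finset.range l.length)

variable (φ : A →ₗ[ℂ] ℂ)

/-- A cumulant depends only on the list of its entries, not on the ordered set that indexes them. -/
theorem listCumulant_eq_cumulantOn (htracial : ∀ a b : A, φ (a * b) = φ (b * a))
    {ι : Type*} [LinearOrder ι] (a : ι → A) {l : List A} (hl : l ≠ []) (f : ℕ → ι) {s : Finset ι}
    (hf : ∀ i j, i < j → j < l.length → f i < f j)
    (hs : ∀ z, z ∈ s ↔ ∃ i < l.length, f i = z) (ha : ∀ i (h : i < l.length), a (f i) = l[i]) :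
    cumulantOn φ a s = listCumulant φ l := by
  have himg : s = (Finset.range l.length).image f := by
    ext z
    simp [hs]
  rw [himg, listCumulant]
  symm
  refine cumulantOn_image φ htracial (m := l.length) ?_ ⟨?_, ?_, ?_⟩ ?_
  · simpa using hl
  · intro x hx
    exact (Finset.mem_range.1 hx).le
  · intro x _ y hy hxy _
    exact hf x y hxy (Finset.mem_range.1 hy)
  · intro x _ _ h
    exact absurd (Finset.mem_range.1 h) (lt_irrefl _)
  · intro x hx
    have hx := Finset.mem_range.1 hx
    simp [ha x hx, hx]

theorem freeCumulant_eq_listCumulant (htracial : ∀ a b : A, φ (a * b) = φ (b * a)) {n : ℕ}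
    (a : Fin (n + 1) → A) : freeCumulant φ a = listCumulant φ (List.ofFn a) := by
  refine listCumulant_eq_cumulantOn φ htracial a (by simp) (fun i => Fin.ofNat (n + 1) i)
    ?_ ?_ ?_
  · intro i j hij hj
    rw [List.length_ofFn] at hj
    rw [Fin.lt_def]
    simp [Fin.ofNat, Nat.mod_eq_of_lt hj, Nat.mod_eq_of_lt (hij.trans hj), hij]
  · intro z
    simp only [Finset.mem_univ, true_iff]
    exact ⟨z, by simpa using z.is_le, by ext; simp [Fin.ofNat, Nat.mod_eq_of_lt z.is_lt]⟩
  · intro i hi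
    rw [List.length_ofFn] at hi
    simp only [List.getElem_ofFn]
    congr 1
    ext
    simp [Fin.ofNat, Nat.mod_eq_of_lt hi]

theorem listCumulant_singleton (a : A) : listCumulant φ [a] = φ a := by
  rw [listCumulant, cumulantOn_eq, Finset.sum_eq_zero, sub_zero]
  · simp [orderedProd]
  · intro σ hσ
    exfalso
    have hne := (Finset.mem_filter.1 hσ).2
    obtain ⟨B, hB⟩ := σ.parts_nonempty (by simp)
    have h1 := block_card_lt σ hne hB
    have h2 := Finset.card_pos.2 (σ.nonempty_of_mem_parts hB)
    simp at h1 h2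
    exact h2.ne_empty h1

theorem listCumulant_concat (htracial : ∀ a b : A, φ (a * b) = φ (b * a)) (x : A) (l : List A) :
    listCumulant φ (l ++ [x]) = listCumulant φ (x :: l) := by
  have himg : (Finset.range (l.length + 1)).image (fun i => if i < l.length then i + 1 else 0) =
      Finset.range (x :: l).length := by
    ext z
    simp only [Finset.mem_image, Finset.mem_range, List.length_cons]
    constructor
    · rintro ⟨i, hi, rfl⟩
      split_ifs <;> omega
    · intro hz
      rcases z with _ | z
      · exact ⟨l.length, by omega, by simp⟩
      · exact ⟨z, by omega, by rw [if_pos (by omega)]⟩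
  rw [listCumulant, listCumulant, ← himg, List.length_append, List.length_singleton]
  refine cumulantOn_image φ htracial (m := l.length) (by simp) ⟨?_, ?_, ?_⟩ ?_
  · intro i hi
    have := Finset.mem_range.1 hi
    omega
  · intro i _ j _ hij hj
    simp [hj, hij.trans hj, hij]
  · intro i _ hi _
    simp [hi]
  · intro i hi
    have hi := Finset.mem_range.1 hi
    by_cases h : i < l.length
    · simp [h, List.getElem?_append_left h]
    · have : i = l.length := by omega
      subst this
      simp

theorem listCumulant_append_comm (htracial : ∀ a b : A, φ (a * b) = φ (b * a)) (l l' : List A) :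
    listCumulant φ (l ++ l') = listCumulant φ (l' ++ l) := by
  induction l' generalizing l with
  | nil => simp
  | cons x l' ih =>
    rw [← List.singleton_append, ← List.append_assoc, ih, ← List.append_assoc,
      listCumulant_concat φ htracial]
    simp

theorem listCumulant_isRotated (htracial : ∀ a b : A, φ (a * b) = φ (b * a)) {l l' : List A}
    (h : l ~r l') : listCumulant φ l = listCumulant φ l' := by
  obtain ⟨n, hn, rfl⟩ := List.isRotated_iff_mod.1 h
  rw [List.rotate_eq_drop_append_take hn, listCumulant_append_comm φ htracial,
    List.take_append_drop]

theorem listCumulant_add_smul_cons (x y : A) (c : ℂ) (l : List A) :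
    listCumulant φ ((x + c • y) :: l) =
      listCumulant φ (x :: l) + c * listCumulant φ (y :: l) := by
  refine cumulantOn_add_smul φ (x := 0) (by simp) (by simp) (by simp) ?_ ?_ <;>
  · rintro (_ | z) _ hz
    · exact absurd rfl hz
    · simp

/-- The formula for free cumulants with a product as an entry. -/
theorem listCumulant_mul_cons (htracial : ∀ a b : A, φ (a * b) = φ (b * a)) (x y : A)
    (l : List A) :
    listCumulant φ ((x * y) :: l) = listCumulant φ (x :: y :: l) +
      ∑ k ∈ Finset.range (l.length + 1),
        listCumulant φ (y :: l.take k) * listCumulant φ (x :: l.drop k) := by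
  have hmem : ∀ z, z ∈ (Finset.range (l.length + 2)).erase 0 ↔ 0 < z ∧ z < l.length + 2 := by
    intro z
    simp [Nat.pos_iff_ne_zero]
  -- The product takes the index `1`, so that the entry of `a'` with index `0` is irrelevant.
  have h := cumulantOn_mul φ (a := fun i => (x :: y :: l).getD i 0)
    (a' := fun i => (x :: (x * y) :: l).getD i 0) (s := (Finset.range (l.length + 2)).erase 0)
    (x := 0) (y := 1) (fun z hz => ((hmem z).1 hz).1) (by simp) (fun z hz => ((hmem z).1 hz).1)
    (by simp) (by
      rintro (_ | _ | z) hz hz'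
      · simp at hz
      · exact absurd rfl hz'
      · simp)
  rw [listCumulant_eq_cumulantOn φ htracial (l := (x * y) :: l) _ (by simp) (fun i => i + 1)] at h
  rotate_left
  · intro i j hij _
    simpa using hij
  · intro z
    rw [hmem]
    constructor
    · rintro ⟨h1, h2⟩
      exact ⟨z - 1, by simp; omega, by omega⟩
    · rintro ⟨i, hi, rfl⟩
      simp at hi
      omega
  · intro i hi
    simp only [List.length_cons] at hi
    simp [hi]
  rw [h]
  have herase : insert 0 ((Finset.range (l.length + 2)).erase 0) = Finset.range (l.length + 2) :=
    Finset.insert_erase (by simp)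
  rw [herase]
  congr 1
  symm
  refine Finset.sum_bij (fun k _ => k + 1) ?_ ?_ ?_ ?_
  · intro k hk
    rw [Finset.mem_range] at hk
    rw [hmem]
    omega
  · intro i _ j _ hij
    simpa using hij
  · intro z hz
    rw [hmem] at hz
    exact ⟨z - 1, by simp; omega, by omega⟩
  · intro k hk
    rw [Finset.mem_range] at hk
    rw [mul_comm]
    congr 1
    · symm
      refine listCumulant_eq_cumulantOn φ htracial _ (by simp)
        (fun i => if i = 0 then 0 else i + (k + 1)) ?_ ?_ ?_
      · intro i j hij _
        split_ifs <;> omega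
      · intro z
        simp only [Finset.mem_insert, Finset.mem_filter, hmem, List.length_cons, List.length_drop]
        constructor
        · rintro (rfl | ⟨⟨h1, h2⟩, h3⟩)
          · exact ⟨0, by omega, by simp⟩
          · refine ⟨z - (k + 1), by omega, ?_⟩
            rw [if_neg (by omega)]
            omega
        · rintro ⟨i, hi, rfl⟩
          split_ifs
          · exact .inl rfl
          · omega
      · intro i hi
        simp only [List.length_cons, List.length_drop] at hi
        rcases i with _ | i
        · simp
        · have e1 : k + (i + 1) = k + i + 1 := by omega
          have e2 : k + i < l.length := by omega
          simp [show i + 1 + (k + 1) = (k + i) + 1 + 1 by omega, e2]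
    · symm
      refine listCumulant_eq_cumulantOn φ htracial _ (by simp) (fun i => i + 1) ?_ ?_ ?_
      · intro i j hij _
        simpa using hij
      · intro z
        simp only [Finset.mem_filter, hmem, List.length_cons, List.length_take]
        constructor
        · rintro ⟨⟨h1, h2⟩, h3⟩
          exact ⟨z - 1, by omega, by omega⟩
        · rintro ⟨i, hi, rfl⟩
          omega
      · intro i hi
        simp only [List.length_cons, List.length_take] at hi
        rcases i with _ | i
        · simp
        · have e2 : i < l.length := by omega
          simp [e2]

/-- Cumulants of length at least two vanish if an entry is the unit: in the formula for `1 * b` all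
terms but the first and the last contain a shorter cumulant of this kind, and the last one equals
the left-hand side. -/
theorem listCumulant_one_cons (hunital : φ 1 = 1) (htracial : ∀ a b : A, φ (a * b) = φ (b * a))
    {l : List A} (hl : l ≠ []) : listCumulant φ (1 :: l) = 0 := by
  induction hn : l.length using Nat.strong_induction_on generalizing l with
  | _ n ih =>
    obtain ⟨b, w, rfl⟩ := List.exists_cons_of_ne_nil hl
    have h := listCumulant_mul_cons φ htracial 1 b w
    rw [one_mul, Finset.sum_range_succ, Finset.sum_eq_zero, List.take_length, List.drop_length,
      listCumulant_singleton, hunital, mul_one, zero_add] at h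
    · exact right_eq_add.1 h
    · intro k hk
      rw [Finset.mem_range] at hk
      rw [ih (w.drop k).length (by simp at hn ⊢; omega) (by simp; omega) rfl, mul_zero]

/-- The free cumulant of the entries of a cycle, which is well defined for a tracial functional. -/
def cycleCumulant (htracial : ∀ a b : A, φ (a * b) = φ (b * a)) (c : Cycle A) : ℂ :=
  Quotient.lift (listCumulant φ) (s := List.IsRotated.setoid A)
    (fun _ _ h => listCumulant_isRotated φ htracial h) c

theorem cycleCumulant_coe (htracial : ∀ a b : A, φ (a * b) = φ (b * a)) (l : List A) :
    cycleCumulant φ htracial (l : Cycle A) = listCumulant φ l := rfl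

/-! ### Mixed cumulants vanish -/

/-- A non-crossing partition of an interval has a block which is an interval. -/
theorem exists_interval_mem_parts {i j : ℕ} (hij : i < j) {σ : Finpartition (Finset.Ico i j)}
    (hσ : IsNonCrossing σ) :
    ∃ i' j', i ≤ i' ∧ i' < j' ∧ j' ≤ j ∧ Finset.Ico i' j' ∈ σ.parts := by
  classical
  have hne : σ.parts.Nonempty := σ.parts_nonempty (by simpa using hij)
  -- A block of minimal diameter has no gaps, since a block in a gap would have smaller diameter.
  obtain ⟨B, hB, hmin⟩ := σ.parts.exists_min_image
    (fun B => if h : B.Nonempty then B.max' h - B.min' h else 0) hne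
  have hBne := σ.nonempty_of_mem_parts hB
  have hm1 := B.min'_mem hBne
  have hm2 := B.max'_mem hBne
  have hle : B.min' hBne ≤ B.max' hBne := B.min'_le _ hm2
  have hs1 := Finset.mem_Ico.1 (σ.le hB hm1)
  have hs2 := Finset.mem_Ico.1 (σ.le hB hm2)
  refine ⟨B.min' hBne, B.max' hBne + 1, hs1.1, by omega, by omega, ?_⟩
  have : Finset.Ico (B.min' hBne) (B.max' hBne + 1) = B := by
    ext z
    rw [Finset.mem_Ico]
    refine ⟨fun ⟨h1, h2⟩ => ?_, fun hz => ⟨B.min'_le z hz, Nat.lt_succ_of_le (B.le_max' z hz)⟩⟩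
    by_contra hzB
    have hne1 : z ≠ B.min' hBne := fun e => hzB (e ▸ hm1)
    have hne2 : z ≠ B.max' hBne := fun e => hzB (e ▸ hm2)
    obtain ⟨C, hC, hzC⟩ := σ.exists_mem (a := z) (by rw [Finset.mem_Ico]; omega)
    have hCB : C ≠ B := fun e => hzB (e ▸ hzC)
    have hin : ∀ c ∈ C, B.min' hBne < c ∧ c < B.max' hBne := by
      intro c hc
      have hc1 : c ≠ B.min' hBne := fun e => hCB (σ.eq_of_mem_parts hC hB (e ▸ hc) hm1)
      have hc2 : c ≠ B.max' hBne := fun e => hCB (σ.eq_of_mem_parts hC hB (e ▸ hc) hm2)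
      refine ⟨?_, ?_⟩
      · by_contra h
        exact hσ C hC B hB hCB c hc _ hm1 z hzC _ hm2 (by omega) (by omega) (by omega)
      · by_contra h
        exact hσ B hB C hC hCB.symm _ hm1 z hzC _ hm2 c hc (by omega) (by omega) (by omega)
    have hCne : C.Nonempty := ⟨z, hzC⟩
    have h3 := hmin C hC
    rw [dif_pos hBne, dif_pos hCne] at h3
    have h4 := hin _ (C.min'_mem hCne)
    have h5 := hin _ (C.max'_mem hCne)
    have h6 := C.min'_le _ (C.max'_mem hCne)
    omega
  rwa [this]

/-- If the moments of all intervals vanish, then so do their cumulants: by induction, each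
non-crossing partition contributes a vanishing cumulant of a smaller interval. -/
theorem cumulantOn_Ico_eq_zero (a : ℕ → A) {N : ℕ}
    (h : ∀ i j, i < j → j ≤ N → φ (orderedProd a (Finset.Ico i j)) = 0) {i j : ℕ} (hij : i < j)
    (hj : j ≤ N) : cumulantOn φ a (Finset.Ico i j) = 0 := by
  induction hn : j - i using Nat.strong_induction_on generalizing i j with
  | _ n ih =>
    rw [cumulantOn_eq, h i j hij hj, Finset.sum_eq_zero, sub_zero]
    intro σ hσ
    obtain ⟨hnc, hne⟩ := Finset.mem_filter.1 hσ
    obtain ⟨i', j', h1, h2, h3, hB⟩ := exists_interval_mem_parts hij (mem_ncPartitions.1 hnc)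
    refine Finset.prod_eq_zero hB (ih (j' - i') ?_ h2 (by omega) rfl)
    have := block_card_lt σ hne hB
    simp only [Nat.card_Ico] at this
    omega

theorem sort_Ico (i j : ℕ) : (Finset.Ico i j).sort (· ≤ ·) = List.range' i (j - i) := by
  refine List.Perm.eq_of_pairwise (le := (· ≤ ·)) (fun a b _ _ => le_antisymm)
    (Finset.pairwise_sort _ _) ?_ ?_
  · exact (List.pairwise_lt_range' (s := i) (n := j - i)).imp le_of_lt
  · refine (List.perm_ext_iff_of_nodup (Finset.sort_nodup _ _) List.nodup_range').2 fun a => ?_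
    simp only [Finset.mem_sort, Finset.mem_Ico, List.mem_range'_1]
    omega

variable {I : Type*} {S : I → Subalgebra ℂ A}

/-- The cumulant of an alternating list of centred elements of free subalgebras vanishes: all
moments of its intervals do, and each non-crossing partition has an interval as a block. -/
theorem listCumulant_eq_zero_of_alternating (hfree : FreelyIndependent φ S) (l : List (I × A))
    (hl : l ≠ []) (hS : ∀ p ∈ l, p.2 ∈ S p.1) (hφ : ∀ p ∈ l, φ p.2 = 0)
    (halt : l.IsChain fun p q => p.1 ≠ q.1) : listCumulant φ (l.map Prod.snd) = 0 := by
  rw [listCumulant, Finset.range_eq_Ico]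
  refine cumulantOn_Ico_eq_zero φ _ (N := (l.map Prod.snd).length) ?_
    (by simpa [List.length_pos_iff] using hl) le_rfl
  intro i j hij hj
  obtain ⟨n, rfl⟩ : ∃ n, j = i + (n + 1) := ⟨j - i - 1, by omega⟩
  rw [List.length_map] at hj
  have hlt : ∀ k : Fin (n + 1), i + k.1 < l.length := fun k => by omega
  have h := hfree n (fun k => (l[i + k.1]'(hlt k)).1) (fun k => (l[i + k.1]'(hlt k)).2) ?_
    (fun k => hS _ (List.getElem_mem _)) (fun k => hφ _ (List.getElem_mem _))
  · rw [← h, orderedProd, sort_Ico, show i + (n + 1) - i = n + 1 by omega]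
    congr 2
    refine List.ext_getElem (by simp) fun k h1 h2 => ?_
    simp only [List.length_map, List.length_range'] at h1
    have := hlt ⟨k, h1⟩
    simp only at this
    rw [List.getElem_map, List.getElem_ofFn, List.getElem_range']
    simp [this]
  · intro k
    exact List.isChain_iff_getElem.1 halt (i + k.1) (by omega)

/-- Free cumulants vanish as soon as two entries belong to different free subalgebras. Each letter
is given with the index of a subalgebra to which it belongs. -/
theorem listCumulant_eq_zero_of_mixed (hunital : φ 1 = 1)
    (htracial : ∀ a b : A, φ (a * b) = φ (b * a)) (hfree : FreelyIndependent φ S)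
    (l : List (I × A)) (hS : ∀ p ∈ l, p.2 ∈ S p.1)
    (hmix : ∃ p ∈ l, ∃ q ∈ l, p.1 ≠ q.1) : listCumulant φ (l.map Prod.snd) = 0 := by
  induction hn : l.length using Nat.strong_induction_on generalizing l with
  | _ n ih =>
  by_cases halt : l.IsChain fun p q => p.1 ≠ q.1
  · -- All letters can be centred, as cumulants with an entry `1` vanish.
    have hlen : 2 ≤ l.length := by
      obtain ⟨p, hp, q, hq, hne⟩ := hmix
      rcases l with _ | ⟨a, _ | ⟨b, l⟩⟩
      · simp at hp
      · simp only [List.mem_singleton] at hp hq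
        exact absurd (hp.trans hq.symm ▸ rfl) hne
      · simp
    let ctr : I × A → I × A := fun p => (p.1, p.2 + (-φ p.2) • 1)
    have hctr : ∀ u w : List (I × A), u ++ w = l →
        listCumulant φ (l.map Prod.snd) =
          listCumulant φ ((u.map ctr ++ w).map Prod.snd) := by
      intro u
      induction u using List.reverseRecOn with
      | nil => rintro w rfl; simp
      | append_singleton u p ihu =>
        intro w hw
        have hw' : u ++ (p :: w) = l := by rw [← hw]; simp
        have hne : w.map Prod.snd ++ (u.map ctr).map Prod.snd ≠ [] := by
          intro h
          have h1 := congrArg List.length h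
          have h2 := congrArg List.length hw'
          simp at h1 h2
          simp [h1] at h2
          omega
        rw [ihu _ hw']
        simp only [List.map_append, List.map_cons, List.map_nil, List.append_assoc,
          List.cons_append, List.nil_append]
        rw [listCumulant_append_comm φ htracial _ (_ :: _),
          listCumulant_append_comm φ htracial _ (_ :: _), List.cons_append, List.cons_append]
        change _ = listCumulant φ ((p.2 + (-φ p.2) • 1) :: _)
        rw [listCumulant_add_smul_cons, listCumulant_one_cons φ hunital htracial hne]
        ring
    rw [hctr l [] (by simp), List.append_nil]
    refine listCumulant_eq_zero_of_alternating φ hfree (l.map ctr) ?_ ?_ ?_ ?_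
    · intro h
      have := congrArg List.length h
      simp at this
      simp [this] at hlen
    · intro p hp
      obtain ⟨q, hq, rfl⟩ := List.mem_map.1 hp
      exact (S q.1).add_mem (hS q hq) ((S q.1).smul_mem (S q.1).one_mem _)
    · intro p hp
      obtain ⟨q, hq, rfl⟩ := List.mem_map.1 hp
      simp [ctr, hunital]
    · rw [List.isChain_map]
      exact halt
  · -- Two neighbouring letters of the same subalgebra can be multiplied.
    obtain ⟨u, p, q, w, rfl, hpq⟩ : ∃ u p q w, l = u ++ p :: q :: w ∧ p.1 = q.1 := by
      rw [List.isChain_iff_getElem] at halt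
      push Not at halt
      obtain ⟨k, hk, he⟩ := halt
      refine ⟨l.take k, l[k], l[k + 1], l.drop (k + 2), ?_, he⟩
      rw [List.getElem_cons_drop, List.getElem_cons_drop, List.take_append_drop]
    obtain ⟨i, x⟩ := p
    obtain ⟨i', y⟩ := q
    obtain rfl : i = i' := hpq
    have hx : x ∈ S i := hS (i, x) (by simp)
    have hy : y ∈ S i := hS (i, y) (by simp)
    set v := w ++ u with hv
    have hvS : ∀ p ∈ v, p.2 ∈ S p.1 := fun p hp => hS p (by
      simp only [hv, List.mem_append] at hp
      simp only [List.mem_append, List.mem_cons]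
      tauto)
    obtain ⟨r, hr, hri⟩ : ∃ r ∈ v, r.1 ≠ i := by
      by_contra! hall
      have hall' : ∀ p ∈ u ++ (i, x) :: (i, y) :: w, p.1 = i := by
        intro p hp
        simp only [List.mem_append, List.mem_cons] at hp
        rcases hp with hp | rfl | rfl | hp
        · exact hall p (by simp [hv, hp])
        · rfl
        · rfl
        · exact hall p (by simp [hv, hp])
      obtain ⟨p, hp, q, hq, hne⟩ := hmix
      exact hne ((hall' p hp).trans (hall' q hq).symm)
    have hlen : v.length + 2 = n := by
      rw [← hn]
      simp [hv]
      omega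
    have key : ∀ (z : A) (v' : List (I × A)), z ∈ S i → v'.length < v.length + 1 →
        (∀ p ∈ v', p ∈ v) → r ∈ v' → listCumulant φ (z :: v'.map Prod.snd) = 0 := by
      intro z v' hz hl hsub hr'
      refine ih (v'.length + 1) (by omega) ((i, z) :: v') ?_ ?_ rfl
      · intro p hp
        rcases List.mem_cons.1 hp with rfl | hp
        · exact hz
        · exact hvS p (hsub p hp)
      · exact ⟨r, by simp [hr'], (i, z), by simp, hri⟩
    rw [List.map_append, listCumulant_append_comm φ htracial, ← List.map_append]
    change listCumulant φ (x :: y :: (w ++ u).map Prod.snd) = 0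
    have h := listCumulant_mul_cons φ htracial x y (v.map Prod.snd)
    rw [key (x * y) v ((S i).mul_mem hx hy) (by omega) (fun _ h => h) hr, Finset.sum_eq_zero,
      add_zero] at h
    · exact h.symm
    -- The letter `r` of another subalgebra belongs to one of the two shorter cumulants.
    · intro k _
      rw [← List.map_take, ← List.map_drop]
      have hr' := hr
      rw [← List.take_append_drop k v] at hr'
      rcases List.mem_append.1 hr' with hr' | hr'
      · rw [key y (v.take k) hy (by rw [List.length_take]; omega)
          (fun _ h => List.mem_of_mem_take h) hr', zero_mul]
      · rw [key x (v.drop k) hx (by rw [List.length_drop]; omega)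
          (fun _ h => List.mem_of_mem_drop h) hr', mul_zero]

end List

end NCProb

namespace Traffic

/-! ### Orbits of permutations -/

section Orbits

open Function Equiv

theorem mem_periodicPts_perm {E : Type*} [Finite E] (ρ : Perm E) (e : E) :
    e ∈ periodicPts ρ := by
  refine mk_mem_periodicPts (orderOf_pos ρ) ?_
  rw [IsPeriodicPt, IsFixedPt, ← Perm.coe_pow, pow_orderOf_eq_one, Perm.one_apply]

theorem mem_periodicOrbit_perm {E : Type*} [Finite E] {ρ : Perm E} {e e' : E} :
    e' ∈ periodicOrbit ρ e ↔ ∃ n, ρ^[n] e = e' :=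
  mem_periodicOrbit_iff (mem_periodicPts_perm ρ e)

theorem mem_periodicOrbit_perm_lt {E : Type*} [Finite E] {ρ : Perm E} {e e' : E} :
    e' ∈ periodicOrbit ρ e ↔ ∃ n < minimalPeriod ρ e, ρ^[n] e = e' := by
  simp [periodicOrbit, eq_comm]

theorem self_mem_periodicOrbit_perm {E : Type*} [Finite E] (ρ : Perm E) (e : E) :
    e ∈ periodicOrbit ρ e :=
  self_mem_periodicOrbit (mem_periodicPts_perm ρ e)

theorem minimalPeriod_perm_pos {E : Type*} [Finite E] (ρ : Perm E) (e : E) :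
    0 < minimalPeriod ρ e :=
  minimalPeriod_pos_of_mem_periodicPts (mem_periodicPts_perm ρ e)

theorem periodicOrbit_eq_of_mem {E : Type*} [Finite E] {ρ : Perm E} {e e' : E}
    (h : e' ∈ periodicOrbit ρ e) : periodicOrbit ρ e' = periodicOrbit ρ e := by
  obtain ⟨n, rfl⟩ := mem_periodicOrbit_perm.1 h
  exact periodicOrbit_apply_iterate_eq (mem_periodicPts_perm ρ e) n

theorem mem_periodicOrbit_comm {E : Type*} [Finite E] {ρ : Perm E} {e e' : E} :
    e' ∈ periodicOrbit ρ e ↔ e ∈ periodicOrbit ρ e' :=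
  ⟨fun h => periodicOrbit_eq_of_mem h ▸ self_mem_periodicOrbit_perm ρ e,
    fun h => periodicOrbit_eq_of_mem h ▸ self_mem_periodicOrbit_perm ρ e'⟩

theorem apply_mem_periodicOrbit {E : Type*} [Finite E] {ρ : Perm E} {e e' : E} :
    ρ e' ∈ periodicOrbit ρ e ↔ e' ∈ periodicOrbit ρ e := by
  rw [mem_periodicOrbit_comm, periodicOrbit_apply_eq (mem_periodicPts_perm ρ e'),
    mem_periodicOrbit_comm]

/-- To find the orbit of `x` it suffices to list its elements up to the first return. -/
theorem iterate_and_minimalPeriod_eq {α : Type*} {f : α → α} {x : α} {n : ℕ} (g : ℕ → α)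
    (hn : 0 < n) (h0 : g 0 = x) (hs : ∀ i, i + 1 < n → f (g i) = g (i + 1))
    (hl : f (g (n - 1)) = x) (hne : ∀ i < n, g i = x → i = 0) :
    (∀ i < n, f^[i] x = g i) ∧ minimalPeriod f x = n := by
  have h1 : ∀ i < n, f^[i] x = g i := by
    intro i hi
    induction i with
    | zero => exact h0.symm
    | succ i ih => rw [iterate_succ_apply', ih (by omega), hs i hi]
  refine ⟨h1, ?_⟩
  have hper : IsPeriodicPt f n x := by
    obtain ⟨m, rfl⟩ : ∃ m, n = m + 1 := ⟨n - 1, by omega⟩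
    rw [IsPeriodicPt, IsFixedPt, iterate_succ_apply', h1 m (by omega)]
    exact hl
  refine le_antisymm (hper.minimalPeriod_le hn) ?_
  by_contra hlt
  have hpos := hper.minimalPeriod_pos hn
  have := hne _ (not_le.1 hlt) ((h1 _ (not_le.1 hlt)).symm.trans iterate_minimalPeriod)
  omega

theorem periodicOrbit_eq_coe {α : Type*} {f : α → α} {x : α} {n : ℕ} (g : ℕ → α)
    (hn : 0 < n) (h0 : g 0 = x) (hs : ∀ i, i + 1 < n → f (g i) = g (i + 1))
    (hl : f (g (n - 1)) = x) (hne : ∀ i < n, g i = x → i = 0) :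
    periodicOrbit f x = ((List.range n).map g : Cycle α) := by
  obtain ⟨h1, h2⟩ := iterate_and_minimalPeriod_eq g hn h0 hs hl hne
  rw [periodicOrbit, h2]
  congr 1
  exact List.map_congr_left fun i hi => h1 i (List.mem_range.1 hi)

theorem periodicOrbit_map {E F : Type*} {ρ : E → E} {σ : F → F} {i : E → F}
    (hi : Injective i) {e : E} (h : ∀ n, σ^[n] (i e) = i (ρ^[n] e)) :
    periodicOrbit σ (i e) = (periodicOrbit ρ e).map i := by
  have hp : minimalPeriod σ (i e) = minimalPeriod ρ e := by
    rw [minimalPeriod_eq_minimalPeriod_iff]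
    intro n
    rw [IsPeriodicPt, IsFixedPt, IsPeriodicPt, IsFixedPt, h, hi.eq_iff]
  rw [periodicOrbit, periodicOrbit, hp, Cycle.map_coe, List.map_map]
  congr 1
  exact List.map_congr_left fun n _ => h n

theorem cycle_map_injective {E F : Type*} {i : E → F} (hi : Injective i) :
    Injective (Cycle.map i) := by
  rintro ⟨l⟩ ⟨l'⟩ h
  have h' : l.map i ~r l'.map i := Cycle.coe_eq_coe.1 h
  obtain ⟨n, hn⟩ := h'
  rw [← List.map_rotate] at hn
  exact Cycle.coe_eq_coe.2 ⟨n, (List.map_injective_iff.2 hi) hn⟩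

/-- The product of a function `k` of cycles over the orbits of the elements of `s`, where each orbit
is counted once. -/
def orbitProd {E : Type*} (ρ : Perm E) (k : Cycle E → ℂ) (s : Set E) : ℂ :=
  ∏ᶠ c ∈ periodicOrbit ρ '' s, k c

theorem orbitProd_union {E : Type*} [Finite E] (ρ : Perm E) (k : Cycle E → ℂ) {s t : Set E}
    (hst : Disjoint s t) (hs : ∀ e ∈ s, ρ e ∈ s) :
    orbitProd ρ k (s ∪ t) = orbitProd ρ k s * orbitProd ρ k t := by
  unfold orbitProd
  rw [Set.image_union, finprod_mem_union _ (Set.toFinite _) (Set.toFinite _)]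
  rw [Set.disjoint_left]
  rintro _ ⟨e, he, rfl⟩ ⟨e', he', h⟩
  have h1 : e' ∈ periodicOrbit ρ e := h ▸ self_mem_periodicOrbit_perm ρ e'
  obtain ⟨n, rfl⟩ := mem_periodicOrbit_perm.1 h1
  have h2 : ∀ n, ρ^[n] e ∈ s := fun n => by
    induction n with
    | zero => exact he
    | succ n ih => rw [iterate_succ_apply']; exact hs _ ih
  exact Set.disjoint_left.1 hst (h2 n) he'

theorem orbitProd_orbit {E : Type*} [Finite E] (ρ : Perm E) (k : Cycle E → ℂ) (x : E) :
    orbitProd ρ k {e | e ∈ periodicOrbit ρ x} = k (periodicOrbit ρ x) := by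
  have : periodicOrbit ρ '' {e | e ∈ periodicOrbit ρ x} = {periodicOrbit ρ x} := by
    ext c
    constructor
    · rintro ⟨e, he, rfl⟩
      exact periodicOrbit_eq_of_mem he
    · rintro rfl
      exact ⟨x, self_mem_periodicOrbit_perm ρ x, rfl⟩
  rw [orbitProd, this, finprod_mem_singleton]

theorem orbitProd_congr {E : Type*} {ρ σ : Perm E} {k k' : Cycle E → ℂ} {s : Set E}
    (h : ∀ e ∈ s, periodicOrbit ρ e = periodicOrbit σ e)
    (hk : ∀ e ∈ s, k (periodicOrbit σ e) = k' (periodicOrbit σ e)) :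
    orbitProd ρ k s = orbitProd σ k' s := by
  refine finprod_mem_congr (Set.image_congr h) ?_
  rintro _ ⟨e, he, rfl⟩
  exact hk e he

theorem orbitProd_image {E F : Type*} {ρ : Perm E} {σ : Perm F} {i : E → F} (hi : Injective i)
    (k : Cycle F → ℂ) {s : Set E} (h : ∀ e ∈ s, ∀ n, σ^[n] (i e) = i (ρ^[n] e)) :
    orbitProd σ k (i '' s) = orbitProd ρ (fun c => k (c.map i)) s := by
  have : periodicOrbit σ '' (i '' s) = Cycle.map i '' (periodicOrbit ρ '' s) := by
    rw [Set.image_image, Set.image_image]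
    exact Set.image_congr fun e he => periodicOrbit_map hi (h e he)
  rw [orbitProd, this, finprod_mem_image (cycle_map_injective hi).injOn]
  rfl

theorem orbitProd_univ {E : Type*} [Finite E] (ρ : Perm E) (k : Cycle E → ℂ) (x : E) :
    orbitProd ρ k Set.univ =
      k (periodicOrbit ρ x) * orbitProd ρ k {e | e ∉ periodicOrbit ρ x} := by
  rw [← orbitProd_orbit ρ k x, ← orbitProd_union]
  · congr 1
    ext e
    simpa using em _
  · rw [Set.disjoint_left]
    exact fun e h h' => h' h
  · exact fun e he => apply_mem_periodicOrbit.2 he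

/-! ### Cutting an orbit in two -/

section Cut

variable {E : Type*} (σ : Perm E) (x : E) {j : ℕ}

theorem iterate_ne_self {i : ℕ} (hi : 0 < i) (hi' : i < minimalPeriod σ x) : σ^[i] x ≠ x :=
  fun h => absurd (IsPeriodicPt.minimalPeriod_le hi h) (not_le.2 hi')

theorem iterate_injOn {i j : ℕ} (hi : i < minimalPeriod σ x) (hj : j < minimalPeriod σ x)
    (h : σ^[i] x = σ^[j] x) : i = j :=
  (iterate_eq_iterate_iff_of_lt_minimalPeriod hi hj).1 h

variable [DecidableEq E]

theorem periodicOrbit_mul_swap_apply (hj : 0 < j) (hj' : j < minimalPeriod σ x) :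
    periodicOrbit (σ * swap x (σ^[j] x)) (σ x) =
      ((List.range j).map fun i => σ^[i + 1] x : Cycle E) := by
  refine periodicOrbit_eq_coe _ hj rfl ?_ ?_ ?_
  · intro i hi
    rw [Perm.mul_apply, swap_apply_of_ne_of_ne, iterate_succ_apply' _ (i + 1)]
    · exact iterate_ne_self σ x (by omega) (by omega)
    · intro h
      have := iterate_injOn σ x (by omega) (by omega) h
      omega
  · rw [Nat.sub_add_cancel hj, Perm.mul_apply, swap_apply_right]
  · intro i hi h
    have := iterate_injOn σ x (i := i + 1) (j := 1) (by omega) (by omega) h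
    omega

theorem periodicOrbit_mul_swap_self (hj : 0 < j) (hj' : j < minimalPeriod σ x) :
    periodicOrbit (σ * swap x (σ^[j] x)) x =
      (x :: (List.range (minimalPeriod σ x - j - 1)).map fun i => σ^[j + 1 + i] x : List E) := by
  rw [periodicOrbit_eq_coe (n := minimalPeriod σ x - j)
    (fun i => if i = 0 then x else σ^[j + i] x) (by omega) (by simp)]
  · obtain ⟨m, hm⟩ : ∃ m, minimalPeriod σ x - j = m + 1 := ⟨minimalPeriod σ x - j - 1, by omega⟩
    rw [hm, List.range_succ_eq_map]
    simp only [List.map_cons, if_true, List.map_map, Nat.add_sub_cancel]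
    congr 2
    refine List.map_congr_left fun i _ => ?_
    simp only [comp_apply, Nat.succ_ne_zero, if_false]
    congr 1
    omega
  · intro i hi
    rw [if_neg (by omega : ¬ i + 1 = 0)]
    split_ifs with h
    · subst h
      rw [Perm.mul_apply, swap_apply_left, ← iterate_succ_apply' σ]
    · rw [Perm.mul_apply, swap_apply_of_ne_of_ne, ← add_assoc, iterate_succ_apply']
      · exact iterate_ne_self σ x (by omega) (by omega)
      · intro h
        have := iterate_injOn σ x (by omega) (by omega) h
        omega
  · split_ifs with h
    · rw [Perm.mul_apply, swap_apply_left, ← iterate_succ_apply' σ,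
        show (j.succ = minimalPeriod σ x) by omega, iterate_minimalPeriod]
    · rw [Perm.mul_apply, swap_apply_of_ne_of_ne, ← iterate_succ_apply' σ,
        show (j + (minimalPeriod σ x - j - 1)).succ = minimalPeriod σ x by omega,
        iterate_minimalPeriod]
      · exact iterate_ne_self σ x (by omega) (by omega)
      · intro h
        have := iterate_injOn σ x (by omega) (by omega) h
        omega
  · intro i hi h
    by_contra h0
    rw [if_neg h0] at h
    exact iterate_ne_self σ x (by omega) (by omega) h

variable [Finite E]

theorem iterate_mul_swap_of_notMem {e c : E} (he : e ∉ periodicOrbit σ x)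
    (hc : c ∈ periodicOrbit σ x) (n : ℕ) : (σ * swap x c)^[n] e = σ^[n] e := by
  induction n with
  | zero => rfl
  | succ n ih =>
    have hmem : σ^[n] e ∉ periodicOrbit σ x := by
      intro h
      have h1 : σ^[n] e ∈ periodicOrbit σ e := mem_periodicOrbit_perm.2 ⟨n, rfl⟩
      rw [← periodicOrbit_eq_of_mem h, periodicOrbit_eq_of_mem h1] at he
      exact he (self_mem_periodicOrbit_perm σ e)
    rw [iterate_succ_apply', iterate_succ_apply', ih, Perm.mul_apply, swap_apply_of_ne_of_ne]
    · rintro h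
      exact hmem (h ▸ self_mem_periodicOrbit_perm σ x)
    · rintro h
      exact hmem (h ▸ hc)

/-- Composition with a transposition of two elements of an orbit cuts the orbit in two. -/
theorem orbitProd_mul_swap (k : Cycle E → ℂ) (hj : 0 < j) (hj' : j < minimalPeriod σ x) :
    orbitProd (σ * swap x (σ^[j] x)) k Set.univ =
      k ((List.range j).map fun i => σ^[i + 1] x : Cycle E) *
      k (x :: (List.range (minimalPeriod σ x - j - 1)).map fun i => σ^[j + 1 + i] x : List E) *
      orbitProd σ k {e | e ∉ periodicOrbit σ x} := by
  set σ' := σ * swap x (σ^[j] x) with hσ'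
  have h1 := periodicOrbit_mul_swap_apply σ x hj hj'
  have h2 := periodicOrbit_mul_swap_self σ x hj hj'
  rw [← hσ'] at h1 h2
  have hm1 : ∀ e, e ∈ periodicOrbit σ' (σ x) ↔ ∃ i < j, σ^[i + 1] x = e := by
    intro e
    rw [h1]
    simp [eq_comm]
  have hm2 : ∀ e, e ∈ periodicOrbit σ' x ↔
      e = x ∨ ∃ i < minimalPeriod σ x - j - 1, σ^[j + 1 + i] x = e := by
    intro e
    rw [h2]
    simp [eq_comm]
  have hsub : ∀ e, e ∈ periodicOrbit σ x ↔
      e ∈ periodicOrbit σ' (σ x) ∨ e ∈ periodicOrbit σ' x := by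
    intro e
    rw [hm1, hm2]
    constructor
    · intro h
      obtain ⟨n, hn, rfl⟩ := mem_periodicOrbit_perm_lt.1 h
      rcases n with _ | n
      · exact .inr (.inl rfl)
      · by_cases hnj : n < j
        · exact .inl ⟨n, hnj, rfl⟩
        · exact .inr (.inr ⟨n - j, by omega, by congr 1; omega⟩)
    · rintro (⟨i, -, rfl⟩ | rfl | ⟨i, -, rfl⟩)
      · exact mem_periodicOrbit_perm.2 ⟨_, rfl⟩
      · exact self_mem_periodicOrbit_perm σ _
      · exact mem_periodicOrbit_perm.2 ⟨_, rfl⟩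
  have hdisj : ∀ e, e ∈ periodicOrbit σ' (σ x) → e ∉ periodicOrbit σ' x := by
    intro e h h'
    obtain ⟨i, hi, rfl⟩ := (hm1 _).1 h
    rcases (hm2 _).1 h' with h' | ⟨l, hl, h'⟩
    · exact iterate_ne_self σ x (by omega) (by omega) h'
    · have := iterate_injOn σ x (by omega) (by omega) h'
      omega
  have hc : σ^[j] x ∈ periodicOrbit σ x := mem_periodicOrbit_perm.2 ⟨j, rfl⟩
  have huniv : (Set.univ : Set E) = {e | e ∈ periodicOrbit σ' (σ x)} ∪
      ({e | e ∈ periodicOrbit σ' x} ∪ {e | e ∉ periodicOrbit σ x}) := by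
    ext e
    have := hsub e
    simp only [Set.mem_univ, Set.mem_union, Set.mem_ofPred_eq, true_iff]
    tauto
  rw [huniv, orbitProd_union, orbitProd_union, orbitProd_orbit, orbitProd_orbit, h1, h2, mul_assoc]
  · congr 2
    refine orbitProd_congr (fun e he => ?_) fun _ _ => rfl
    have := periodicOrbit_map (ρ := σ) (σ := σ') (i := id) injective_id (e := e)
      fun n => iterate_mul_swap_of_notMem σ x he hc n
    simpa [periodicOrbit] using this
  · rw [Set.disjoint_left]
    exact fun e he he' => he' ((hsub e).2 (.inr he))
  · exact fun e he => apply_mem_periodicOrbit.2 he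
  · rw [Set.disjoint_left]
    rintro e he (he' | he')
    · exact hdisj e he he'
    · exact he' ((hsub e).2 (.inl he))
  · exact fun e he => apply_mem_periodicOrbit.2 he

end Cut

end Orbits

/-! ### Sums over cactus permutations -/

open Function Equiv

theorem cycle_map_congr {E F : Type*} {f g : E → F} {c : Cycle E} (h : ∀ e ∈ c, f e = g e) :
    c.map f = c.map g := by
  induction c using Quotient.inductionOn' with | _ l
  exact congrArg (fun l : List F => (l : Cycle F)) (List.map_congr_left fun e he => h e he)

theorem cycle_map_map {E F G : Type*} (f : E → F) (g : F → G) (c : Cycle E) :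
    (c.map f).map g = c.map (g ∘ f) := by
  induction c using Quotient.inductionOn' with | _ l
  exact congrArg (fun l : List G => (l : Cycle G)) List.map_map

/-- A graph with edge set `E` is encoded by the set `D` of all pairs `(f ∘ src, f ∘ tgt)`, where `f`
runs through the rational functions on the vertices. A permutation `ρ` of the edges is a cactus
permutation if `src e = tgt (ρ e)` for all edges `e` and every function on the edges is the sum of
a function of the target and a function of the orbit of the edge, the vertices being identified as
required by the first condition. For a connected graph the second condition says that the bipartite
graph of vertices and orbits, with one edge for each element of `E`, is a tree: the coboundary
operator of a connected graph is onto exactly for trees. Hence the graph obtained by the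
identifications is a cactus with pads the orbits of `ρ`, which runs through each pad against its
direction. -/
def IsCactusPerm {E : Type*} (D : Set ((E → ℚ) × (E → ℚ))) (ρ : Perm E) : Prop :=
  ∀ h : E → ℚ, ∃ p ∈ D, (∀ e, p.1 e = p.2 (ρ e)) ∧ ∀ e, p.2 (ρ e) - h (ρ e) = p.2 e - h e

theorem map_range_minimalPeriod {A E : Type*} [Finite E] (ρ : Perm E) (ℓ : E → A) (x : E) :
    ((List.range (minimalPeriod ρ x)).map fun i => ℓ (ρ^[i] x)) =
      ℓ x :: (List.range (minimalPeriod ρ x - 1)).map fun i => ℓ (ρ^[i + 1] x) := by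
  obtain ⟨m, hm⟩ : ∃ m, minimalPeriod ρ x = m + 1 :=
    ⟨minimalPeriod ρ x - 1, by have := minimalPeriod_perm_pos ρ x; omega⟩
  rw [hm, List.range_succ_eq_map, List.map_cons, List.map_map]
  rfl

section Cumulant

variable {A : Type*} [Ring A] [Algebra ℂ A] (φ : A →ₗ[ℂ] ℂ)
  (htracial : ∀ a b : A, φ (a * b) = φ (b * a))

/-- The product of the free cumulants of the labels of the orbits of a permutation. -/
def permCumulant {E : Type*} (ρ : Perm E) (ℓ : E → A) : ℂ :=
  orbitProd ρ (fun c => NCProb.cycleCumulant φ htracial (c.map ℓ)) Set.univ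

open scoped Classical in
/-- The sum of the products of free cumulants over all cactus permutations. -/
def cactusSum {E : Type*} (D : Set ((E → ℚ) × (E → ℚ))) (ℓ : E → A) : ℂ :=
  ∑ᶠ ρ : Perm E, if IsCactusPerm D ρ then permCumulant φ htracial ρ ℓ else 0

theorem permCumulant_eq {E : Type*} [Finite E] (ρ : Perm E) (ℓ : E → A) (x : E) :
    permCumulant φ htracial ρ ℓ =
      NCProb.listCumulant φ ((List.range (minimalPeriod ρ x)).map fun i => ℓ (ρ^[i] x)) *
        orbitProd ρ (fun c => NCProb.cycleCumulant φ htracial (c.map ℓ))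
          {e | e ∉ periodicOrbit ρ x} := by
  rw [permCumulant, orbitProd_univ ρ _ x, periodicOrbit, Cycle.map_coe,
    NCProb.cycleCumulant_coe, List.map_map]
  rfl

theorem orbitProd_label_congr {E : Type*} [Finite E] (ρ : Perm E) {ℓ ℓ' : E → A} {x : E}
    (h : ∀ e, e ≠ x → ℓ e = ℓ' e) :
    orbitProd ρ (fun c => NCProb.cycleCumulant φ htracial (c.map ℓ)) {e | e ∉ periodicOrbit ρ x} =
      orbitProd ρ (fun c => NCProb.cycleCumulant φ htracial (c.map ℓ'))
        {e | e ∉ periodicOrbit ρ x} := by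
  refine orbitProd_congr (fun _ _ => rfl) fun e he => ?_
  congr 1
  refine cycle_map_congr fun e' he' => h e' ?_
  rintro rfl
  exact he (mem_periodicOrbit_comm.1 he')

/-- Cactus sums are invariant under isomorphisms of graphs. -/
theorem cactusSum_equiv {E F : Type*} (i : E ≃ F)
    {D : Set ((E → ℚ) × (E → ℚ))} {D' : Set ((F → ℚ) × (F → ℚ))} {ℓ : E → A} {ℓ' : F → A}
    (hD : ∀ p : (F → ℚ) × (F → ℚ), p ∈ D' ↔ (p.1 ∘ i, p.2 ∘ i) ∈ D) (hℓ : ∀ e, ℓ e = ℓ' (i e)) :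
    cactusSum φ htracial D' ℓ' = cactusSum φ htracial D ℓ := by
  rw [cactusSum, cactusSum, ← finsum_comp_equiv i.permCongr]
  refine finsum_congr fun ρ => ?_
  have hc : permCumulant φ htracial (i.permCongr ρ) ℓ' = permCumulant φ htracial ρ ℓ := by
    have hit : ∀ e n, (i.permCongr ρ)^[n] (i e) = i (ρ^[n] e) := by
      intro e n
      induction n with
      | zero => rfl
      | succ n ih => rw [iterate_succ_apply', ih, iterate_succ_apply']; simp
    rw [permCumulant, ← Set.image_univ_of_surjective i.surjective,
      orbitProd_image (ρ := ρ) i.injective _ fun e _ n => hit e n, permCumulant]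
    refine orbitProd_congr (fun _ _ => rfl) fun e _ => ?_
    rw [cycle_map_map]
    congr 1
    exact cycle_map_congr fun e _ => (hℓ e).symm
  have ht : IsCactusPerm D' (i.permCongr ρ) ↔ IsCactusPerm D ρ := by
    constructor
    · intro H h
      obtain ⟨p, hp, h1, h2⟩ := H (h ∘ i.symm)
      refine ⟨_, (hD p).1 hp, fun e => ?_, fun e => ?_⟩
      · simpa using h1 (i e)
      · simpa using h2 (i e)
    · intro H h
      obtain ⟨p, hp, h1, h2⟩ := H (h ∘ i)
      refine ⟨(p.1 ∘ i.symm, p.2 ∘ i.symm), (hD _).2 ?_, fun e => ?_, fun e => ?_⟩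
      · simpa [comp_assoc] using hp
      · simpa using h1 (i.symm e)
      · simpa using h2 (i.symm e)
  by_cases h : IsCactusPerm D ρ
  · rw [if_pos h, if_pos (ht.2 h), hc]
  · rw [if_neg h, if_neg fun h' => h (ht.1 h')]

/-- A cactus sum is linear in each label. -/
theorem cactusSum_add_smul {E : Type*} [Finite E] [DecidableEq E]
    (D : Set ((E → ℚ) × (E → ℚ))) (ℓ : E → A) (a : E) (x y : A) (c : ℂ) :
    cactusSum φ htracial D (update ℓ a (x + c • y)) =
      cactusSum φ htracial D (update ℓ a x) + c * cactusSum φ htracial D (update ℓ a y) := by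
  have := Fintype.ofFinite E
  rw [cactusSum, cactusSum, cactusSum, finsum_eq_sum_of_fintype, finsum_eq_sum_of_fintype,
    finsum_eq_sum_of_fintype, Finset.mul_sum, ← Finset.sum_add_distrib]
  refine Finset.sum_congr rfl fun ρ _ => ?_
  split_ifs
  · have hw : ∀ z : A, ((List.range (minimalPeriod ρ a - 1)).map
        fun i => update ℓ a z (ρ^[i + 1] a)) =
        (List.range (minimalPeriod ρ a - 1)).map fun i => ℓ (ρ^[i + 1] a) := by
      intro z
      refine List.map_congr_left fun i hi => update_of_ne ?_ _ _
      have := List.mem_range.1 hi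
      exact iterate_ne_self ρ a (by omega) (by omega)
    have hR : ∀ z : A, permCumulant φ htracial ρ (update ℓ a z) =
        NCProb.listCumulant φ (z :: (List.range (minimalPeriod ρ a - 1)).map
          fun i => ℓ (ρ^[i + 1] a)) *
        orbitProd ρ (fun c => NCProb.cycleCumulant φ htracial (c.map ℓ))
          {e | e ∉ periodicOrbit ρ a} := by
      intro z
      rw [permCumulant_eq φ htracial ρ _ a, map_range_minimalPeriod, hw, update_self,
        orbitProd_label_congr φ htracial ρ fun e he => update_of_ne he z ℓ]
    rw [hR, hR, hR, NCProb.listCumulant_add_smul_cons]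
    ring
  · simp

/-- An edge labelled by the unit can be contracted. -/
theorem cactusSum_one {E : Type*} [Finite E] (hunital : φ 1 = 1)
    (D : Set ((Option E → ℚ) × (Option E → ℚ))) (ℓ : Option E → A) (hℓ : ℓ none = 1) :
    cactusSum φ htracial D ℓ = cactusSum φ htracial
      {p | ∃ q ∈ D, q.1 none = q.2 none ∧ p = (q.1 ∘ some, q.2 ∘ some)} (ℓ ∘ some) := by
  classical
  have := Fintype.ofFinite E
  rw [cactusSum, cactusSum, finsum_eq_sum_of_fintype, finsum_eq_sum_of_fintype]
  symm
  refine Finset.sum_of_injOn (fun ρ : Perm E => ρ.optionCongr) ?_ (by simp) ?_ ?_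
  · exact fun ρ _ σ _ h => Equiv.optionCongr_injective h
  · -- If the edge is not a fixed point, then its orbit has a vanishing cumulant.
    intro ρ _ hρ
    have hne : ρ none ≠ none := by
      intro h
      refine hρ ⟨removeNone ρ, by simp, ?_⟩
      simp only [map_equiv_removeNone, h, swap_self]
      rfl
    split_ifs
    · rw [permCumulant_eq φ htracial ρ ℓ none, map_range_minimalPeriod, hℓ,
        NCProb.listCumulant_one_cons φ hunital htracial, zero_mul]
      have h1 := minimalPeriod_perm_pos ρ none
      have h2 : minimalPeriod ρ none ≠ 1 := fun h => hne (minimalPeriod_eq_one_iff_isFixedPt.1 h)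
      intro h
      have := congrArg List.length h
      simp at this
      omega
    · rfl
  · intro ρ _
    have hit : ∀ (e : E) n, (ρ.optionCongr)^[n] (some e) = some (ρ^[n] e) := by
      intro e n
      induction n with
      | zero => rfl
      | succ n ih => rw [iterate_succ_apply', ih, iterate_succ_apply']; simp
    have hone : minimalPeriod (ρ.optionCongr : Perm (Option E)) none = 1 :=
      minimalPeriod_eq_one_iff_isFixedPt.2 rfl
    have hset : {e | e ∉ periodicOrbit (ρ.optionCongr : Perm (Option E)) none} =
        some '' Set.univ := by
      ext e
      rcases e with _ | e <;> simp [periodicOrbit, hone]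
    have hc : permCumulant φ htracial (ρ.optionCongr : Perm (Option E)) ℓ =
        permCumulant φ htracial ρ (ℓ ∘ some) := by
      rw [permCumulant_eq φ htracial _ ℓ none, hone, hset,
        orbitProd_image (ρ := ρ) (Option.some_injective E) _ fun e _ n => hit e n]
      simp only [List.range_one, List.map_cons, List.map_nil, iterate_zero, id_eq, hℓ,
        NCProb.listCumulant_singleton, hunital, one_mul, permCumulant, cycle_map_map]
    have ht : IsCactusPerm {p | ∃ q ∈ D, q.1 none = q.2 none ∧ p = (q.1 ∘ some, q.2 ∘ some)} ρ ↔
        IsCactusPerm D (ρ.optionCongr : Perm (Option E)) := by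
      constructor
      · intro H h
        obtain ⟨_, ⟨q, hq, h0, rfl⟩, h1, h2⟩ := H (h ∘ some)
        refine ⟨q, hq, ?_, ?_⟩
        · rintro (_ | e)
          · exact h0
          · exact h1 e
        · rintro (_ | e)
          · rfl
          · exact h2 e
      · intro H h
        obtain ⟨q, hq, h1, h2⟩ := H (fun o => o.elim 0 h)
        exact ⟨_, ⟨q, hq, h1 none, rfl⟩, fun e => h1 (some e), fun e => h2 (some e)⟩
    simp only [hc, ht]

end Cumulant

/-! ### Subdividing an edge -/

section Path

variable {E : Type*} [DecidableEq E]

/-- The encoding of the graph in which the edge `a` is replaced by two consecutive edges: `none`,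
starting at the source of `a`, and `some a`, ending at its target. -/
def pathData (a : E) (D : Set ((E → ℚ) × (E → ℚ))) : Set ((Option E → ℚ) × (Option E → ℚ)) :=
  {q | ∃ p ∈ D, ∃ v : ℚ,
    q = (fun o => o.elim (p.1 a) (update p.1 a v), fun o => o.elim v p.2)}

/-- The permutation of the edges of the subdivided graph that visits `none` immediately after
`some a` and otherwise agrees with `ρ`. -/
def pathPerm (a : E) (ρ : Perm E) : Perm (Option E) :=
  ρ.optionCongr * swap none (some a)

variable (a : E) (ρ : Perm E)

theorem pathPerm_some_self : pathPerm a ρ (some a) = none := by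
  simp [pathPerm]

theorem pathPerm_none : pathPerm a ρ none = some (ρ a) := by
  simp [pathPerm]

theorem pathPerm_some_of_ne {e : E} (h : e ≠ a) : pathPerm a ρ (some e) = some (ρ e) := by
  have h1 : swap none (some a) (some e) = some e :=
    swap_apply_of_ne_of_ne (by simp) (by simpa using h)
  simp [pathPerm, h1]

theorem isCactusPerm_pathPerm {D : Set ((E → ℚ) × (E → ℚ))} :
    IsCactusPerm (pathData a D) (pathPerm a ρ) ↔ IsCactusPerm D ρ := by
  constructor
  · intro H h
    obtain ⟨q, ⟨p, hp, v, rfl⟩, h1, h2⟩ := H (fun o => o.elim 0 h)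
    refine ⟨p, hp, fun e => ?_, fun e => ?_⟩
    · by_cases he : e = a
      · subst he
        simpa [pathPerm_none] using h1 none
      · simpa [pathPerm_some_of_ne e ρ, pathPerm_some_of_ne a ρ he, he] using h1 (some e)
    · by_cases he : e = a
      · subst he
        have h3 := h2 (some e)
        have h4 := h2 none
        rw [pathPerm_some_self] at h3
        rw [pathPerm_none] at h4
        exact h4.trans h3
      · simpa [pathPerm_some_of_ne a ρ he] using h2 (some e)
  · intro H h
    obtain ⟨p, hp, h1, h2⟩ := H (h ∘ some)
    refine ⟨_, ⟨p, hp, p.2 a - h (some a) + h none, rfl⟩, ?_, ?_⟩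
    · rintro (_ | e)
      · simpa [pathPerm_none] using h1 a
      · by_cases he : e = a
        · subst he
          simp [pathPerm_some_self]
        · simpa [pathPerm_some_of_ne a ρ he, he] using h1 e
    · rintro (_ | e)
      · simpa [pathPerm_none] using h2 a
      · by_cases he : e = a
        · subst he
          simp [pathPerm_some_self]
        · simpa [pathPerm_some_of_ne a ρ he] using h2 e

variable {a}

/-- If `σ` visits `none` immediately after `some a`, then composition with a transposition of
`some a` and `c` preserves cactus permutations if it cuts an orbit in two, and never yields a cactus
permutation if it joins two orbits. -/
theorem isCactusPerm_mul_swap [Finite E] {D : Set ((E → ℚ) × (E → ℚ))} {σ : Perm (Option E)}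
    (hσ : σ (some a) = none) {c : Option E} (hc : c ≠ some a) :
    IsCactusPerm (pathData a D) (σ * swap (some a) c) ↔
      IsCactusPerm (pathData a D) σ ∧ c ∈ periodicOrbit σ (some a) := by
  set σ' := σ * swap (some a) c with hσ'
  have s1 : σ' (some a) = σ c := by simp [hσ']
  have s2 : σ' c = none := by simp [hσ', hσ]
  have s3 : ∀ e, e ≠ some a → e ≠ c → σ' e = σ e := by
    intro e he hec
    rw [hσ', Perm.mul_apply, swap_apply_of_ne_of_ne he hec]
  have hd : σ c ≠ none := fun h => hc (σ.injective (h.trans hσ.symm))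
  have hnone : ∀ e, σ e = none → e = some a := fun e h => σ.injective (h.trans hσ.symm)
  constructor
  · intro H
    constructor
    · intro h
      obtain ⟨_, ⟨p, hp, v, rfl⟩, h1, h2⟩ := H (update h none (h (σ c)))
      have k1 := h1 (some a)
      rw [s1] at k1
      have k2 := h2 (some a)
      have k3 := h2 c
      rw [s1] at k2
      rw [s2] at k3
      simp only [update_of_ne hd, update_self, Option.elim_some, Option.elim_none] at k1 k2 k3
      -- The new vertex takes the value for which the decomposition of `h` holds at `none`.
      refine ⟨_, ⟨p, hp, h none + (v - h (σ c)), rfl⟩, fun e => ?_, fun e => ?_⟩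
      · by_cases he : e = some a
        · subst he
          simp [hσ]
        · have hne : σ e ≠ none := fun h => he (hnone e h)
          obtain ⟨e', he'⟩ := Option.ne_none_iff_exists'.1 hne
          have hl : ∀ w, (fun o : Option E => o.elim (p.1 a) (update p.1 a w)) e =
              (fun o : Option E => o.elim (p.1 a) (update p.1 a v)) e := by
            intro w
            rcases e with _ | e
            · rfl
            · have : e ≠ a := fun h => he (h ▸ rfl)
              simp [this]
          have h1e := h1 e
          by_cases hec : e = c
          · subst hec
            rw [s2] at h1e
            refine (hl _).trans (h1e.trans ?_)
            rw [he'] at k1 ⊢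
            exact k1
          · rw [s3 e he hec] at h1e
            refine (hl _).trans (h1e.trans ?_)
            rw [he']
            rfl
      · have hG : ∀ e : Option E, e.elim (h none + (v - h (σ c))) p.2 - h e =
            e.elim v p.2 - update h none (h (σ c)) e := by
          rintro (_ | e)
          · simp
          · simp
        rw [hG, hG]
        by_cases he : e = some a
        · subst he
          rw [hσ]
          simp only [update_self, Option.elim_some, Option.elim_none] at k1 k2 ⊢
          rw [← k1] at k2
          rw [← k2]
        · by_cases hec : e = c
          · subst hec
            rw [update_of_ne hd, ← k1]
            exact k3
          · have := h2 e
            rw [s3 e he hec] at this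
            exact this
    -- If two orbits are joined, then the orbit of `c` under `σ` connects the target of `none` to
    -- its source without passing through `none`, so that the indicator function of `none` has no
    -- decomposition.
    · by_contra hmem
      obtain ⟨_, ⟨p, hp, v, rfl⟩, h1, h2⟩ := H (Pi.single none 1)
      set G : Option E → ℚ := fun o => o.elim v p.2 - (Pi.single none 1 : Option E → ℚ) o with hG
      have h2' : ∀ e, G (σ' e) = G e := h2
      have hcon : ∀ n, n < minimalPeriod σ c → G (σ^[n + 1] c) = G (σ c) := by
        intro n
        induction n with
        | zero => intro _; rfl
        | succ n ih =>
          intro hn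
          rw [← ih (by omega), iterate_succ_apply', ← h2' (σ^[n + 1] c), s3]
          · intro h
            have : some a ∈ periodicOrbit σ c := h ▸ mem_periodicOrbit_perm.2 ⟨n + 1, rfl⟩
            exact hmem (mem_periodicOrbit_comm.1 this)
          · exact iterate_ne_self σ c (by omega) hn
      have hpos := minimalPeriod_perm_pos σ c
      have h3 := hcon (minimalPeriod σ c - 1) (by omega)
      rw [Nat.sub_add_cancel hpos, iterate_minimalPeriod] at h3
      have h4 := h2' c
      rw [s2, h3] at h4
      have h5 := h1 (some a)
      rw [s1] at h5
      simp only [Option.elim_some, update_self] at h5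
      simp only [hG, Pi.single_eq_same, Pi.single_eq_of_ne hd, Option.elim_none] at h4
      linarith
  · rintro ⟨H, hmem⟩ h
    obtain ⟨j, hj', hjc⟩ := mem_periodicOrbit_perm_lt.1 hmem
    have hj : 0 < j := by
      rcases j with _ | j
      · exact absurd hjc.symm hc
      · omega
    classical
    -- A multiple of the indicator function of the orbit that has been cut off is used to correct
    -- the values of `h`, such that the vertices to be separated and joined get the right values.
    set χ : Option E → ℚ := fun e => if e ∈ periodicOrbit σ' none then 1 else 0 with hχ
    have hχ1 : χ none = 1 := if_pos (self_mem_periodicOrbit_perm σ' none)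
    have hχ2 : ∀ e, χ (σ' e) = χ e := fun e => by
      simp only [hχ, apply_mem_periodicOrbit]
    have hχ3 : χ (σ c) = 0 := by
      rw [← s1, hχ2]
      refine if_neg ?_
      rw [← hσ, hσ', ← hjc, periodicOrbit_mul_swap_apply σ (some a) hj hj']
      simp only [Cycle.mem_coe_iff, List.mem_map, List.mem_range, not_exists, not_and]
      exact fun i hi => iterate_ne_self σ _ (by omega) (by omega)
    obtain ⟨_, ⟨p, hp, v, rfl⟩, h1, h2⟩ := H (fun e => h e + (h (σ c) - h none) * χ e)
    set t := h (σ c) - h none with ht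
    set G : Option E → ℚ := fun o => o.elim v p.2 - (h o + t * χ o) with hG
    have h2' : ∀ e, G (σ e) = G e := h2
    have hGc : G c = G (some a) := by
      rw [← hjc]
      clear_value G
      clear hjc hj'
      induction j with
      | zero => rfl
      | succ j ih =>
        rcases Nat.eq_zero_or_pos j with rfl | hj0
        · exact h2' _
        · rw [iterate_succ_apply', h2', ih hj0]
    obtain ⟨d, hdd⟩ := Option.ne_none_iff_exists'.1 hd
    have hGn : p.2 d = G none + h (σ c) := by
      have e1 : G (σ c) = G none := by rw [h2', hGc, ← h2' (some a), hσ]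
      rw [← e1]
      simp only [hG, hχ3]
      rw [hdd]
      simp
    have hnew : ∀ e : Option E, e.elim (p.2 d) p.2 - h e = G e + t * χ e := by
      rintro (_ | e)
      · simp only [Option.elim_none, hχ1, hGn, ht]
        ring
      · simp only [Option.elim_some, hG]
        ring
    refine ⟨_, ⟨p, hp, p.2 d, rfl⟩, fun e => ?_, fun e => ?_⟩
    · by_cases he : e = some a
      · subst he
        rw [s1, hdd]
        simp
      · have hl : (fun o : Option E => o.elim (p.1 a) (update p.1 a (p.2 d))) e =
            (fun o : Option E => o.elim (p.1 a) (update p.1 a v)) e := by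
          rcases e with _ | e
          · rfl
          · have : e ≠ a := fun h => he (h ▸ rfl)
            simp [this]
        refine hl.trans ((h1 e).trans ?_)
        by_cases hec : e = c
        · subst hec
          rw [s2, hdd]
          rfl
        · rw [s3 e he hec]
          obtain ⟨e', he'⟩ := Option.ne_none_iff_exists'.1 fun h => he (hnone e h)
          rw [he']
          rfl
    · change (σ' e).elim (p.2 d) p.2 - h (σ' e) = e.elim (p.2 d) p.2 - h e
      rw [hnew, hnew, hχ2]
      congr 1
      by_cases he : e = some a
      · subst he
        rw [s1, h2', hGc]
      · by_cases hec : e = c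
        · subst hec
          rw [s2, ← hσ, h2', hGc]
        · rw [s3 e he hec, h2']

/-- A permutation `σ` of the edges of the subdivided graph is given by the edge `c` with
`σ c = none` and by the permutation of `E` obtained by exchanging the images of `c` and `some a` and
then skipping `none`. -/
theorem pathPerm_mul_swap_bijective [Fintype E] (a : E) :
    Bijective fun p : Perm E × Option E => pathPerm a p.1 * swap (some a) p.2 := by
  rw [Fintype.bijective_iff_injective_and_card]
  constructor
  · rintro ⟨ρ, c⟩ ⟨ρ', c'⟩ h
    simp only at h
    have h1 : (pathPerm a ρ * swap (some a) c) c = none := by simp [pathPerm_some_self]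
    have h2 : (pathPerm a ρ' * swap (some a) c') c' = none := by simp [pathPerm_some_self]
    rw [← h] at h2
    obtain rfl : c = c' := (pathPerm a ρ * swap (some a) c).injective (h1.trans h2.symm)
    have h3 : ρ.optionCongr = ρ'.optionCongr := mul_right_cancel (mul_right_cancel h)
    rw [Equiv.optionCongr_injective h3]
  · rw [Fintype.card_prod, Fintype.card_perm, Fintype.card_perm, Fintype.card_option,
      Nat.factorial_succ, mul_comm]

/-- The orbit of `some a` under the permutation of the subdivided graph. -/
theorem pathPerm_iterate [Finite E] (a : E) (ρ : Perm E) :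
    (∀ i < minimalPeriod ρ a, (pathPerm a ρ)^[i + 1] (some a) =
      if i = 0 then none else some (ρ^[i] a)) ∧
    minimalPeriod (pathPerm a ρ) (some a) = minimalPeriod ρ a + 1 := by
  have hpos := minimalPeriod_perm_pos ρ a
  have key := iterate_and_minimalPeriod_eq (f := pathPerm a ρ) (x := some a)
    (n := minimalPeriod ρ a + 1)
    (fun i => if i = 0 then some a else if i = 1 then none else some (ρ^[i - 1] a))
    (by omega) rfl
  refine (fun h => ?_ : _ → _) (key ?_ ?_ ?_)
  · obtain ⟨h1, h2⟩ := h
    refine ⟨fun i hi => (h1 (i + 1) (by omega)).trans ?_, h2⟩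
    simp
  · intro i hi
    rcases i with _ | _ | i
    · simp [pathPerm_some_self]
    · simp [pathPerm_none]
    · simp only [Nat.add_eq_zero_iff, one_ne_zero, and_false, if_false, Nat.add_sub_cancel,
        Nat.add_eq_right]
      rw [pathPerm_some_of_ne, ← iterate_succ_apply' ρ]
      exact iterate_ne_self ρ a (by omega) (by omega)
  · obtain ⟨m, hm⟩ : ∃ m, minimalPeriod ρ a = m + 1 := ⟨minimalPeriod ρ a - 1, by omega⟩
    have hper : ρ^[m + 1] a = a := hm ▸ iterate_minimalPeriod
    rw [hm, Nat.add_sub_cancel]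
    rcases m with _ | m
    · simpa [pathPerm_none] using hper
    · simp only [Nat.add_eq_zero_iff, one_ne_zero, and_false, if_false, Nat.add_sub_cancel,
        Nat.add_eq_right]
      rw [pathPerm_some_of_ne, ← iterate_succ_apply' ρ, hper]
      exact iterate_ne_self ρ a (by omega) (by omega)
  · intro i hi h
    by_contra h0
    rw [if_neg h0] at h
    split_ifs at h with h1
    exact iterate_ne_self ρ a (by omega) (by omega) (Option.some_injective _ h)

theorem pathPerm_iterate_of_notMem [Finite E] {ρ : Perm E} {e : E} (he : e ∉ periodicOrbit ρ a)
    (n : ℕ) : (pathPerm a ρ)^[n] (some e) = some (ρ^[n] e) := by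
  induction n with
  | zero => rfl
  | succ n ih =>
    rw [iterate_succ_apply', ih, iterate_succ_apply', pathPerm_some_of_ne]
    intro h
    exact he (mem_periodicOrbit_comm.1 (mem_periodicOrbit_perm.2 ⟨n, h⟩))

theorem mem_periodicOrbit_pathPerm [Finite E] {ρ : Perm E} {e : E} :
    some e ∈ periodicOrbit (pathPerm a ρ) (some a) ↔ e ∈ periodicOrbit ρ a := by
  obtain ⟨h1, h2⟩ := pathPerm_iterate a ρ
  rw [mem_periodicOrbit_perm_lt, mem_periodicOrbit_perm_lt, h2]
  constructor
  · rintro ⟨n, hn, h⟩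
    rcases n with _ | n
    · exact ⟨0, minimalPeriod_perm_pos ρ a, Option.some_injective _ h⟩
    · rw [h1 n (by omega)] at h
      split_ifs at h with h0
      exact ⟨n, by omega, Option.some_injective _ h⟩
  · rintro ⟨n, hn, rfl⟩
    rcases n with _ | n
    · exact ⟨0, by omega, rfl⟩
    · refine ⟨n + 1 + 1, by omega, ?_⟩
      rw [h1 (n + 1) hn, if_neg (by omega)]

variable {A : Type*} [Ring A] [Algebra ℂ A] (φ : A →ₗ[ℂ] ℂ)
  (htracial : ∀ a b : A, φ (a * b) = φ (b * a))

/-- The sum over all ways of cutting the orbit of the subdivided edge is given by the formula for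
free cumulants with products as entries. -/
theorem permCumulant_update_mul [Finite E] (ρ : Perm E) (ℓ : E → A) (a : E) (y : A) :
    permCumulant φ htracial ρ (update ℓ a (ℓ a * y)) =
      ∑ j ∈ Finset.range (minimalPeriod ρ a + 1),
        permCumulant φ htracial
          (pathPerm a ρ * swap (some a) ((pathPerm a ρ)^[j] (some a))) (fun o => o.elim y ℓ) := by
  set σ := pathPerm a ρ with hσ
  set ℓ' : Option E → A := fun o => o.elim y ℓ with hℓ'
  obtain ⟨h1, h2⟩ := pathPerm_iterate a ρ
  have hpos := minimalPeriod_perm_pos ρ a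
  obtain ⟨m, hm⟩ : ∃ m, minimalPeriod ρ a = m + 1 := ⟨minimalPeriod ρ a - 1, by omega⟩
  rw [hm, ← hσ] at h1 h2
  set w : List A := (List.range m).map fun i => ℓ (ρ^[i + 1] a) with hw
  set R := orbitProd ρ (fun c => NCProb.cycleCumulant φ htracial (c.map ℓ))
    {e | e ∉ periodicOrbit ρ a} with hR
  have hlen : w.length = m := by simp [hw]
  have hwi : ∀ i < m, ℓ' (σ^[i + 1 + 1] (some a)) = ℓ (ρ^[i + 1] a) := by
    intro i hi
    rw [h1 (i + 1) (by omega), if_neg (by omega)]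
    rfl
  have hσ1 : σ^[1] (some a) = none := pathPerm_some_self a ρ
  have hR' : orbitProd σ (fun c => NCProb.cycleCumulant φ htracial (c.map ℓ'))
      {e | e ∉ periodicOrbit σ (some a)} = R := by
    have hset : {e | e ∉ periodicOrbit σ (some a)} = some '' {e | e ∉ periodicOrbit ρ a} := by
      ext e
      rcases e with _ | e
      · have : none ∈ periodicOrbit σ (some a) := mem_periodicOrbit_perm.2 ⟨1, hσ1⟩
        simp [this]
      · simp [hσ, mem_periodicOrbit_pathPerm]
    rw [hset, orbitProd_image (ρ := ρ) (Option.some_injective E) _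
      fun e he n => by rw [hσ, pathPerm_iterate_of_notMem he]]
    refine orbitProd_congr (fun _ _ => rfl) fun e _ => ?_
    rw [cycle_map_map]
    rfl
  have hL : permCumulant φ htracial ρ (update ℓ a (ℓ a * y)) =
      NCProb.listCumulant φ ((ℓ a * y) :: w) * R := by
    rw [permCumulant_eq φ htracial ρ _ a, map_range_minimalPeriod, hm, update_self,
      orbitProd_label_congr φ htracial ρ fun e he => update_of_ne he _ ℓ]
    congr 3
    refine List.map_congr_left fun i hi => update_of_ne ?_ _ _
    have := List.mem_range.1 hi
    exact iterate_ne_self ρ a (by omega) (by omega)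
  have h0 : permCumulant φ htracial (σ * swap (some a) (σ^[0] (some a))) ℓ' =
      NCProb.listCumulant φ (ℓ a :: y :: w) * R := by
    rw [iterate_zero, id_eq, swap_self]
    change permCumulant φ htracial (σ * 1) ℓ' = _
    rw [mul_one, permCumulant_eq φ htracial σ _ (some a), hR', map_range_minimalPeriod, h2,
      Nat.add_sub_cancel, List.range_succ_eq_map, List.map_cons, List.map_map, zero_add, hσ1]
    congr 4
    refine List.map_congr_left fun i hi => ?_
    exact hwi i (List.mem_range.1 hi)
  have hj : ∀ k < m + 1, permCumulant φ htracial (σ * swap (some a) (σ^[k + 1] (some a))) ℓ' =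
      NCProb.listCumulant φ (y :: w.take k) * NCProb.listCumulant φ (ℓ a :: w.drop k) * R := by
    intro k hk
    rw [permCumulant, orbitProd_mul_swap σ (some a) _ (by omega) (by omega), hR', Cycle.map_coe,
      Cycle.map_coe, NCProb.cycleCumulant_coe, NCProb.cycleCumulant_coe, List.map_cons,
      List.map_map, List.map_map, List.range_succ_eq_map, List.map_cons, List.map_map]
    have e1 : ((ℓ' ∘ fun i => σ^[i + 1] (some a)) 0) = y := by
      simp only [comp_apply, zero_add, hσ1]
      rfl
    have e2 : (List.range k).map ((ℓ' ∘ fun i => σ^[i + 1] (some a)) ∘ Nat.succ) = w.take k := by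
      rw [hw, ← List.map_take, List.take_range, min_eq_left (by omega)]
      refine List.map_congr_left fun i hi => ?_
      have := List.mem_range.1 hi
      exact hwi i (by omega)
    have e3 : (List.range (minimalPeriod σ (some a) - (k + 1) - 1)).map
        (ℓ' ∘ fun i => σ^[k + 1 + 1 + i] (some a)) = w.drop k := by
      refine List.ext_getElem (by simp [hlen, h2]; omega) fun i hi hi' => ?_
      simp only [List.length_map, List.length_range, h2] at hi
      simp only [List.getElem_map, List.getElem_range, comp_apply, List.getElem_drop, hw]
      rw [← hwi (k + i) (by omega)]
      congr 2
      omega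
    rw [e1, e2, e3]
    rfl
  rw [hm, Finset.sum_range_succ', hL, h0, NCProb.listCumulant_mul_cons φ htracial, add_mul,
    Finset.sum_mul, hlen, add_comm]
  congr 1
  exact Finset.sum_congr rfl fun k hk => (hj k (Finset.mem_range.1 hk)).symm

/-- An edge labelled by a product can be replaced by two consecutive edges. -/
theorem cactusSum_pathData [Finite E] (D : Set ((E → ℚ) × (E → ℚ))) (ℓ : E → A) (a : E) (y : A) :
    cactusSum φ htracial (pathData a D) (fun o => o.elim y ℓ) =
      cactusSum φ htracial D (update ℓ a (ℓ a * y)) := by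
  classical
  have := Fintype.ofFinite E
  rw [cactusSum, cactusSum, finsum_eq_sum_of_fintype, finsum_eq_sum_of_fintype,
    ← (pathPerm_mul_swap_bijective a).sum_comp, Fintype.sum_prod_type]
  refine Finset.sum_congr rfl fun ρ _ => ?_
  have hiff : ∀ c, IsCactusPerm (pathData a D) (pathPerm a ρ * swap (some a) c) ↔
      IsCactusPerm D ρ ∧ c ∈ periodicOrbit (pathPerm a ρ) (some a) := by
    intro c
    by_cases hc : c = some a
    · subst hc
      rw [swap_self]
      change IsCactusPerm (pathData a D) (pathPerm a ρ * 1) ↔ _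
      rw [mul_one, isCactusPerm_pathPerm]
      simp [self_mem_periodicOrbit_perm]
    · rw [isCactusPerm_mul_swap (pathPerm_some_self a ρ) hc, isCactusPerm_pathPerm]
  simp only [hiff]
  by_cases hρ : IsCactusPerm D ρ
  · simp only [hρ, true_and, if_true]
    rw [permCumulant_update_mul, ← Finset.sum_filter]
    have himg : ({c | c ∈ periodicOrbit (pathPerm a ρ) (some a)} : Finset (Option E)) =
        (Finset.range (minimalPeriod ρ a + 1)).image fun j => (pathPerm a ρ)^[j] (some a) := by
      ext c
      simp only [Finset.mem_filter, Finset.mem_univ, true_and, Finset.mem_image, Finset.mem_range,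
        mem_periodicOrbit_perm_lt, (pathPerm_iterate a ρ).2]
    rw [himg, Finset.sum_image]
    intro i hi j hj h
    have hi := Finset.mem_range.1 hi
    have hj := Finset.mem_range.1 hj
    rw [← (pathPerm_iterate a ρ).2] at hi hj
    exact iterate_injOn _ _ hi hj h
  · simp [hρ]

end Path

/-! ### Bouquets of graphs with free labels -/

section Bouquet

variable {A : Type*} [Ring A] [Algebra ℂ A] (φ : A →ₗ[ℂ] ℂ)
  (htracial : ∀ a b : A, φ (a * b) = φ (b * a))

/-- Only permutations whose orbits respect the colours of free labels contribute. -/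
theorem permCumulant_eq_zero_of_mixed (hunital : φ 1 = 1) {I : Type*} {S : I → Subalgebra ℂ A}
    (hfree : NCProb.FreelyIndependent φ S) {E : Type*} [Finite E] (ρ : Perm E) (ℓ : E → A)
    (c : E → I) (hc : ∀ e, ℓ e ∈ S (c e)) {x : E} (hx : c x ≠ c (ρ x)) :
    permCumulant φ htracial ρ ℓ = 0 := by
  have hpos := minimalPeriod_perm_pos ρ x
  have hlt : 1 < minimalPeriod ρ x := by
    have : minimalPeriod ρ x ≠ 1 := fun h => hx (by
      rw [show ρ x = x from minimalPeriod_eq_one_iff_isFixedPt.1 h])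
    omega
  have h := NCProb.listCumulant_eq_zero_of_mixed φ hunital htracial hfree
    ((List.range (minimalPeriod ρ x)).map fun i => (c (ρ^[i] x), ℓ (ρ^[i] x))) ?_ ?_
  · rw [List.map_map] at h
    rw [permCumulant_eq φ htracial ρ ℓ x]
    exact mul_eq_zero_of_left h _
  · intro p hp
    obtain ⟨i, -, rfl⟩ := List.mem_map.1 hp
    exact hc _
  · exact ⟨_, List.mem_map.2 ⟨0, List.mem_range.2 hpos, rfl⟩,
      _, List.mem_map.2 ⟨1, List.mem_range.2 hlt, rfl⟩, hx⟩

theorem permCumulant_sumCongr {E F : Type*} [Finite E] [Finite F] (ρ : Perm E) (σ : Perm F)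
    (ℓ : E ⊕ F → A) :
    permCumulant φ htracial (Perm.sumCongr ρ σ) ℓ =
      permCumulant φ htracial ρ (ℓ ∘ Sum.inl) * permCumulant φ htracial σ (ℓ ∘ Sum.inr) := by
  have hl : ∀ e n, (Perm.sumCongr ρ σ)^[n] (Sum.inl e) = Sum.inl (ρ^[n] e) := by
    intro e n
    induction n with
    | zero => rfl
    | succ n ih => rw [iterate_succ_apply', ih, iterate_succ_apply']; rfl
  have hr : ∀ e n, (Perm.sumCongr ρ σ)^[n] (Sum.inr e) = Sum.inr (σ^[n] e) := by
    intro e n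
    induction n with
    | zero => rfl
    | succ n ih => rw [iterate_succ_apply', ih, iterate_succ_apply']; rfl
  have huniv : (Set.univ : Set (E ⊕ F)) = Sum.inl '' Set.univ ∪ Sum.inr '' Set.univ := by
    rw [Set.image_univ, Set.image_univ, Set.range_inl_union_range_inr]
  rw [permCumulant, huniv, orbitProd_union, orbitProd_image (ρ := ρ) Sum.inl_injective _
    fun e _ n => hl e n, orbitProd_image (ρ := σ) Sum.inr_injective _ fun e _ n => hr e n]
  · simp only [cycle_map_map, permCumulant]
  · rw [Set.image_univ, Set.image_univ]
    exact Set.isCompl_range_inl_range_inr.disjoint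
  · rintro _ ⟨e, -, rfl⟩
    exact ⟨ρ e, trivial, rfl⟩

/-- If no permutation that mixes the two sets of edges contributes, then the sum over the cactus
permutations of a graph that consists of two graphs with a common vertex is a product: the functions
on its vertices are the pairs of functions on the vertices of the two graphs which agree at the
common vertex, and this can be achieved by adding a constant to one of them. -/
theorem cactusSum_sum {E F : Type*} [Finite E] [Finite F]
    {D : Set ((E ⊕ F → ℚ) × (E ⊕ F → ℚ))} {D₁ : Set ((E → ℚ) × (E → ℚ))}
    {D₂ : Set ((F → ℚ) × (F → ℚ))} (ℓ : E ⊕ F → A)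
    (h₁ : ∀ p ∈ D, (p.1 ∘ Sum.inl, p.2 ∘ Sum.inl) ∈ D₁)
    (h₂ : ∀ p ∈ D, (p.1 ∘ Sum.inr, p.2 ∘ Sum.inr) ∈ D₂)
    (h₃ : ∀ p ∈ D₁, ∀ q ∈ D₂, ∃ c : ℚ,
      (Sum.elim p.1 fun e => q.1 e + c, Sum.elim p.2 fun e => q.2 e + c) ∈ D)
    (hmix : ∀ ρ : Perm (E ⊕ F), ∀ e e', ρ (Sum.inl e) = Sum.inr e' →
      permCumulant φ htracial ρ ℓ = 0) :
    cactusSum φ htracial D ℓ =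
      cactusSum φ htracial D₁ (ℓ ∘ Sum.inl) * cactusSum φ htracial D₂ (ℓ ∘ Sum.inr) := by
  classical
  have := Fintype.ofFinite E
  have := Fintype.ofFinite F
  rw [cactusSum, cactusSum, cactusSum, finsum_eq_sum_of_fintype, finsum_eq_sum_of_fintype,
    finsum_eq_sum_of_fintype, Finset.sum_mul_sum, ← Finset.sum_product']
  symm
  refine Finset.sum_of_injOn (fun p : Perm E × Perm F => Perm.sumCongr p.1 p.2) ?_ (by simp) ?_ ?_
  · rintro ⟨ρ, σ⟩ _ ⟨ρ', σ'⟩ _ h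
    exact Perm.sumCongrHom_injective (a₁ := (ρ, σ)) (a₂ := (ρ', σ')) h
  · intro ρ _ hρ
    split_ifs
    · by_contra hne
      have hmaps : Set.MapsTo ρ (Set.range Sum.inl) (Set.range Sum.inl) := by
        rintro _ ⟨e, rfl⟩
        rcases he : ρ (Sum.inl e) with e' | e'
        · exact ⟨e', rfl⟩
        · exact absurd (hmix ρ e e' he) hne
      obtain ⟨p, hp⟩ := Perm.mem_sumCongrHom_range_of_perm_mapsTo_inl hmaps
      exact hρ ⟨p, by simp, hp⟩
    · rfl
  · rintro ⟨ρ, σ⟩ _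
    have ht : IsCactusPerm D (Perm.sumCongr ρ σ) ↔ IsCactusPerm D₁ ρ ∧ IsCactusPerm D₂ σ := by
      constructor
      · intro H
        constructor
        · intro h
          obtain ⟨p, hp, k1, k2⟩ := H (Sum.elim h 0)
          exact ⟨_, h₁ p hp, fun e => k1 (Sum.inl e), fun e => k2 (Sum.inl e)⟩
        · intro h
          obtain ⟨p, hp, k1, k2⟩ := H (Sum.elim 0 h)
          exact ⟨_, h₂ p hp, fun e => k1 (Sum.inr e), fun e => k2 (Sum.inr e)⟩
      · rintro ⟨H₁, H₂⟩ h
        obtain ⟨p, hp, k1, k2⟩ := H₁ (h ∘ Sum.inl)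
        obtain ⟨q, hq, l1, l2⟩ := H₂ (h ∘ Sum.inr)
        obtain ⟨c, hc⟩ := h₃ p hp q hq
        refine ⟨_, hc, ?_, ?_⟩
        · rintro (e | e)
          · exact k1 e
          · exact congrArg (· + c) (l1 e)
        · rintro (e | e)
          · exact k2 e
          · have := l2 e
            simp only [comp_apply] at this
            simp only [Perm.sumCongr_apply, Sum.map_inr, Sum.elim_inr]
            linarith
    rw [permCumulant_sumCongr]
    by_cases k1 : IsCactusPerm D₁ ρ <;> by_cases k2 : IsCactusPerm D₂ σ <;> simp [ht, k1, k2]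

end Bouquet

/-! ### Oriented cacti and cactus permutations -/

namespace TestGraph

variable {S : Type*} (T : TestGraph S)

/-- The pairs of functions on the edges that are induced by a function on the vertices. -/
def data : Set ((T.E → ℚ) × (T.E → ℚ)) :=
  Set.range fun f : T.V → ℚ => (fun e => f (T.src e), fun e => f (T.tgt e))

/-- The set of edges of an orbit. -/
def orbitSet {E : Type*} (ρ : Perm E) (e : E) : Set E := {e' | e' ∈ periodicOrbit ρ e}

variable {T} {ρ : Perm T.E}

theorem eq_of_mem_periodicOrbit {E : Type*} [Finite E] {ρ : Perm E} {G : E → ℚ}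
    (hG : ∀ e, G (ρ e) = G e) {e e' : E} (h : e' ∈ periodicOrbit ρ e) : G e' = G e := by
  obtain ⟨n, rfl⟩ := mem_periodicOrbit_perm.1 h
  induction n with
  | zero => rfl
  | succ n ih => rw [iterate_succ_apply', hG, ih (mem_periodicOrbit_perm.2 ⟨n, rfl⟩)]

/-- The edges of an orbit end at distinct vertices, since the indicator function of an edge is a
function of the target up to a function of the orbit. -/
theorem tgt_injOn_orbit (H : IsCactusPerm T.data ρ) {e e' : T.E} (h : e' ∈ periodicOrbit ρ e)
    (ht : T.tgt e' = T.tgt e) : e' = e := by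
  classical
  obtain ⟨_, ⟨f, rfl⟩, -, h2⟩ := H (Pi.single e 1)
  have := eq_of_mem_periodicOrbit (G := fun e' => f (T.tgt e') - (Pi.single e 1 : T.E → ℚ) e')
    h2 h
  by_contra hne
  simp only [ht, Pi.single_eq_same, Pi.single_eq_of_ne hne] at this
  linarith

/-- The simple cycles are orbits. The signed indicator function of a simple cycle annihilates all
coboundaries, and for a cactus permutation `ρ` each `h - h ∘ ρ` is a coboundary. Hence the signed
indicator function is invariant under `ρ`, so that `ρ` follows the cycle in one of the two
directions. -/
theorem IsSimpleCycle.exists_eq_orbitSet (hρ : ∀ e, T.src e = T.tgt (ρ e))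
    (H : IsCactusPerm T.data ρ) {C : Set T.E} (hC : T.IsSimpleCycle C) :
    ∃ e, C = orbitSet ρ e := by
  classical
  obtain ⟨n, e, v, he, hv, rfl, hd⟩ := hC
  -- The sign says whether the edge is traversed along or against its direction.
  set ε : Fin (n + 1) → ℚ := fun i =>
    if T.src (e i) = v i ∧ T.tgt (e i) = v (i + 1) then 1 else -1 with hε
  have hε0 : ∀ i, ε i ≠ 0 := fun i => by
    simp only [hε]
    split_ifs <;> norm_num
  have hsum : ∀ h : T.E → ℚ, ∑ i, ε i * h (e i) = ∑ i, ε i * h (ρ (e i)) := by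
    intro h
    obtain ⟨_, ⟨f, rfl⟩, -, h2⟩ := H h
    rw [← sub_eq_zero, ← Finset.sum_sub_distrib]
    have h3 : ∀ i, ε i * h (e i) - ε i * h (ρ (e i)) = f (v (i + 1)) - f (v i) := by
      intro i
      have h4 := h2 (e i)
      simp only [← hρ] at h4
      rw [← mul_sub, show h (e i) - h (ρ (e i)) = f (T.tgt (e i)) - f (T.src (e i)) by linarith]
      by_cases hi : T.src (e i) = v i ∧ T.tgt (e i) = v (i + 1)
      · simp only [hε, if_pos hi]
        rw [hi.1, hi.2, one_mul]
      · have hi' := (hd i).resolve_left hi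
        simp only [hε, if_neg hi]
        rw [hi'.1, hi'.2]
        ring
    rw [Finset.sum_congr rfl fun i _ => h3 i, Finset.sum_sub_distrib, sub_eq_zero]
    exact Equiv.sum_comp (Equiv.addRight (1 : Fin (n + 1))) fun i => f (v i)
  -- The signed indicator function is invariant under `ρ` and under its inverse.
  have key1 : ∀ i, ∃ j, e j = ρ (e i) ∧ ε j = ε i := by
    intro i
    have h := hsum (Pi.single (ρ (e i)) 1)
    have hR : ∑ j, ε j * (Pi.single (ρ (e i)) 1 : T.E → ℚ) (ρ (e j)) = ε i := by
      rw [Finset.sum_eq_single i (fun j _ hj => by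
        rw [Pi.single_eq_of_ne fun h => hj (he (ρ.injective h)), mul_zero]) (by simp),
        Pi.single_eq_same, mul_one]
    replace h := h.trans hR
    obtain ⟨j, -, hj⟩ := Finset.exists_ne_zero_of_sum_ne_zero (h ▸ hε0 i)
    have hej : e j = ρ (e i) := by
      by_contra hne
      exact hj (by rw [Pi.single_eq_of_ne hne, mul_zero])
    refine ⟨j, hej, ?_⟩
    rw [← h, Finset.sum_eq_single j (fun k _ hk => by
      rw [Pi.single_eq_of_ne fun h => hk (he (h.trans hej.symm)), mul_zero]) (by simp), hej,
      Pi.single_eq_same, mul_one]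
  have key2 : ∀ i, ∃ j, ρ (e j) = e i ∧ ε j = ε i := by
    intro i
    have h := hsum (Pi.single (e i) 1)
    have hR : ∑ j, ε j * (Pi.single (e i) 1 : T.E → ℚ) (e j) = ε i := by
      rw [Finset.sum_eq_single i (fun j _ hj => by
        rw [Pi.single_eq_of_ne fun h => hj (he h), mul_zero]) (by simp),
        Pi.single_eq_same, mul_one]
    replace h := hR.symm.trans h
    obtain ⟨j, -, hj⟩ := Finset.exists_ne_zero_of_sum_ne_zero (h ▸ hε0 i)
    have hej : ρ (e j) = e i := by
      by_contra hne
      exact hj (by rw [Pi.single_eq_of_ne hne, mul_zero])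
    refine ⟨j, hej, ?_⟩
    rw [h, Finset.sum_eq_single j (fun k _ hk => by
      rw [Pi.single_eq_of_ne fun h => hk (he (ρ.injective (h.trans hej.symm))), mul_zero])
      (by simp), hej, Pi.single_eq_same, mul_one]
  have step : ∀ i, e (i + 1) ∈ periodicOrbit ρ (e i) := by
    intro i
    by_cases hi : T.src (e i) = v i ∧ T.tgt (e i) = v (i + 1)
    · obtain ⟨j, hj, hεj⟩ := key2 i
      have hj' : T.src (e j) = v j ∧ T.tgt (e j) = v (j + 1) := by
        by_contra hne
        simp only [hε, if_pos hi, if_neg hne] at hεj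
        norm_num at hεj
      have : v j = v (i + 1) := by rw [← hj'.1, hρ, hj, hi.2]
      rw [← hv this, ← hj, periodicOrbit_apply_eq (mem_periodicPts_perm ρ _)]
      exact self_mem_periodicOrbit_perm ρ _
    · obtain ⟨j, hj, hεj⟩ := key1 i
      have hi' := (hd i).resolve_left hi
      have hj' : T.src (e j) = v (j + 1) ∧ T.tgt (e j) = v j := by
        refine (hd j).resolve_left fun hne => ?_
        simp only [hε, if_pos hne, if_neg hi] at hεj
        norm_num at hεj
      have : v j = v (i + 1) := by rw [← hj'.2, hj, ← hρ, hi'.1]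
      rw [← hv this, hj]
      exact apply_mem_periodicOrbit.2 (self_mem_periodicOrbit_perm ρ _)
  refine ⟨e 0, Set.Subset.antisymm ?_ ?_⟩
  · rintro _ ⟨i, rfl⟩
    induction i using Fin.induction with
    | zero => exact self_mem_periodicOrbit_perm ρ (e 0)
    | succ i ih =>
      change _ ∈ periodicOrbit ρ (e 0)
      rw [← periodicOrbit_eq_of_mem ih, ← Fin.coeSucc_eq_succ]
      exact step _
  · intro x hx
    obtain ⟨m, rfl⟩ := mem_periodicOrbit_perm.1 hx
    clear hx
    induction m with
    | zero => exact ⟨0, rfl⟩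
    | succ m ih =>
      obtain ⟨i, hi⟩ := ih
      obtain ⟨j, hj, -⟩ := key1 i
      exact ⟨j, by rw [hj, hi, iterate_succ_apply']⟩

/-- Each orbit is a directed simple cycle, which `ρ` follows against its direction. -/
theorem isReading_orbit (hρ : ∀ e, T.src e = T.tgt (ρ e)) (H : IsCactusPerm T.data ρ) (e : T.E) :
    ∃ (n : ℕ) (r : Fin (n + 1) → T.E), T.IsReading r ∧ Set.range r = orbitSet ρ e := by
  have hpos := minimalPeriod_perm_pos ρ e
  obtain ⟨n, hn⟩ : ∃ n, minimalPeriod ρ e = n + 1 := ⟨minimalPeriod ρ e - 1, by omega⟩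
  have hmem : ∀ i, ρ^[i] e ∈ periodicOrbit ρ e := fun i => mem_periodicOrbit_perm.2 ⟨i, rfl⟩
  refine ⟨n, fun i => ρ^[i] e, ⟨?_, ?_⟩, ?_⟩
  · intro i j hij
    simp only [hρ, ← iterate_succ_apply' ρ] at hij
    have h1 : ρ^[i.1 + 1] e ∈ periodicOrbit ρ (ρ^[j.1 + 1] e) := by
      rw [periodicOrbit_eq_of_mem (hmem _)]
      exact hmem _
    have h2 := tgt_injOn_orbit H h1 hij
    rw [iterate_succ_apply', iterate_succ_apply'] at h2
    exact Fin.ext (iterate_injOn ρ e (by rw [hn]; exact i.2)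
      (by rw [hn]; exact j.2) (ρ.injective h2))
  · intro i
    change T.src (ρ^[i.1] e) = T.tgt (ρ^[(i + 1).1] e)
    rw [hρ, ← iterate_succ_apply' ρ]
    congr 1
    rcases eq_or_ne i (Fin.last n) with rfl | hi
    · rw [Fin.last_add_one, Fin.val_last, Fin.val_zero]
      change ρ^[n + 1] e = e
      exact hn ▸ iterate_minimalPeriod
    · rw [Fin.val_add_one_of_lt (Fin.lt_last_iff_ne_last.2 hi)]
  · ext x
    constructor
    · rintro ⟨i, rfl⟩
      exact hmem _
    · intro hx
      obtain ⟨i, hi, rfl⟩ := mem_periodicOrbit_perm_lt.1 hx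
      exact ⟨⟨i, by omega⟩, rfl⟩

theorem IsReading.injective {n : ℕ} {r : Fin (n + 1) → T.E} (hr : T.IsReading r) : Injective r :=
  fun _ _ h => hr.1 (congrArg T.src h)

theorem IsReading.isSimpleCycle {n : ℕ} {r : Fin (n + 1) → T.E} (hr : T.IsReading r) :
    T.IsSimpleCycle (Set.range r) := by
  refine ⟨n, r, fun i => T.tgt (r i), hr.injective, ?_, rfl, fun i => .inr ⟨hr.2 i, rfl⟩⟩
  intro i j hij
  have h : ∀ k, T.tgt (r k) = T.src (r (k - 1)) := fun k => by rw [hr.2, sub_add_cancel]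
  simp only [h] at hij
  exact sub_left_injective (hr.1 hij)

theorem isSimpleCycle_orbitSet (hρ : ∀ e, T.src e = T.tgt (ρ e)) (H : IsCactusPerm T.data ρ)
    (e : T.E) : T.IsSimpleCycle (orbitSet ρ e) := by
  obtain ⟨n, r, hr, h⟩ := isReading_orbit hρ H e
  exact h ▸ hr.isSimpleCycle

theorem pads_eq (hρ : ∀ e, T.src e = T.tgt (ρ e)) (H : IsCactusPerm T.data ρ) :
    T.pads = Set.range (orbitSet ρ) := by
  ext C
  constructor
  · intro hC
    obtain ⟨e, rfl⟩ := IsSimpleCycle.exists_eq_orbitSet hρ H hC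
    exact ⟨e, rfl⟩
  · rintro ⟨e, rfl⟩
    exact isSimpleCycle_orbitSet hρ H e

theorem orbitSet_eq_of_mem {E : Type*} [Finite E] {ρ : Perm E} {e e' : E}
    (h : e' ∈ orbitSet ρ e) : orbitSet ρ e' = orbitSet ρ e := by
  rw [orbitSet, orbitSet, periodicOrbit_eq_of_mem h]

theorem isOrientedCactus_of_isCactusPerm (hρ : ∀ e, T.src e = T.tgt (ρ e))
    (H : IsCactusPerm T.data ρ) : T.IsOrientedCactus := by
  constructor
  · intro e
    refine ⟨orbitSet ρ e, ⟨isSimpleCycle_orbitSet hρ H e, self_mem_periodicOrbit_perm ρ e⟩, ?_⟩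
    rintro C ⟨hC, heC⟩
    obtain ⟨e', rfl⟩ := IsSimpleCycle.exists_eq_orbitSet hρ H hC
    exact (orbitSet_eq_of_mem heC).symm
  · intro C hC
    obtain ⟨e, rfl⟩ := IsSimpleCycle.exists_eq_orbitSet hρ H hC
    obtain ⟨n, r, hr, h⟩ := isReading_orbit hρ H e
    exact ⟨⟨n, r⟩, hr, h⟩

/-- The orbits are the simple cycles of the graph, and within an orbit an edge is determined by its
target. -/
theorem cactusPerm_unique {ρ' : Perm T.E} (hρ : ∀ e, T.src e = T.tgt (ρ e))
    (H : IsCactusPerm T.data ρ) (hρ' : ∀ e, T.src e = T.tgt (ρ' e))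
    (H' : IsCactusPerm T.data ρ') : ρ' = ρ := by
  ext e
  obtain ⟨e', he'⟩ := IsSimpleCycle.exists_eq_orbitSet hρ' H' (isSimpleCycle_orbitSet hρ H e)
  have h1 : e ∈ orbitSet ρ' e' := he' ▸ self_mem_periodicOrbit_perm ρ e
  rw [← orbitSet_eq_of_mem h1] at he'
  have h2 : ρ' e ∈ orbitSet ρ e :=
    he' ▸ apply_mem_periodicOrbit.2 (self_mem_periodicOrbit_perm ρ' e)
  have h3 : ρ e ∈ periodicOrbit ρ e := apply_mem_periodicOrbit.2 (self_mem_periodicOrbit_perm ρ e)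
  refine tgt_injOn_orbit H ?_ ((hρ' e).symm.trans (hρ e))
  rw [periodicOrbit_eq_of_mem h3]
  exact h2

section Cumulant

variable {A : Type*} [Ring A] [Algebra ℂ A] (φ : A →ₗ[ℂ] ℂ)
  (htracial : ∀ a b : A, φ (a * b) = φ (b * a)) {T : TestGraph A} {ρ : Perm T.E}

theorem padCumulant_orbitSet (hρ : ∀ e, T.src e = T.tgt (ρ e)) (H : IsCactusPerm T.data ρ)
    (e : T.E) : padCumulant φ T (orbitSet ρ e) =
      NCProb.cycleCumulant φ htracial ((periodicOrbit ρ e).map T.label) := by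
  have hdir : T.IsDirectedCycle (orbitSet ρ e) :=
    (isOrientedCactus_of_isCactusPerm hρ H).2 _ (isSimpleCycle_orbitSet hρ H e)
  rw [padCumulant, dif_pos hdir]
  obtain ⟨hr, hrange⟩ := hdir.choose_spec
  set r := hdir.choose.2
  have hmem : ∀ i, r i ∈ periodicOrbit ρ e := fun i => by
    have : r i ∈ orbitSet ρ e := hrange ▸ Set.mem_range_self i
    exact this
  have hstep : ∀ i, ρ (r i) = r (i + 1) := by
    intro i
    refine tgt_injOn_orbit H ?_ ((hρ _).symm.trans (hr.2 i))
    rw [periodicOrbit_eq_of_mem (hmem _)]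
    exact apply_mem_periodicOrbit.2 (hmem i)
  have horb : periodicOrbit ρ e = (List.ofFn r : Cycle T.E) := by
    rw [← periodicOrbit_eq_of_mem (hmem 0),
      periodicOrbit_eq_coe (n := hdir.choose.1 + 1) (fun i : ℕ => r (Fin.ofNat _ i)) (by omega)
        (by simp)]
    · congr 1
      refine List.ext_getElem (by simp) fun i h1 h2 => ?_
      simp only [List.length_ofFn] at h2
      simp only [List.getElem_map, List.getElem_range, List.getElem_ofFn]
      congr 1
      ext
      simp [Nat.mod_eq_of_lt h2]
    · intro i _
      rw [hstep]
      congr 1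
      ext
      simp [Fin.val_add]
    · rw [hstep, Nat.add_sub_cancel]
      simp
    · intro i hi h
      have := congrArg Fin.val (hr.injective h)
      simpa [Nat.mod_eq_of_lt hi] using this
  rw [horb, Cycle.map_coe, NCProb.cycleCumulant_coe, NCProb.freeCumulant_eq_listCumulant φ htracial,
    List.map_ofFn]
  rfl

theorem injTrafficState_of_isCactusPerm (hρ : ∀ e, T.src e = T.tgt (ρ e))
    (H : IsCactusPerm T.data ρ) : injTrafficState φ T = permCumulant φ htracial ρ T.label := by
  rw [injTrafficState, if_pos (isOrientedCactus_of_isCactusPerm hρ H), pads_eq hρ H, permCumulant,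
    orbitProd]
  have himg : Set.range (orbitSet ρ) =
      (fun c : Cycle T.E => {e | e ∈ c}) '' (periodicOrbit ρ '' Set.univ) := by
    rw [Set.image_image, Set.image_univ]
    rfl
  rw [himg, finprod_mem_image]
  · refine finprod_mem_congr rfl ?_
    rintro _ ⟨e, -, rfl⟩
    exact padCumulant_orbitSet φ htracial hρ H e
  · rintro _ ⟨e, -, rfl⟩ _ ⟨e', -, rfl⟩ h
    have : e ∈ orbitSet ρ e' := by
      change e ∈ {x | x ∈ periodicOrbit ρ e'}
      rw [← show {x | x ∈ periodicOrbit ρ e} = {x | x ∈ periodicOrbit ρ e'} from h]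
      exact self_mem_periodicOrbit_perm ρ e
    exact periodicOrbit_eq_of_mem this

end Cumulant

end TestGraph

/-! ### The traffic state as a sum over cactus permutations -/

namespace TestGraph

section Flow

variable {S : Type*} {T : TestGraph S}

/-- The support of a non-zero rational flow contains a simple cycle: a walk in the support that
never turns back can always be continued, and it has to meet itself. -/
theorem exists_isSimpleCycle_of_flow [Fintype T.E] {c : T.E → ℚ}
    (hc : ∀ f : T.V → ℚ, ∑ e, c e * (f (T.tgt e) - f (T.src e)) = 0) {e₀ : T.E}
    (h₀ : c e₀ ≠ 0) : ∃ C, T.IsSimpleCycle C ∧ ∀ e ∈ C, c e ≠ 0 := by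
  classical
  by_cases hloop : ∃ e, c e ≠ 0 ∧ T.src e = T.tgt e
  · obtain ⟨e, he, hl⟩ := hloop
    refine ⟨{e}, ⟨0, fun _ => e, fun _ => T.src e,
      fun i j _ => Subsingleton.elim (α := Fin 1) i j,
      fun i j _ => Subsingleton.elim (α := Fin 1) i j,
      by simp, fun _ => .inl ⟨rfl, hl.symm⟩⟩, ?_⟩
    rintro _ rfl
    exact he
  push Not at hloop
  -- A dart is an edge of the support with one of the two directions.
  let head : {d : T.E × Bool // c d.1 ≠ 0} → T.V := fun d => cond d.1.2 (T.tgt d.1.1) (T.src d.1.1)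
  let tail : {d : T.E × Bool // c d.1 ≠ 0} → T.V := fun d => cond d.1.2 (T.src d.1.1) (T.tgt d.1.1)
  -- The flow equation at the head of a dart yields another edge of the support at this vertex.
  have hnext : ∀ d, ∃ d' : {d : T.E × Bool // c d.1 ≠ 0}, tail d' = head d ∧ d'.1.1 ≠ d.1.1 := by
    rintro ⟨⟨e, b⟩, he⟩
    set x := head ⟨⟨e, b⟩, he⟩ with hx
    have hinc : ∃ e', e' ≠ e ∧ c e' ≠ 0 ∧ (T.src e' = x ∨ T.tgt e' = x) := by
      by_contra! hno
      have h := hc (Pi.single x 1)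
      rw [Finset.sum_eq_single e] at h
      · have hl := hloop e he
        rcases b with _ | _
        · have hx' : x = T.src e := rfl
          rw [hx', Pi.single_eq_same, Pi.single_eq_of_ne hl.symm] at h
          apply he
          linarith
        · have hx' : x = T.tgt e := rfl
          rw [hx', Pi.single_eq_same, Pi.single_eq_of_ne hl] at h
          apply he
          linarith
      · intro e' _ hne
        by_cases hce : c e' = 0
        · rw [hce, zero_mul]
        · obtain ⟨h1, h2⟩ := hno e' hne hce
          rw [Pi.single_eq_of_ne h1, Pi.single_eq_of_ne h2, sub_zero, mul_zero]
      · simp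
    obtain ⟨e', hne, hce, h | h⟩ := hinc
    · exact ⟨⟨⟨e', true⟩, hce⟩, h, hne⟩
    · exact ⟨⟨⟨e', false⟩, hce⟩, h, hne⟩
  choose next hnext1 hnext2 using hnext
  let d : ℕ → {d : T.E × Bool // c d.1 ≠ 0} := fun k => next^[k] ⟨⟨e₀, true⟩, h₀⟩
  have hd : ∀ k, d (k + 1) = next (d k) := fun k => iterate_succ_apply' next k _
  let x : ℕ → T.V := fun k => tail (d k)
  have hx : ∀ k, x (k + 1) = head (d k) := fun k => by
    change tail (d (k + 1)) = _
    rw [hd, hnext1]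
  -- The first vertex that is visited twice closes a simple cycle.
  have hrep : ∃ j, ∃ i < j, x i = x j := by
    obtain ⟨i, j, hij, h⟩ := Finite.exists_ne_map_eq_of_infinite x
    rcases lt_or_gt_of_ne hij with hlt | hlt
    · exact ⟨j, i, hlt, h⟩
    · exact ⟨i, j, hlt, h.symm⟩
  obtain ⟨i, hij, hxij⟩ := Nat.find_spec hrep
  set j := Nat.find hrep with hj
  have hinj : ∀ a < j, ∀ b < j, x a = x b → a = b := by
    intro a ha b hb hab
    rcases lt_trichotomy a b with hlt | heq | hlt
    · exact absurd ⟨a, hlt, hab⟩ (Nat.find_min hrep hb)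
    · exact heq
    · exact absurd ⟨b, hlt, hab.symm⟩ (Nat.find_min hrep ha)
  have hedge : ∀ a b, a < b → b < j → (d a).1.1 ≠ (d b).1.1 := by
    intro a b hab hb h
    by_cases hbool : (d a).1.2 = (d b).1.2
    · have : d a = d b := Subtype.ext (Prod.ext h hbool)
      have hx' : x a = x b := congrArg tail this
      have := hinj a (by omega) b hb hx'
      omega
    · have hht : head (d a) = tail (d b) := by
        change cond (d a).1.2 (T.tgt (d a).1.1) (T.src (d a).1.1) =
          cond (d b).1.2 (T.src (d b).1.1) (T.tgt (d b).1.1)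
        rw [h]
        revert hbool
        cases (d a).1.2 <;> cases (d b).1.2 <;> simp
      rw [← hx] at hht
      have hba := hinj (a + 1) (by omega) b hb hht
      rw [← hba, hd] at h
      exact hnext2 (d a) h.symm
  obtain ⟨n, hn⟩ : ∃ n, j = i + n + 1 := ⟨j - i - 1, by omega⟩
  have hcyc : ∀ k : Fin (n + 1), x (i + (k + 1 : Fin (n + 1)).1) = head (d (i + k.1)) := by
    intro k
    rw [← hx]
    rcases eq_or_ne k (Fin.last n) with rfl | hk
    · rw [Fin.last_add_one, Fin.val_last, Fin.val_zero, add_zero, hxij, hn]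
    · rw [Fin.val_add_one_of_lt (Fin.lt_last_iff_ne_last.2 hk)]
      rfl
  refine ⟨_, ⟨n, fun k => (d (i + k.1)).1.1, fun k => x (i + k.1), ?_, ?_, rfl, ?_⟩, ?_⟩
  · intro k l hkl
    by_contra hne
    rcases lt_or_gt_of_ne hne with hlt | hlt
    · exact hedge (i + k.1) (i + l.1) (by omega) (by omega) hkl
    · exact hedge (i + l.1) (i + k.1) (by omega) (by omega) hkl.symm
  · intro k l hkl
    have := hinj (i + k.1) (by omega) (i + l.1) (by omega) hkl
    exact Fin.ext (by omega)
  · intro k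
    simp only [hcyc]
    change (_ = cond (d (i + k.1)).1.2 _ _ ∧ _ = cond (d (i + k.1)).1.2 _ _) ∨
      (_ = cond (d (i + k.1)).1.2 _ _ ∧ _ = cond (d (i + k.1)).1.2 _ _)
    cases (d (i + k.1)).1.2 <;> simp
  · rintro _ ⟨k, rfl⟩
    exact (d (i + k.1)).2

/-- In an oriented cactus, let `ρ e` be the edge of the pad of `e` that ends where `e` starts. A
function on the edges that is a coboundary on each pad is a coboundary, since there is no flow
other than the linear combinations of the pads: after the subtraction of such a combination, a flow
vanishes at one edge of each pad, so that its support contains no simple cycle. -/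
theorem IsOrientedCactus.exists_isCactusPerm (hT : T.IsOrientedCactus) :
    ∃ ρ : Perm T.E, (∀ e, T.src e = T.tgt (ρ e)) ∧ IsCactusPerm T.data ρ := by
  classical
  have := Fintype.ofFinite T.E
  choose C hC huniq using hT.1
  have hCeq : ∀ e e', e' ∈ C e → C e' = C e := fun e e' h =>
    (huniq e' (C e) ⟨(hC e).1, h⟩).symm
  have hstep : ∀ e, ∃ e' ∈ C e, T.src e = T.tgt e' := by
    intro e
    obtain ⟨⟨n, r⟩, hr, hrange⟩ := hT.2 _ (hC e).1
    have hmem := (hC e).2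
    rw [← hrange] at hmem ⊢
    obtain ⟨i, rfl⟩ := hmem
    exact ⟨r (i + 1), Set.mem_range_self _, hr.2 i⟩
  have hsrc : ∀ e, ∀ e' ∈ C e, T.src e' = T.src e → e' = e := by
    intro e e' he' h
    obtain ⟨⟨n, r⟩, hr, hrange⟩ := hT.2 _ (hC e).1
    have hmem := (hC e).2
    rw [← hrange] at hmem he'
    obtain ⟨i, rfl⟩ := hmem
    obtain ⟨i', rfl⟩ := he'
    exact congrArg r (hr.1 h)
  choose σ hσ1 hσ2 using hstep
  have hinj : Injective σ := by
    intro e e' h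
    have h1 : C e = C e' := by rw [← hCeq e _ (hσ1 e), h, hCeq e' _ (hσ1 e')]
    refine hsrc e' e (h1 ▸ (hC e).2) ?_
    rw [hσ2, hσ2, h]
  set ρ : Perm T.E := Equiv.ofBijective σ (Finite.injective_iff_bijective.1 hinj) with hρ
  have hρσ : ∀ e, ρ e = σ e := fun _ => rfl
  refine ⟨ρ, hσ2, fun h => ?_⟩
  let δ : (T.V → ℚ) →ₗ[ℚ] (T.E → ℚ) :=
    LinearMap.funLeft ℚ ℚ T.tgt - LinearMap.funLeft ℚ ℚ T.src
  suffices hmem : (fun e => h e - h (ρ e)) ∈ LinearMap.range δ by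
    obtain ⟨f, hf⟩ := hmem
    refine ⟨_, ⟨f, rfl⟩, fun e => congrArg f (hσ2 e), fun e => ?_⟩
    have h1 : f (T.tgt e) - f (T.src e) = h e - h (ρ e) := congrFun hf e
    have h2 : f (T.src e) = f (T.tgt (ρ e)) := congrArg f (hσ2 e)
    simp only
    linarith
  by_contra hnot
  -- A functional that vanishes on all coboundaries is given by a flow `c`.
  obtain ⟨L, hL, hker⟩ := Submodule.exists_le_ker_of_notMem hnot
  set c : T.E → ℚ := fun e => L (Pi.single e 1) with hc
  have hLc : ∀ g : T.E → ℚ, L g = ∑ e, g e * c e := fun g => by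
    rw [LinearMap.pi_apply_eq_sum_univ L g]
    refine Finset.sum_congr rfl fun e _ => ?_
    rw [smul_eq_mul, hc]
    congr 2
    funext e'
    simp [Pi.single_apply, eq_comm]
  -- A chosen edge of the pad of `e`.
  let rep : T.E → T.E := fun e => @Classical.epsilon _ ⟨e⟩ (· ∈ C e)
  have hrep1 : ∀ e, rep e ∈ C e := fun e => @Classical.epsilon_spec _ (· ∈ C e) ⟨e, (hC e).2⟩
  have hrep2 : ∀ e e', e' ∈ C e → rep e' = rep e := fun e e' h => by
    simp only [rep, hCeq e e' h]
  have hzero : ∀ e, c e - c (rep e) = 0 := by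
    by_contra! hne
    obtain ⟨e₀, he₀⟩ := hne
    have hflow : ∀ f : T.V → ℚ,
        ∑ e, (c e - c (rep e)) * (f (T.tgt e) - f (T.src e)) = 0 := by
      intro f
      have h1 : ∑ e, c e * (f (T.tgt e) - f (T.src e)) = 0 := by
        have : L (δ f) = 0 := hker ⟨f, rfl⟩
        rw [hLc] at this
        rw [← this]
        refine Finset.sum_congr rfl fun e _ => ?_
        rw [mul_comm]
        rfl
      have h2 : ∑ e, c (rep e) * f (T.src e) = ∑ e, c (rep e) * f (T.tgt e) := by
        rw [← Equiv.sum_comp ρ fun e => c (rep e) * f (T.tgt e)]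
        refine Finset.sum_congr rfl fun e _ => ?_
        rw [hρσ, hrep2 e _ (hσ1 e), hσ2]
      calc ∑ e, (c e - c (rep e)) * (f (T.tgt e) - f (T.src e))
          = ∑ e, c e * (f (T.tgt e) - f (T.src e)) -
            (∑ e, c (rep e) * f (T.tgt e) - ∑ e, c (rep e) * f (T.src e)) := by
            rw [← Finset.sum_sub_distrib, ← Finset.sum_sub_distrib]
            exact Finset.sum_congr rfl fun e _ => by ring
        _ = 0 := by rw [h1, h2]; ring
    obtain ⟨D, hD, hDc⟩ := exists_isSimpleCycle_of_flow (c := fun e => c e - c (rep e)) hflow he₀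
    obtain ⟨n, e, v, -, -, hr, -⟩ := id hD
    have hemem : e 0 ∈ D := hr ▸ Set.mem_range_self 0
    have hDC : D = C (e 0) := huniq (e 0) D ⟨hD, hemem⟩
    refine hDc (rep (e 0)) (hDC ▸ hrep1 (e 0)) ?_
    rw [hrep2 (e 0) _ (hrep1 (e 0)), sub_self]
  have hcρ : ∀ e, c (ρ e) = c e := fun e => by
    have h1 := hzero e
    have h2 := hzero (ρ e)
    rw [hρσ, hrep2 e _ (hσ1 e)] at h2
    rw [hρσ]
    linarith
  apply hL
  rw [hLc]
  calc ∑ e, (h e - h (ρ e)) * c e = ∑ e, h e * c e - ∑ e, h (ρ e) * c (ρ e) := by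
        rw [← Finset.sum_sub_distrib]
        exact Finset.sum_congr rfl fun e _ => by rw [hcρ]; ring
    _ = 0 := by rw [Equiv.sum_comp ρ fun e => h e * c e, sub_self]

end Flow

section Partition

variable {S : Type*} {T : TestGraph S} {ρ : Perm T.E}

/-- The partition of the vertices that is generated by `src e ∼ tgt (ρ e)`. -/
def permSetoid (T : TestGraph S) (ρ : Perm T.E) : Setoid T.V :=
  Relation.EqvGen.setoid fun x y => ∃ e, x = T.src e ∧ y = T.tgt (ρ e)

theorem isCactusPerm_of_quot {π : Setoid T.V} (H : IsCactusPerm (T.quot π).data ρ) :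
    IsCactusPerm T.data ρ := by
  intro h
  obtain ⟨_, ⟨f, rfl⟩, h1, h2⟩ := H h
  exact ⟨_, ⟨fun v => f (Quotient.mk π v), rfl⟩, h1, h2⟩

theorem eq_of_permSetoid {f : T.V → ℚ} (hf : ∀ e, f (T.src e) = f (T.tgt (ρ e))) {x y : T.V}
    (h : T.permSetoid ρ x y) : f x = f y := by
  change Relation.EqvGen (fun x y => ∃ e, x = T.src e ∧ y = T.tgt (ρ e)) x y at h
  induction h with
  | rel x y h =>
    obtain ⟨e, rfl, rfl⟩ := h
    exact hf e
  | refl x => rfl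
  | symm x y _ ih => exact ih.symm
  | trans x y z _ _ ih ih' => exact ih.trans ih'

theorem permSetoid_src (e : T.E) : T.permSetoid ρ (T.src e) (T.tgt (ρ e)) :=
  .rel _ _ ⟨e, rfl, rfl⟩

theorem isCactusPerm_quot_permSetoid (H : IsCactusPerm T.data ρ) :
    IsCactusPerm (T.quot (T.permSetoid ρ)).data ρ := by
  intro h
  obtain ⟨_, ⟨f, rfl⟩, h1, h2⟩ := H h
  exact ⟨_, ⟨fun v => Quotient.lift f (fun _ _ => eq_of_permSetoid h1) v, rfl⟩, h1, h2⟩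

theorem eq_of_connected {g : T.V → ℚ} (hg : ∀ e, g (T.src e) = g (T.tgt e)) (x y : T.V) :
    g x = g y := by
  induction T.connected x y with
  | rel x y h =>
    obtain ⟨e, rfl, rfl⟩ := h
    exact hg e
  | refl x => rfl
  | symm x y _ ih => exact ih.symm
  | trans x y z _ _ ih ih' => exact ih.trans ih'

/-- There is no room for further identifications: if a partition identifies more vertices than
required by `ρ`, then the indicator function of a class of `permSetoid` yields a function on the
edges without decomposition. -/
theorem eq_permSetoid {π : Setoid T.V} (hρ : ∀ e, (T.quot π).src e = (T.quot π).tgt (ρ e))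
    (H : IsCactusPerm (T.quot π).data ρ) : π = T.permSetoid ρ := by
  classical
  apply le_antisymm
  · intro x y hxy
    set f₀ : T.V → ℚ := fun z => if T.permSetoid ρ z x then 1 else 0 with hf₀
    have hf₀ρ : ∀ e, f₀ (T.src e) = f₀ (T.tgt (ρ e)) := by
      intro e
      have : T.permSetoid ρ (T.src e) x ↔ T.permSetoid ρ (T.tgt (ρ e)) x :=
        ⟨fun h => (T.permSetoid ρ).trans ((T.permSetoid ρ).symm (permSetoid_src e)) h,
          fun h => (T.permSetoid ρ).trans (permSetoid_src e) h⟩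
      simp only [hf₀, this]
    obtain ⟨_, ⟨f, rfl⟩, h1, h2⟩ := H fun e => f₀ (T.tgt e)
    have h3 := eq_of_connected (T := T) (g := fun v => f (Quotient.mk π v) - f₀ v) (fun e => by
      have h1e : f (Quotient.mk π (T.src e)) = f (Quotient.mk π (T.tgt (ρ e))) := h1 e
      have h2e : f (Quotient.mk π (T.tgt (ρ e))) - f₀ (T.tgt (ρ e)) =
        f (Quotient.mk π (T.tgt e)) - f₀ (T.tgt e) := h2 e
      change f (Quotient.mk π (T.src e)) - f₀ (T.src e) = _
      rw [h1e, hf₀ρ, h2e]) x y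
    have h5 : f (Quotient.mk π x) = f (Quotient.mk π y) := congrArg f (Quotient.sound hxy)
    have h4 : f₀ x = f₀ y := by linarith
    by_contra hne
    have hx : f₀ x = 1 := if_pos ((T.permSetoid ρ).refl x)
    have hy : f₀ y = 0 := if_neg fun h => hne ((T.permSetoid ρ).symm h)
    rw [hx, hy] at h4
    norm_num at h4
  · refine Setoid.eqvGen_le ?_
    rintro _ _ ⟨e, rfl, rfl⟩
    exact Quotient.exact (hρ e)

end Partition

section State

variable {A : Type*} [Ring A] [Algebra ℂ A] (φ : A →ₗ[ℂ] ℂ)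
  (htracial : ∀ a b : A, φ (a * b) = φ (b * a))

open scoped Classical in
theorem injTrafficState_eq_finsum (T : TestGraph A) :
    injTrafficState φ T = ∑ᶠ ρ : Perm T.E,
      if (∀ e, T.src e = T.tgt (ρ e)) ∧ IsCactusPerm T.data ρ then
        permCumulant φ htracial ρ T.label else 0 := by
  by_cases hT : T.IsOrientedCactus
  · obtain ⟨ρ, hρ, H⟩ := hT.exists_isCactusPerm
    rw [finsum_eq_single _ ρ fun σ hσ => if_neg fun h => hσ (cactusPerm_unique hρ H h.1 h.2),
      if_pos ⟨hρ, H⟩, injTrafficState_of_isCactusPerm φ htracial hρ H]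
  · rw [injTrafficState, if_neg hT, finsum_eq_zero_of_forall_eq_zero]
    exact fun ρ => if_neg fun h => hT (isOrientedCactus_of_isCactusPerm h.1 h.2)

theorem _root_.Traffic.trafficState_eq_cactusSum (T : TestGraph A) :
    trafficState φ T = cactusSum φ htracial T.data T.label := by
  classical
  have := Fintype.ofFinite T.E
  have : Finite (Setoid T.V) := Finite.of_injective (fun s : Setoid T.V => fun x y => s x y)
    fun s t h => Setoid.ext fun x y => iff_of_eq (congrFun (congrFun h x) y)
  have := Fintype.ofFinite (Setoid T.V)
  rw [trafficState, cactusSum, finsum_eq_sum_of_fintype, finsum_eq_sum_of_fintype]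
  have h1 : ∀ π : Setoid T.V, injTrafficState φ (T.quot π) = ∑ ρ : Perm T.E,
      if (∀ e, (T.quot π).src e = (T.quot π).tgt (ρ e)) ∧ IsCactusPerm (T.quot π).data ρ then
        permCumulant φ htracial ρ T.label else 0 := by
    intro π
    exact (injTrafficState_eq_finsum φ htracial (T.quot π)).trans
      (finsum_eq_sum_of_fintype (α := Perm T.E) _)
  simp only [h1]
  rw [Finset.sum_comm]
  refine Finset.sum_congr rfl fun ρ _ => ?_
  by_cases H : IsCactusPerm T.data ρ
  · rw [if_pos H, Finset.sum_eq_single (T.permSetoid ρ)]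
    · exact if_pos ⟨fun e => Quotient.sound (permSetoid_src (T := T) e),
        isCactusPerm_quot_permSetoid H⟩
    · exact fun π _ hπ => if_neg fun h => hπ (eq_permSetoid h.1 h.2)
    · simp
  · rw [if_neg H]
    exact Finset.sum_eq_zero fun π _ => if_neg fun h => H (isCactusPerm_of_quot h.2)

end State

end TestGraph

/-! ### Potentials on graph monomials -/

namespace GraphMonomial

variable {S : Type*}

/-- The pair of functions `p` on the edges is induced by a function on the vertices that takes the
value `x` at the input and `y` at the output. -/
def IsPotential (t : GraphMonomial S) (p : (t.E → ℚ) × (t.E → ℚ)) (x y : ℚ) : Prop :=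
  ∃ f : t.V → ℚ, (∀ e, p.1 e = f (t.src e)) ∧ (∀ e, p.2 e = f (t.tgt e)) ∧
    f t.inp = x ∧ f t.out = y

/-- The encoding of the graph obtained from `t` by identifying the input with the output. -/
def closedData (t : GraphMonomial S) : Set ((t.E → ℚ) × (t.E → ℚ)) :=
  {p | ∃ x, t.IsPotential p x x}

theorem data_closure (t : GraphMonomial S) : t.closure.data = t.closedData := by
  ext p
  constructor
  · rintro ⟨f, rfl⟩
    refine ⟨_, fun v => f (Quotient.mk _ v), fun _ => rfl, fun _ => rfl, rfl, ?_⟩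
    exact congrArg f (Quotient.sound (.symm _ _ (.rel _ _ ⟨rfl, rfl⟩)))
  · rintro ⟨x, f, h1, h2, h3, h4⟩
    refine ⟨fun v => Quotient.lift f ?_ v, Prod.ext (funext fun e => (h1 e).symm)
      (funext fun e => (h2 e).symm)⟩
    intro a b hab
    change Relation.EqvGen (fun x y => x = t.inp ∧ y = t.out) a b at hab
    induction hab with
    | rel x y h =>
      obtain ⟨rfl, rfl⟩ := h
      exact h3.trans h4.symm
    | refl x => rfl
    | symm x y _ ih => exact ih.symm
    | trans x y z _ _ ih ih' => exact ih.trans ih'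

theorem isPotential_comp {t t' : GraphMonomial S}
    {p : ((t.comp t').E → ℚ) × ((t.comp t').E → ℚ)} {x y : ℚ} :
    (t.comp t').IsPotential p x y ↔
      ∃ z, t.IsPotential (fun e => p.1 (.inl e), fun e => p.2 (.inl e)) z y ∧
        t'.IsPotential (fun e => p.1 (.inr e), fun e => p.2 (.inr e)) x z := by
  constructor
  · rintro ⟨f, h1, h2, h3, h4⟩
    refine ⟨_, ⟨fun v => f (Quot.mk _ (.inl v)), fun e => h1 (.inl e), fun e => h2 (.inl e),
      rfl, h4⟩, ⟨fun v => f (Quot.mk _ (.inr v)), fun e => h1 (.inr e), fun e => h2 (.inr e),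
      h3, ?_⟩⟩
    exact congrArg f (Quot.sound ⟨rfl, rfl⟩).symm
  · rintro ⟨z, ⟨f, h1, h2, h3, h4⟩, ⟨f', h1', h2', h3', h4'⟩⟩
    refine ⟨fun v => Quot.lift (Sum.elim f f') ?_ v, ?_, ?_, h3', h4⟩
    · rintro _ _ ⟨rfl, rfl⟩
      exact h3.trans h4'.symm
    · rintro (e | e)
      · exact h1 e
      · exact h1' e
    · rintro (e | e)
      · exact h2 e
      · exact h2' e

open scoped Classical in
theorem isPotential_subst {t m : GraphMonomial S} {e₀ : t.E}
    {p : ((t.subst e₀ m).E → ℚ) × ((t.subst e₀ m).E → ℚ)} {x y : ℚ} :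
    (t.subst e₀ m).IsPotential p x y ↔
      ∃ z w, m.IsPotential (fun e => p.1 (.inr e), fun e => p.2 (.inr e)) z w ∧
        t.IsPotential (fun e => if h : e = e₀ then z else p.1 (.inl ⟨e, h⟩),
          fun e => if h : e = e₀ then w else p.2 (.inl ⟨e, h⟩)) x y := by
  constructor
  · rintro ⟨f, h1, h2, h3, h4⟩
    refine ⟨_, _, ⟨fun v => f (Quot.mk _ (.inr v)), fun e => h1 (.inr e), fun e => h2 (.inr e),
      rfl, rfl⟩, ⟨fun v => f (Quot.mk _ (.inl v)), fun e => ?_, fun e => ?_, h3, h4⟩⟩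
    · by_cases h : e = e₀
      · subst h
        simp only [dif_pos]
        exact congrArg f (Quot.sound (.inl ⟨rfl, rfl⟩)).symm
      · simp only [dif_neg h]
        exact h1 (.inl ⟨e, h⟩)
    · by_cases h : e = e₀
      · subst h
        simp only [dif_pos]
        exact congrArg f (Quot.sound (.inr ⟨rfl, rfl⟩)).symm
      · simp only [dif_neg h]
        exact h2 (.inl ⟨e, h⟩)
  · rintro ⟨z, w, ⟨f, h1, h2, h3, h4⟩, ⟨f', h1', h2', h3', h4'⟩⟩
    refine ⟨fun v => Quot.lift (Sum.elim f' f) ?_ v, ?_, ?_, h3', h4'⟩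
    · rintro _ _ (⟨rfl, rfl⟩ | ⟨rfl, rfl⟩)
      · have := h1' e₀
        simp only [dif_pos] at this
        exact this.symm.trans h3.symm
      · have := h2' e₀
        simp only [dif_pos] at this
        exact this.symm.trans h4.symm
    · rintro (⟨e, he⟩ | e)
      · have := h1' e
        simp only [dif_neg he] at this
        exact this
      · exact h1 e
    · rintro (⟨e, he⟩ | e)
      · have := h2' e
        simp only [dif_neg he] at this
        exact this
      · exact h2 e

theorem isPotential_edge {a : S} {p : ((edge a).E → ℚ) × ((edge a).E → ℚ)} {x y : ℚ} :
    (edge a).IsPotential p x y ↔ p.1 () = x ∧ p.2 () = y := by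
  constructor
  · rintro ⟨f, h1, h2, h3, h4⟩
    exact ⟨(h1 ()).trans h3, (h2 ()).trans h4⟩
  · rintro ⟨rfl, rfl⟩
    exact ⟨fun b : Bool => cond b (p.2 ()) (p.1 ()), fun _ => rfl, fun _ => rfl, rfl, rfl⟩

theorem isPotential_triv {p : ((triv : GraphMonomial S).E → ℚ) × (triv.E → ℚ)} {x y : ℚ} :
    (triv : GraphMonomial S).IsPotential p x y ↔ x = y := by
  constructor
  · rintro ⟨f, -, -, h3, h4⟩
    exact h3.symm.trans h4
  · rintro rfl
    exact ⟨fun _ => x, fun e => e.elim, fun e => e.elim, rfl, rfl⟩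

theorem IsPotential.comp_equiv {t t' : GraphMonomial S} {f : t.V ≃ t'.V} {g : t.E ≃ t'.E}
    (hs : ∀ e, f (t.src e) = t'.src (g e)) (ht : ∀ e, f (t.tgt e) = t'.tgt (g e))
    (hi : f t.inp = t'.inp) (ho : f t.out = t'.out) {p : (t'.E → ℚ) × (t'.E → ℚ)} {x y : ℚ} :
    t'.IsPotential p x y ↔ t.IsPotential (p.1 ∘ g, p.2 ∘ g) x y := by
  constructor
  · rintro ⟨k, h1, h2, h3, h4⟩
    refine ⟨k ∘ f, fun e => ?_, fun e => ?_, ?_, ?_⟩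
    · simp [h1, hs]
    · simp [h2, ht]
    · simp [hi, h3]
    · simp [ho, h4]
  · rintro ⟨k, h1, h2, h3, h4⟩
    refine ⟨k ∘ f.symm, fun e => ?_, fun e => ?_, ?_, ?_⟩
    · obtain ⟨e, rfl⟩ := g.surjective e
      simpa [← hs] using h1 e
    · obtain ⟨e, rfl⟩ := g.surjective e
      simpa [← ht] using h2 e
    · simp [← hi, h3]
    · simp [← ho, h4]

theorem IsPotential.add_const {t : GraphMonomial S} {p : (t.E → ℚ) × (t.E → ℚ)} {x y : ℚ}
    (h : t.IsPotential p x y) (c : ℚ) :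
    t.IsPotential (fun e => p.1 e + c, fun e => p.2 e + c) (x + c) (y + c) := by
  obtain ⟨f, h1, h2, h3, h4⟩ := h
  exact ⟨fun v => f v + c, fun e => congrArg (· + c) (h1 e), fun e => congrArg (· + c) (h2 e),
    congrArg (· + c) h3, congrArg (· + c) h4⟩

theorem IsPotential.eq_of_inp_eq_out {t : GraphMonomial S} (ht : t.inp = t.out)
    {p : (t.E → ℚ) × (t.E → ℚ)} {x y : ℚ} (h : t.IsPotential p x y) : x = y := by
  obtain ⟨f, -, -, h3, h4⟩ := h
  rw [← h3, ← h4, ht]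

end GraphMonomial

/-! ### Linear functionals on graph polynomials -/

section Functional

variable {A : Type*} [Ring A] [Algebra ℂ A]

namespace GraphPoly

theorem hom_ext {S N : Type*} [AddCommMonoid N] [Module ℂ N] {f g : GraphPoly S →ₗ[ℂ] N}
    (h : ∀ t, f (of t) = g (of t)) : f = g := by
  refine MonoidAlgebra.lhom_ext' fun m => LinearMap.ext_ring ?_
  induction m using Quotient.inductionOn with | _ t
  exact h t

/-- The linear extension of an invariant of graph monomials. -/
def linearExt {S : Type*} (F : GraphMonomial S → ℂ)
    (hF : ∀ t t', GraphMonomial.Iso t t' → F t = F t') : GraphPoly S →ₗ[ℂ] ℂ :=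
  Finsupp.linearCombination ℂ (fun m : Monomial S => Quotient.lift F hF m) ∘ₗ
    (MonoidAlgebra.coeffLinearEquiv ℂ).toLinearMap

theorem linearExt_of {S : Type*} (F : GraphMonomial S → ℂ)
    (hF : ∀ t t', GraphMonomial.Iso t t' → F t = F t') (t : GraphMonomial S) :
    linearExt F hF (of t) = F t := by
  change Finsupp.linearCombination ℂ _ (Finsupp.single (Monomial.mk t) 1) = _
  rw [Finsupp.linearCombination_single, one_smul]
  rfl

theorem of_mul_of {S : Type*} (t t' : GraphMonomial S) : of t * of t' = of (t.comp t') := by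
  unfold of
  rw [MonoidAlgebra.single_mul_single, one_mul]
  rfl

theorem subst_of {S : Type*} (t : GraphMonomial S) (e₀ : t.E) (m : GraphMonomial S) :
    subst t e₀ (of m) = of (t.subst e₀ m) := by
  simp only [subst, of, MonoidAlgebra.mapDomainLinearMap_single]
  rfl

end GraphPoly

variable (φ : A →ₗ[ℂ] ℂ) (htracial : ∀ a b : A, φ (a * b) = φ (b * a))

/-- The linear functional on graph polynomials which is induced by the traffic state. -/
def stateExt : GraphPoly A →ₗ[ℂ] ℂ :=
  GraphPoly.linearExt (fun t => cactusSum φ htracial t.closedData t.label) (by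
    rintro t t' ⟨f, g, hs, ht, hl, hi, ho⟩
    refine (cactusSum_equiv φ htracial g (fun p => ?_) hl).symm
    exact exists_congr fun x => GraphMonomial.IsPotential.comp_equiv hs ht hi ho)

theorem stateExt_of (t : GraphMonomial A) :
    stateExt φ htracial (GraphPoly.of t) = cactusSum φ htracial t.closedData t.label :=
  GraphPoly.linearExt_of _ _ t

/-- The encoding of the graph obtained from a graph with edges `Option F` by installing `m` in the
place of the edge `none`. -/
def plugData {F S : Type*} (D : Set ((Option F → ℚ) × (Option F → ℚ))) (m : GraphMonomial S) :
    Set ((F ⊕ m.E → ℚ) × (F ⊕ m.E → ℚ)) :=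
  {p | ∃ x y, m.IsPotential (fun e => p.1 (.inr e), fun e => p.2 (.inr e)) x y ∧
    (fun o => o.elim x fun e => p.1 (.inl e), fun o => o.elim y fun e => p.2 (.inl e)) ∈ D}

/-- The sum over the cactus permutations of a graph with a hole, as a linear functional of the graph
polynomial that is installed in the hole. -/
def plug {F : Type*} (D : Set ((Option F → ℚ) × (Option F → ℚ))) (ℓ : F → A) :
    GraphPoly A →ₗ[ℂ] ℂ :=
  GraphPoly.linearExt (fun m => cactusSum φ htracial (plugData D m) (Sum.elim ℓ m.label)) (by
    rintro t t' ⟨f, g, hs, ht, hl, hi, ho⟩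
    refine (cactusSum_equiv φ htracial (Equiv.sumCongr (Equiv.refl F) g) (fun p => ?_) ?_).symm
    · exact exists_congr fun x => exists_congr fun y =>
        and_congr_left' (GraphMonomial.IsPotential.comp_equiv hs ht hi ho)
    · rintro (e | e)
      · rfl
      · exact hl e)

theorem plug_of {F : Type*} (D : Set ((Option F → ℚ) × (Option F → ℚ))) (ℓ : F → A)
    (m : GraphMonomial A) : plug φ htracial D ℓ (GraphPoly.of m) =
      cactusSum φ htracial (plugData D m) (Sum.elim ℓ m.label) :=
  GraphPoly.linearExt_of _ _ m

/-- The graph polynomial `X` may be replaced by an edge with label `a` in all graphs. The edge sets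
of the graphs live in `Type`, as those of graph monomials. -/
def Evaluates (X : GraphPoly A) (a : A) : Prop :=
  ∀ (F : Type) [Finite F] (D : Set ((Option F → ℚ) × (Option F → ℚ))) (ℓ : F → A),
    plug φ htracial D ℓ X = cactusSum φ htracial D fun o => o.elim a ℓ

theorem evaluates_edge (a : A) :
    Evaluates φ htracial (GraphPoly.of (GraphMonomial.edge a)) a := by
  intro F _ D ℓ
  rw [plug_of]
  refine cactusSum_equiv φ htracial
    ((Equiv.optionEquivSumPUnit.{0} F).trans (Equiv.refl (F ⊕ Unit)))
    (D' := plugData D (GraphMonomial.edge a)) (fun p => ?_) ?_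
  · have h : ∀ k : F ⊕ Unit → ℚ, (fun o : Option F => o.elim (k (.inr ())) fun e => k (.inl e)) =
        k ∘ ((Equiv.optionEquivSumPUnit.{0} F).trans (Equiv.refl (F ⊕ Unit))) := by
      intro k
      funext o
      rcases o with _ | o <;> rfl
    constructor
    · rintro ⟨x, y, h1, h2⟩
      obtain ⟨rfl, rfl⟩ := GraphMonomial.isPotential_edge.1 h1
      rwa [← h, ← h]
    · intro h2
      rw [← h, ← h] at h2
      exact ⟨_, _, GraphMonomial.isPotential_edge.2 ⟨rfl, rfl⟩, h2⟩
  · rintro (_ | e) <;> rfl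

theorem evaluates_one (hunital : φ 1 = 1) : Evaluates φ htracial (1 : GraphPoly A) 1 := by
  intro F _ D ℓ
  rw [cactusSum_one φ htracial hunital D _ rfl]
  refine (plug_of φ htracial D ℓ GraphMonomial.triv).trans ?_
  refine (cactusSum_equiv φ htracial (Equiv.sumEmpty F Empty) (fun p => ?_) ?_).symm
  · have h : ∀ q : Option F → ℚ,
        (fun o : Option F => o.elim (q none) fun e => (q ∘ some) e) = q := by
      intro q
      funext o
      rcases o with _ | o <;> rfl
    constructor
    · rintro ⟨q, hq, h0, rfl⟩
      refine ⟨q.1 none, q.2 none, GraphMonomial.isPotential_triv.2 h0, ?_⟩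
      change ((fun o : Option F => o.elim (q.1 none) fun e => (q.1 ∘ some) e),
        (fun o : Option F => o.elim (q.2 none) fun e => (q.2 ∘ some) e)) ∈ D
      rwa [h, h]
    · rintro ⟨x, y, h1, h2⟩
      exact ⟨_, h2, GraphMonomial.isPotential_triv.1 h1, rfl⟩
  · rintro (e | e)
    · rfl
    · exact e.elim

variable {φ htracial}

theorem Evaluates.add_smul {X Y : GraphPoly A} {a b : A} (hX : Evaluates φ htracial X a)
    (hY : Evaluates φ htracial Y b) (c : ℂ) : Evaluates φ htracial (X + c • Y) (a + c • b) := by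
  classical
  intro F _ D ℓ
  have h : ∀ x : A, (fun o : Option F => o.elim x ℓ) = update (fun o => o.elim 0 ℓ) none x := by
    intro x
    funext o
    rcases o with _ | o <;> simp
  rw [map_add, map_smul, hX, hY, h, h b, h (a + c • b), cactusSum_add_smul, smul_eq_mul]

/-- The two factors are replaced one after the other, which leaves two consecutive edges. -/
theorem Evaluates.mul {X Y : GraphPoly A} {a b : A} (hX : Evaluates φ htracial X a)
    (hY : Evaluates φ htracial Y b) : Evaluates φ htracial (X * Y) (a * b) := by
  classical
  intro F _ D ℓ
  -- The graph with `m` installed behind the hole.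
  let D' : (m : GraphMonomial A) → Set ((Option (F ⊕ m.E) → ℚ) × (Option (F ⊕ m.E) → ℚ)) :=
    fun m => {q | ∃ x, m.IsPotential (fun e => q.1 (some (.inr e)), fun e => q.2 (some (.inr e)))
      x (q.1 none) ∧ (fun o => o.elim x fun e => q.1 (some (.inl e)),
        fun o => o.elim (q.2 none) fun e => q.2 (some (.inl e))) ∈ D}
  have h1 : ∀ m, plug φ htracial D ℓ ∘ₗ LinearMap.mulRight ℂ (GraphPoly.of m) =
      plug φ htracial (D' m) (Sum.elim ℓ m.label) := by
    intro m
    refine GraphPoly.hom_ext fun t => ?_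
    rw [LinearMap.comp_apply, LinearMap.mulRight_apply, GraphPoly.of_mul_of, plug_of, plug_of]
    refine cactusSum_equiv φ htracial
      (((Equiv.sumAssoc F m.E t.E).trans ((Equiv.refl F).sumCongr (Equiv.sumComm m.E t.E))))
      (D' := plugData D (t.comp m)) (fun p => ?_) ?_
    · constructor
      · rintro ⟨x, y, hp, hD⟩
        obtain ⟨z, hz, hz'⟩ := GraphMonomial.isPotential_comp.1 hp
        exact ⟨z, y, hz, x, hz', hD⟩
      · rintro ⟨z, y, hz, x, hz', hD⟩
        exact ⟨x, y, GraphMonomial.isPotential_comp.2 ⟨z, hz, hz'⟩, hD⟩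
    · rintro ((e | e) | e) <;> rfl
  have h2 : plug φ htracial D ℓ ∘ₗ LinearMap.mulLeft ℂ X =
      plug φ htracial (pathData none D) (fun o => o.elim a ℓ) := by
    refine GraphPoly.hom_ext fun m => ?_
    have h3 := LinearMap.congr_fun (h1 m) X
    rw [LinearMap.comp_apply, LinearMap.mulRight_apply, hX] at h3
    rw [LinearMap.comp_apply, LinearMap.mulLeft_apply, h3, plug_of]
    symm
    refine cactusSum_equiv φ htracial
      ((Equiv.optionEquivSumPUnit.{0} (F ⊕ m.E)).trans <|
        (Equiv.sumAssoc F m.E Unit).trans <|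
        ((Equiv.refl F).sumCongr (Equiv.sumComm m.E Unit)).trans <|
        (Equiv.sumAssoc F Unit m.E).symm.trans <|
          (Equiv.optionEquivSumPUnit.{0} F).symm.sumCongr (Equiv.refl m.E)) (fun p => ?_) ?_
    · constructor
      · rintro ⟨x, y, hp, q, hq, v, hqv⟩
        rw [Prod.mk.injEq] at hqv
        obtain ⟨k1, k2⟩ := hqv
        have k1n := congrFun k1 none
        have k2n := congrFun k2 none
        have k1s := fun o => congrFun k1 (some o)
        have k2s := fun o => congrFun k2 (some o)
        simp only [Option.elim_none, Option.elim_some] at k1n k2n k1s k2s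
        have k1n' := k1s none
        rw [update_self] at k1n'
        refine ⟨x, ?_, ?_⟩
        · change m.IsPotential (fun e => p.1 (.inr e), fun e => p.2 (.inr e)) x (p.1 (.inl none))
          rwa [k1n', ← k2n]
        · convert hq using 1
          refine Prod.ext (funext fun o => ?_) (funext fun o => ?_)
          · rcases o with _ | e
            · exact k1n
            · exact (k1s (some e)).trans (update_of_ne (by simp) _ _)
          · rcases o with _ | e
            · exact k2s none
            · exact k2s (some e)
      · rintro ⟨x, hp, hD⟩
        refine ⟨x, p.1 (.inl none), hp, _, hD, p.1 (.inl none), ?_⟩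
        refine Prod.ext (funext fun o => ?_) (funext fun o => ?_)
        · rcases o with _ | _ | e
          · rfl
          · simp
          · simp
        · rcases o with _ | _ | e <;> rfl
    · rintro (_ | e | e) <;> rfl
  have h3 := LinearMap.congr_fun h2 Y
  rw [LinearMap.comp_apply, LinearMap.mulLeft_apply] at h3
  rw [h3, hY, cactusSum_pathData]
  congr 1
  funext o
  rcases o with _ | o <;> simp

/-- The defining relations of the free `𝒢`-algebra hold inside each graph. -/
theorem evaluates_lift (hunital : φ 1 = 1) {n : ℕ} (b : Fin n → A) (P : FreeAlgebra ℂ (Fin n)) :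
    Evaluates φ htracial
      (FreeAlgebra.lift ℂ (fun i => GraphPoly.of (GraphMonomial.edge (b i))) P)
      (FreeAlgebra.lift ℂ b P) := by
  induction P using FreeAlgebra.induction with
  | grade0 r =>
    have h := (evaluates_one φ htracial hunital).add_smul (evaluates_one φ htracial hunital) (r - 1)
    rw [AlgHom.commutes, AlgHom.commutes, Algebra.algebraMap_eq_smul_one,
      Algebra.algebraMap_eq_smul_one]
    rwa [sub_smul, sub_smul, one_smul, one_smul, add_sub_cancel, add_sub_cancel] at h
  | grade1 i =>
    rw [FreeAlgebra.lift_ι_apply, FreeAlgebra.lift_ι_apply]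
    exact evaluates_edge φ htracial (b i)
  | mul P Q hP hQ =>
    rw [map_mul, map_mul]
    exact hP.mul hQ
  | add P Q hP hQ =>
    rw [map_add, map_add]
    simpa using hP.add_smul hQ 1

end Functional

/-! ### The induced trace -/

section Trace

variable {A : Type*} [Ring A] [Algebra ℂ A]

/-- The encoding, with the edge `e₀` as a hole, of the graph obtained from `u`, `t` and `v` by
identifying the vertices as in the trace of the product of `u`, `t` and `v`. -/
def contextData {S : Type*} (u t v : GraphMonomial S) (e₀ : t.E) :
    Set ((Option ((u.E ⊕ {e : t.E // e ≠ e₀}) ⊕ v.E) → ℚ) ×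
      (Option ((u.E ⊕ {e : t.E // e ≠ e₀}) ⊕ v.E) → ℚ)) :=
  open scoped Classical in
  {q | ∃ x z w, u.IsPotential (fun e => q.1 (some (.inl (.inl e))),
      fun e => q.2 (some (.inl (.inl e)))) w x ∧
    t.IsPotential (fun e => if h : e = e₀ then q.1 none else q.1 (some (.inl (.inr ⟨e, h⟩))),
      fun e => if h : e = e₀ then q.2 none else q.2 (some (.inl (.inr ⟨e, h⟩)))) z w ∧
    v.IsPotential (fun e => q.1 (some (.inr e)), fun e => q.2 (some (.inr e))) x z}

/-- The labels of the edges other than the hole. -/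
def contextLabel {S : Type*} (u t v : GraphMonomial S) (e₀ : t.E) :
    (u.E ⊕ {e : t.E // e ≠ e₀}) ⊕ v.E → S :=
  Sum.elim (Sum.elim u.label fun e => t.label e.1) v.label

variable (φ : A →ₗ[ℂ] ℂ) (htracial : ∀ a b : A, φ (a * b) = φ (b * a))

theorem stateExt_subst (u t v : GraphMonomial A) (e₀ : t.E) (X : GraphPoly A) :
    stateExt φ htracial (GraphPoly.of u * GraphPoly.subst t e₀ X * GraphPoly.of v) =
      plug φ htracial (contextData u t v e₀) (contextLabel u t v e₀) X := by
  classical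
  have h : stateExt φ htracial ∘ₗ LinearMap.mulRight ℂ (GraphPoly.of v) ∘ₗ
      LinearMap.mulLeft ℂ (GraphPoly.of u) ∘ₗ GraphPoly.subst t e₀ =
      plug φ htracial (contextData u t v e₀) (contextLabel u t v e₀) := by
    refine GraphPoly.hom_ext fun m => ?_
    rw [LinearMap.comp_apply, LinearMap.comp_apply, LinearMap.comp_apply, GraphPoly.subst_of,
      LinearMap.mulLeft_apply, LinearMap.mulRight_apply, GraphPoly.of_mul_of, GraphPoly.of_mul_of,
      stateExt_of, plug_of]
    refine cactusSum_equiv φ htracial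
      ((Equiv.sumAssoc (u.E ⊕ {e : t.E // e ≠ e₀}) v.E m.E).trans <|
        ((Equiv.refl _).sumCongr (Equiv.sumComm v.E m.E)).trans <|
        (Equiv.sumAssoc (u.E ⊕ {e : t.E // e ≠ e₀}) m.E v.E).symm.trans <|
        (Equiv.sumAssoc u.E {e : t.E // e ≠ e₀} m.E).sumCongr (Equiv.refl v.E))
      (D' := ((u.comp (t.subst e₀ m)).comp v).closedData) (fun p => ?_) ?_
    · constructor
      · rintro ⟨x, hx⟩
        obtain ⟨z, h1, hv⟩ := GraphMonomial.isPotential_comp.1 hx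
        obtain ⟨w, hu, h2⟩ := GraphMonomial.isPotential_comp.1 h1
        obtain ⟨a, b, hm, ht⟩ := GraphMonomial.isPotential_subst.1 h2
        exact ⟨a, b, hm, x, z, w, hu, ht, hv⟩
      · rintro ⟨a, b, hm, x, z, w, hu, ht, hv⟩
        exact ⟨x, GraphMonomial.isPotential_comp.2 ⟨z, GraphMonomial.isPotential_comp.2
          ⟨w, hu, GraphMonomial.isPotential_subst.2 ⟨a, b, hm, ht⟩⟩, hv⟩⟩
    · rintro (((e | e) | e) | e) <;> rfl
  exact LinearMap.congr_fun h X

theorem stateExt_of_mul_of_mul_of (u t v : GraphMonomial A) (e₀ : t.E) :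
    stateExt φ htracial (GraphPoly.of u * GraphPoly.of t * GraphPoly.of v) =
      cactusSum φ htracial (contextData u t v e₀)
        (fun o => o.elim (t.label e₀) (contextLabel u t v e₀)) := by
  classical
  rw [GraphPoly.of_mul_of, GraphPoly.of_mul_of, stateExt_of]
  let g : Option ((u.E ⊕ {e : t.E // e ≠ e₀}) ⊕ v.E) ≃ (u.E ⊕ t.E) ⊕ v.E :=
    { toFun := fun o => o.elim (.inl (.inr e₀)) (Sum.map (Sum.map id Subtype.val) id)
      invFun := Sum.elim (Sum.elim (fun e => some (.inl (.inl e)))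
        fun e => if h : e = e₀ then none else some (.inl (.inr ⟨e, h⟩))) fun e => some (.inr e)
      left_inv := by
        rintro (_ | (e | ⟨e, he⟩) | e)
        · simp
        · rfl
        · simp [he]
        · rfl
      right_inv := by
        rintro ((e | e) | e)
        · rfl
        · by_cases he : e = e₀ <;> simp [he]
        · rfl }
  refine cactusSum_equiv φ htracial g (D' := ((u.comp t).comp v).closedData) (fun p => ?_) ?_
  · have hd : ∀ k : (u.E ⊕ t.E) ⊕ v.E → ℚ, (fun e => if h : e = e₀ then (k ∘ g) none else
        (k ∘ g) (some (.inl (.inr ⟨e, h⟩)))) = fun e => k (.inl (.inr e)) := by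
      intro k
      funext e
      by_cases he : e = e₀
      · subst he
        rw [dif_pos rfl]
        rfl
      · rw [dif_neg he]
        rfl
    constructor
    · rintro ⟨x, hx⟩
      obtain ⟨z, h1, hv⟩ := GraphMonomial.isPotential_comp.1 hx
      obtain ⟨w, hu, ht⟩ := GraphMonomial.isPotential_comp.1 h1
      refine ⟨x, z, w, hu, ?_, hv⟩
      rw [hd, hd]
      exact ht
    · rintro ⟨x, z, w, hu, ht, hv⟩
      rw [hd, hd] at ht
      exact ⟨x, GraphMonomial.isPotential_comp.2 ⟨z, GraphMonomial.isPotential_comp.2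
          ⟨w, hu, ht⟩, hv⟩⟩
  · rintro (_ | (e | e) | e) <;> rfl

/-- The functional is invariant under the relations of the free `𝒢`-algebra, within all products. -/
theorem stateExt_rel (hunital : φ 1 = 1) {X Y : GraphPoly A} (h : RingQuot.Rel (UERel A) X Y) :
    ∀ U V, stateExt φ htracial (U * X * V) = stateExt φ htracial (U * Y * V) := by
  induction h with
  | of h =>
    obtain ⟨t, e₀, n, b, P, h⟩ := h
    intro U V
    set Z := GraphPoly.subst t e₀
      (FreeAlgebra.lift ℂ (fun i => GraphPoly.of (GraphMonomial.edge (b i))) P)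
    have h1 : ∀ u v, stateExt φ htracial (GraphPoly.of u * GraphPoly.of t * GraphPoly.of v) =
        stateExt φ htracial (GraphPoly.of u * Z * GraphPoly.of v) := by
      intro u v
      rw [stateExt_subst, stateExt_of_mul_of_mul_of φ htracial u t v e₀,
        evaluates_lift hunital b P, h]
    have h2 : ∀ u, stateExt φ htracial ∘ₗ LinearMap.mulLeft ℂ (GraphPoly.of u * GraphPoly.of t) =
        stateExt φ htracial ∘ₗ LinearMap.mulLeft ℂ (GraphPoly.of u * Z) :=
      fun u => GraphPoly.hom_ext fun v => h1 u v
    have h3 : stateExt φ htracial ∘ₗ LinearMap.mulRight ℂ (GraphPoly.of t * V) =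
        stateExt φ htracial ∘ₗ LinearMap.mulRight ℂ (Z * V) := by
      refine GraphPoly.hom_ext fun u => ?_
      have := LinearMap.congr_fun (h2 u) V
      simpa only [LinearMap.comp_apply, LinearMap.mulLeft_apply, LinearMap.mulRight_apply,
        mul_assoc] using this
    have := LinearMap.congr_fun h3 U
    simpa only [LinearMap.comp_apply, LinearMap.mulRight_apply, mul_assoc] using this
  | add_left _ ih =>
    intro U V
    simp only [mul_add, add_mul, map_add, ih]
  | mul_left _ ih =>
    intro U V
    simpa only [mul_assoc] using ih U (_ * V)
  | mul_right _ ih =>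
    intro U V
    simpa only [mul_assoc] using ih (U * _) V

theorem stateExt_eq_of_mkAlgHom_eq (hunital : φ 1 = 1) {X Y : GraphPoly A}
    (h : RingQuot.mkAlgHom ℂ (UERel A) X = RingQuot.mkAlgHom ℂ (UERel A) Y) :
    stateExt φ htracial X = stateExt φ htracial Y := by
  have h' : RingQuot.mkRingHom (UERel A) X = RingQuot.mkRingHom (UERel A) Y := by
    rw [← RingQuot.mkAlgHom_coe ℂ]
    exact h
  simp only [RingQuot.mkRingHom_def, RingHom.coe_mk, MonoidHom.coe_mk, OneHom.coe_mk,
    RingQuot.mk.injEq] at h'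
  replace h := Quot.eqvGen_exact h'
  clear h'
  induction h with
  | rel X Y h => simpa using stateExt_rel φ htracial hunital h 1 1
  | refl X => rfl
  | symm X Y _ ih => exact ih.symm
  | trans X Y Z _ _ ih ih' => exact ih.trans ih'

theorem exists_trace (hunital : φ 1 = 1) : ∃ ψ : UE A →ₗ[ℂ] ℂ, ∀ t : GraphMonomial A,
    ψ (UE.mk t) = cactusSum φ htracial t.closedData t.label := by
  -- The free `𝒢`-algebra is a quotient of the vector space of graph polynomials.
  set q : GraphPoly A →ₗ[ℂ] UE A := (RingQuot.mkAlgHom ℂ (UERel A)).toLinearMap with hq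
  have hsurj : Surjective q := RingQuot.mkAlgHom_surjective ℂ (UERel A)
  have hker : LinearMap.ker q ≤ LinearMap.ker (stateExt φ htracial) := by
    intro X hX
    rw [LinearMap.mem_ker] at hX ⊢
    rw [← map_zero (stateExt φ htracial)]
    exact stateExt_eq_of_mkAlgHom_eq φ htracial hunital (hX.trans (map_zero q).symm)
  refine ⟨(LinearMap.ker q).liftQ _ hker ∘ₗ (q.quotKerEquivOfSurjective hsurj).symm.toLinearMap,
    fun t => ?_⟩
  have h : (q.quotKerEquivOfSurjective hsurj).symm (UE.mk t) =
      (LinearMap.ker q).mkQ (GraphPoly.of t) := by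
    rw [LinearEquiv.symm_apply_eq]
    rfl
  rw [LinearMap.comp_apply, LinearEquiv.coe_coe, h, Submodule.mkQ_apply, Submodule.liftQ_apply,
    stateExt_of]

end Trace

/-! ### Diagonal graph monomials -/

section Diagonal

theorem GraphMonomial.comp_comm_iso {S : Type*} {t t' : GraphMonomial S} (h : t.inp = t.out)
    (h' : t'.inp = t'.out) : Iso (t.comp t') (t'.comp t) := by
  have key : ∀ {s s' : GraphMonomial S}, s.inp = s.out → s'.inp = s'.out →
      ∀ x y : s.V ⊕ s'.V, x = .inl s.inp ∧ y = .inr s'.out →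
        (Quot.mk _ x.swap : (s'.comp s).V) = Quot.mk _ y.swap := by
    rintro s s' hs hs' _ _ ⟨rfl, rfl⟩
    rw [hs, ← hs']
    exact (Quot.sound ⟨rfl, rfl⟩).symm
  refine ⟨⟨Quot.lift (fun x => Quot.mk _ x.swap) (key h h'),
    Quot.lift (fun x => Quot.mk _ x.swap) (key h' h), ?_, ?_⟩, Equiv.sumComm _ _,
    ?_, ?_, ?_, ?_, ?_⟩
  · rintro ⟨x⟩
    exact congrArg (Quot.mk _) (Sum.swap_swap x)
  · rintro ⟨x⟩
    exact congrArg (Quot.mk _) (Sum.swap_swap x)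
  · rintro (e | e) <;> rfl
  · rintro (e | e) <;> rfl
  · rintro (e | e) <;> rfl
  · change (Quot.mk _ (Sum.inl t'.inp) : (t'.comp t).V) = Quot.mk _ (Sum.inr t.inp)
    rw [h]
    exact Quot.sound ⟨rfl, rfl⟩
  · change (Quot.mk _ (Sum.inr t.out) : (t'.comp t).V) = Quot.mk _ (Sum.inl t'.out)
    rw [← h']
    exact (Quot.sound ⟨rfl, rfl⟩).symm

variable {A : Type*} [Ring A] [Algebra ℂ A]

theorem UE.mk_eq_of_iso {t t' : GraphMonomial A} (h : GraphMonomial.Iso t t') :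
    UE.mk t = UE.mk t' := by
  unfold UE.mk GraphPoly.of
  rw [show Monomial.mk t = Monomial.mk t' from Quotient.sound h]

theorem UE.mk_mul_comm {t t' : GraphMonomial A} (h : t.inp = t.out) (h' : t'.inp = t'.out) :
    UE.mk t * UE.mk t' = UE.mk t' * UE.mk t := by
  rw [UE.mk_mul, UE.mk_mul, UE.mk_eq_of_iso (GraphMonomial.comp_comm_iso h h')]

theorem mul_comm_of_mem_diagonalAlgebra {D D' : Subalgebra ℂ A} {x y : UE A}
    (hx : x ∈ diagonalAlgebra D) (hy : y ∈ diagonalAlgebra D') : x * y = y * x := by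
  change x ∈ Submodule.span ℂ _ at hx
  change y ∈ Submodule.span ℂ _ at hy
  induction hx, hy using Submodule.span_induction₂ with
  | mem_mem x y hx hy =>
    obtain ⟨t, ht, rfl⟩ := hx
    obtain ⟨t', ht', rfl⟩ := hy
    exact UE.mk_mul_comm ht.1 ht'.1
  | zero_left y => simp
  | zero_right x => simp
  | add_left x y z _ _ _ h1 h2 => rw [add_mul, mul_add, h1, h2]
  | add_right x y z _ _ _ h1 h2 => rw [add_mul, mul_add, h1, h2]
  | smul_left r x y _ _ h => rw [smul_mul_assoc, mul_smul_comm, h]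
  | smul_right r x y _ _ h => rw [smul_mul_assoc, mul_smul_comm, h]

/-- The span of the diagonal graph monomials with all labels in the algebras `S j`, `j ∈ J`. -/
def mixedDiagonal {I : Type*} (S : I → Subalgebra ℂ A) (J : Set I) : Submodule ℂ (UE A) :=
  Submodule.span ℂ {x | ∃ t : GraphMonomial A, t.inp = t.out ∧
    (∃ c : t.E → I, ∀ e, c e ∈ J ∧ t.label e ∈ S (c e)) ∧ UE.mk t = x}

theorem mixedDiagonal_mono {I : Type*} (S : I → Subalgebra ℂ A) {J K : Set I} (h : J ⊆ K) :
    mixedDiagonal S J ≤ mixedDiagonal S K := by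
  refine Submodule.span_mono ?_
  rintro _ ⟨t, ht, ⟨c, hc⟩, rfl⟩
  exact ⟨t, ht, ⟨c, fun e => ⟨h (hc e).1, (hc e).2⟩⟩, rfl⟩

theorem one_mem_mixedDiagonal {I : Type*} (S : I → Subalgebra ℂ A) (J : Set I) :
    1 ∈ mixedDiagonal S J :=
  Submodule.subset_span ⟨GraphMonomial.triv, rfl, ⟨Empty.elim, fun e => e.elim⟩, UE.mk_triv⟩

theorem mul_mem_mixedDiagonal {I : Type*} {S : I → Subalgebra ℂ A} {J : Set I} {i : I} {x y : UE A}
    (hx : x ∈ diagonalAlgebra (S i)) (hy : y ∈ mixedDiagonal S J) :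
    x * y ∈ mixedDiagonal S (insert i J) := by
  have hxy := Submodule.mul_mem_mul (M := Submodule.span ℂ _) hx hy
  rw [mixedDiagonal, Submodule.span_mul_span] at hxy
  refine Submodule.span_mono ?_ hxy
  rintro _ ⟨_, ⟨t, ht, rfl⟩, _, ⟨t', ht', ⟨c, hc⟩, rfl⟩, rfl⟩
  refine ⟨t.comp t', ?_, ⟨Sum.elim (fun _ => i) c, ?_⟩, (UE.mk_mul t t').symm⟩
  · change (Quot.mk _ (Sum.inr t'.inp) : (t.comp t').V) = Quot.mk _ (Sum.inl t.out)
    rw [ht', ← ht.1]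
    exact (Quot.sound ⟨rfl, rfl⟩).symm
  · rintro (e | e)
    · exact ⟨.inl rfl, ht.2 e⟩
    · exact ⟨.inr (hc e).1, (hc e).2⟩

variable (φ : A →ₗ[ℂ] ℂ) (htracial : ∀ a b : A, φ (a * b) = φ (b * a))

theorem cactusSum_of_isEmpty {E : Type*} [IsEmpty E] {D : Set ((E → ℚ) × (E → ℚ))}
    (hD : D.Nonempty) (ℓ : E → A) : cactusSum φ htracial D ℓ = 1 := by
  obtain ⟨p, hp⟩ := hD
  rw [cactusSum, finsum_eq_single _ 1 fun ρ hρ => absurd (Subsingleton.elim ρ 1) hρ,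
    if_pos (show IsCactusPerm D 1 from fun h =>
      ⟨p, hp, fun e => isEmptyElim e, fun e => isEmptyElim e⟩), permCumulant, orbitProd,
    Set.univ_eq_empty_iff.2 inferInstance, Set.image_empty, finprod_mem_empty]

/-- For two diagonal graph monomials the closure of the product consists of the two graphs with a
common vertex, and only the permutations that do not mix their edges contribute. -/
theorem cactusSum_comp (hunital : φ 1 = 1) {I : Type*} {S : I → Subalgebra ℂ A}
    (hfree : NCProb.FreelyIndependent φ S) {t t' : GraphMonomial A} (ht : t.inp = t.out)
    (ht' : t'.inp = t'.out) {i : I} (hi : ∀ e, t.label e ∈ S i) {c : t'.E → I}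
    (hc : ∀ e, t'.label e ∈ S (c e)) (hne : ∀ e, i ≠ c e) :
    cactusSum φ htracial (t.comp t').closedData (t.comp t').label =
      cactusSum φ htracial t.closedData t.label * cactusSum φ htracial t'.closedData t'.label := by
  refine cactusSum_sum (E := t.E) (F := t'.E) φ htracial (t.comp t').label ?_ ?_ ?_ ?_
  · rintro p ⟨x, hp⟩
    obtain ⟨z, h1, -⟩ := GraphMonomial.isPotential_comp.1 hp
    obtain rfl := h1.eq_of_inp_eq_out ht
    exact ⟨_, h1⟩
  · rintro p ⟨x, hp⟩
    obtain ⟨z, -, h2⟩ := GraphMonomial.isPotential_comp.1 hp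
    obtain rfl := h2.eq_of_inp_eq_out ht'
    exact ⟨_, h2⟩
  · rintro p ⟨x, hp⟩ q ⟨y, hq⟩
    have hq' := hq.add_const (x - y)
    rw [add_sub_cancel] at hq'
    exact ⟨x - y, x, GraphMonomial.isPotential_comp.2 ⟨x, hp, hq'⟩⟩
  · intro ρ e e' he
    refine permCumulant_eq_zero_of_mixed φ htracial hunital hfree ρ _
      (Sum.elim (fun _ => i) c) ?_ (x := .inl e) ?_
    · rintro (e | e)
      · exact hi e
      · exact hc e
    · rw [he]
      exact hne e'

variable {φ htracial}

theorem map_mul_of_mixedDiagonal (hunital : φ 1 = 1) {I : Type*} {S : I → Subalgebra ℂ A}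
    (hfree : NCProb.FreelyIndependent φ S) {ψ : UE A →ₗ[ℂ] ℂ} (hψ : ∀ t : GraphMonomial A,
      ψ (UE.mk t) = cactusSum φ htracial t.closedData t.label) {J : Set I} {i : I} (hi : i ∉ J)
    {x y : UE A} (hx : x ∈ diagonalAlgebra (S i)) (hy : y ∈ mixedDiagonal S J) :
    ψ (x * y) = ψ x * ψ y := by
  change x ∈ Submodule.span ℂ _ at hx
  rw [mixedDiagonal] at hy
  induction hx, hy using Submodule.span_induction₂ with
  | mem_mem x y hx hy =>
    obtain ⟨t, ht, rfl⟩ := hx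
    obtain ⟨t', ht', ⟨c, hc⟩, rfl⟩ := hy
    rw [UE.mk_mul, hψ, hψ, hψ]
    exact cactusSum_comp φ htracial hunital hfree ht.1 ht' ht.2 (fun e => (hc e).2)
      fun e h => hi (h ▸ (hc e).1)
  | zero_left y => simp
  | zero_right x => simp
  | add_left x y z _ _ _ h1 h2 => rw [add_mul, map_add, map_add, h1, h2, add_mul]
  | add_right x y z _ _ _ h1 h2 => rw [mul_add, map_add, map_add, h1, h2, mul_add]
  | smul_left r x y _ _ h => rw [smul_mul_assoc, map_smul, map_smul, h, smul_mul_assoc]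
  | smul_right r x y _ _ h => rw [mul_smul_comm, map_smul, map_smul, h, mul_smul_comm]

theorem prod_mem_mixedDiagonal {I : Type*} {S : I → Subalgebra ℂ A} {n : ℕ} {i : Fin n → I}
    {a : Fin n → UE A} (ha : ∀ j, a j ∈ diagonalAlgebra (S (i j))) :
    (List.ofFn a).prod ∈ mixedDiagonal S (Set.range i) := by
  induction n with
  | zero =>
    rw [List.ofFn_zero, List.prod_nil]
    exact one_mem_mixedDiagonal S _
  | succ n ih =>
    rw [List.ofFn_succ, List.prod_cons]
    refine mixedDiagonal_mono S ?_ (mul_mem_mixedDiagonal (ha 0) (ih fun j => ha j.succ))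
    rintro _ (rfl | ⟨j, rfl⟩)
    · exact ⟨0, rfl⟩
    · exact ⟨j.succ, rfl⟩

theorem map_prod_of_diagonal (hunital : φ 1 = 1) {I : Type*} {S : I → Subalgebra ℂ A}
    (hfree : NCProb.FreelyIndependent φ S) {ψ : UE A →ₗ[ℂ] ℂ} (hψ : ∀ t : GraphMonomial A,
      ψ (UE.mk t) = cactusSum φ htracial t.closedData t.label) {n : ℕ} {i : Fin n → I}
    {a : Fin n → UE A} (hi : Injective i) (ha : ∀ j, a j ∈ diagonalAlgebra (S (i j))) :
    ψ (List.ofFn a).prod = ∏ j, ψ (a j) := by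
  induction n with
  | zero =>
    rw [List.ofFn_zero, List.prod_nil, Finset.univ_eq_empty, Finset.prod_empty, ← UE.mk_triv, hψ]
    have : IsEmpty (GraphMonomial.triv : GraphMonomial A).E := inferInstanceAs (IsEmpty Empty)
    have hD : (GraphMonomial.triv : GraphMonomial A).closedData.Nonempty :=
      ⟨0, 0, GraphMonomial.isPotential_triv.2 rfl⟩
    exact cactusSum_of_isEmpty φ htracial hD _
  | succ n ih =>
    rw [List.ofFn_succ, List.prod_cons, Fin.prod_univ_succ,
      map_mul_of_mixedDiagonal hunital hfree hψ (J := Set.range fun j : Fin n => i j.succ) ?_ (ha 0)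
        (prod_mem_mixedDiagonal fun j => ha j.succ),
      ih (fun j k h => Fin.succ_injective n (hi h)) fun j => ha j.succ]
    rintro ⟨j, hj⟩
    exact Fin.succ_ne_zero j (hi hj)

end Diagonal

end Traffic

end

theorem mainTheorem2 {A : Type*} [Ring A] [Algebra ℂ A] [StarRing A] [StarModule ℂ A]
    (φ : A →ₗ[ℂ] ℂ) (hunital : φ 1 = 1) (htracial : ∀ a b : A, φ (a * b) = φ (b * a))
    (hpos : ∀ a : A, 0 ≤ φ (star a * a))
    {I : Type*} (S : I → StarSubalgebra ℂ A)
    (hfree : NCProb.FreelyIndependent φ fun i => (S i).toSubalgebra) :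
    ∃ ψ : Traffic.UE A →ₗ[ℂ] ℂ, Traffic.IsInducedTrace φ ψ ∧
      (∀ i, ∀ x ∈ Traffic.diagonalAlgebra (S i).toSubalgebra,
        ∀ y ∈ Traffic.diagonalAlgebra (S i).toSubalgebra, x * y = y * x) ∧
      NCProb.ClassicallyIndependent ψ fun i =>
        Traffic.diagonalAlgebra (S i).toSubalgebra := by
  obtain ⟨ψ, hψ⟩ := Traffic.exists_trace φ htracial hunital
  refine ⟨ψ, fun t => ?_, fun i x hx y hy => Traffic.mul_comm_of_mem_diagonalAlgebra hx hy,
    fun i j _ x hx y hy => Traffic.mul_comm_of_mem_diagonalAlgebra hx hy,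
    fun n i a hi ha => Traffic.map_prod_of_diagonal hunital hfree hψ hi ha⟩
  rw [hψ, Traffic.trafficState_eq_cactusSum φ htracial, t.data_closure]
  rfl
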